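/- Let $l>0$, $\rho^1<\rho^2$ (Rayleigh–Taylor stable case) and $H^3_l(\mathbb R)=H^3(\mathbb R)\cap\{f:\|f\|_{L^\infty}<l\}$. Let $f_0\in H^3_l(\mathbb R)$ and let $f\in C([0,T],H^3_l(\mathbb R))\cap C([0,T],C^2(\mathbb R))\cap C^1([0,T],C(\mathbb R))$, $T>0$, be a classical solution with $f(\cdot,0)=f_0$ of the confined Muskat equation $$\partial_t f(x,t)=\frac{\rho^2-\rho^1}{8l}\,\mathrm{P.V.}\!\int_{\mathbb R}\Big[(\partial_xf(x)-\partial_xf(x-\eta))\,\Xi_1(x,\eta)+(\partial_xf(x)+\partial_xf(x-\eta))\,\Xi_2(x,\eta)\Big]d\eta,$$ $$\Xi_1=\frac{\sinh(\frac{\pi}{2l}\eta)}{\cosh(\frac{\pi}{2l}\eta)-\cos(\frac{\pi}{2l}(f(x)-f(x-\eta)))},\qquad \Xi_2=\frac{\sinh(\frac{\pi}{2l}\eta)}{\cosh(\frac{\pi}{2l}\eta)+\cos(\frac{\pi}{2l}(f(x)+f(x-\eta)))},$$ where the time variable of $f$ is suppressed on the right and the principal value is the limit of the integrals over $\{\varepsilon\le|\eta|\le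 R\}$ as $\varepsilon\to0^+$, $R\to\infty$. Put $$\Phi_l(a,b)=\Big(b+\big|2(\cos\tfrac{\pi}{2l}-2)\sec^4\tfrac{\pi}{4l}\big|\,b^3\Big)\,\frac{1+b\Big(b+\frac{\tan(\frac{\pi}{2l}\frac b2)}{\tanh(\frac{\pi}{4l})}\Big)}{6\tanh(\frac{\pi}{4l})}\Big(\frac{\pi}{2l}\Big)^5+4\tan\Big(\frac{\pi}{2l}a\Big)-4b\cos\Big(\frac{\pi}{l}a\Big).$$ (i) If $\|\partial_xf_0\|_{L^\infty}\le1$, $\ \tan\big(\frac{\pi\|f_0\|_{L^\infty}}{2l}\big)<\|\partial_xf_0\|_{L^\infty}\tanh\big(\frac{\pi}{4l}\big)$ and $\Phi_l(\|f_0\|_{L^\infty},\|\partial_xf_0\|_{L^\infty})\le0$, then $\|\partial_xf(t)\|_{L^\infty}\le\|\partial_xf_0\|_{L^\infty}$ for all $t\in[0,T]$. (ii) Let $(x(l),y(l))$, with $0<x(l)<l$ and $0<y(l)<2l$, be the solution (when it exists) of the system $$\tan\Big(\frac{\pi x}{2l}\Big)-y\tanh\Big(\frac{\pi}{4l}\Big)=0,\qquad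 \Phi_l(x,y)=0.$$ If $\|f_0\|_{L^\infty}<x(l)$, $\|\partial_xf_0\|_{L^\infty}<y(l)$ and $\|\partial_xf_0\|_{L^\infty}\le1$ (the last condition being automatic when $y(l)\le1$), then $\|\partial_xf(t)\|_{L^\infty}\le1$ for all $t\in[0,T]$. -/

import Mathlib

open Set Filter Topology MeasureTheory
open scoped ContDiff

noncomputable section

namespace Muskat

/-- The `L^∞` norm on the line (essential supremum of `|g|` for Lebesgue measure), as a real
number. -/
def linfNorm (g : ℝ → ℝ) : ℝ := (eLpNorm g ⊤ volume).toReal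

/-- `g` is the `k`-th weak (distributional) derivative of `f` on the line. -/
def IsWeakDeriv (k : ℕ) (f g : ℝ → ℝ) : Prop :=
  ∀ φ : ℝ → ℝ, ContDiff ℝ ∞ φ → HasCompactSupport φ →
    ∫ x, f x * iteratedDeriv k φ x = (-1) ^ k * ∫ x, g x * φ x

/-- `f ∈ H^s(ℝ)`: `f` and its weak derivatives up to order `s` are in `L²(ℝ)`. -/
def MemH (s : ℕ) (f : ℝ → ℝ) : Prop :=
  MemLp f 2 volume ∧ ∀ k ≤ s, ∃ g : ℝ → ℝ, MemLp g 2 volume ∧ IsWeakDeriv k f g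

/-- `f ∈ H^s_l(ℝ) = H^s(ℝ) ∩ {f : ‖f‖_{L^∞} < l}`. -/
def MemHl (s : ℕ) (l : ℝ) (f : ℝ → ℝ) : Prop :=
  MemH s f ∧ eLpNorm f ⊤ volume < ENNReal.ofReal l

/-- `f ∈ C([0,T], H^s_l(ℝ))`: each `f t` is in `H^s_l(ℝ)`, and the weak derivatives of orders
`k ≤ s` depend continuously on `t ∈ [0,T]` in `L²(ℝ)`. -/
def ContinuousInHl (s : ℕ) (l T : ℝ) (f : ℝ → ℝ → ℝ) : Prop :=
  (∀ t ∈ Icc 0 T, MemHl s l (f t)) ∧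
  ∀ k ≤ s, ∃ g : ℝ → ℝ → ℝ,
    (∀ t ∈ Icc 0 T, MemLp (g t) 2 volume ∧ IsWeakDeriv k (f t) (g t)) ∧
    ∀ t₀ ∈ Icc 0 T,
      Tendsto (fun t => eLpNorm (g t - g t₀) 2 volume) (𝓝[Icc 0 T] t₀) (𝓝 0)

/-- `f ∈ C([0,T], C^k(ℝ))`: each `f t` is `C^k`, and the derivatives up to order `k` depend
continuously on `t ∈ [0,T]` in the topology of uniform convergence. -/
def ContinuousInC (k : ℕ) (T : ℝ) (f : ℝ → ℝ → ℝ) : Prop :=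
  (∀ t ∈ Icc 0 T, ContDiff ℝ k (f t)) ∧
  ∀ j ≤ k, ∀ t₀ ∈ Icc 0 T,
    TendstoUniformly (fun t => iteratedDeriv j (f t)) (iteratedDeriv j (f t₀)) (𝓝[Icc 0 T] t₀)

/-- `P.V. ∫_ℝ g(η) dη = I`, the principal value at `0` and at infinity: the limit of the integrals
over `{ε ≤ |η| ≤ R}` as `ε → 0⁺` and `R → ∞`. -/
def HasPVIntegral (g : ℝ → ℝ) (I : ℝ) : Prop :=
  Tendsto (fun p : ℝ × ℝ => (∫ η in (-p.2)..(-p.1), g η) + ∫ η in p.1..p.2, g η)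
    ((𝓝[>] (0 : ℝ)) ×ˢ atTop) (𝓝 I)

/-- The kernel `Ξ₁`. -/
def kernelOne (l : ℝ) (f : ℝ → ℝ) (x η : ℝ) : ℝ :=
  Real.sinh (Real.pi / (2 * l) * η) /
    (Real.cosh (Real.pi / (2 * l) * η) - Real.cos (Real.pi / (2 * l) * (f x - f (x - η))))

/-- The kernel `Ξ₂`. -/
def kernelTwo (l : ℝ) (f : ℝ → ℝ) (x η : ℝ) : ℝ :=
  Real.sinh (Real.pi / (2 * l) * η) /
    (Real.cosh (Real.pi / (2 * l) * η) + Real.cos (Real.pi / (2 * l) * (f x + f (x - η))))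

/-- The integrand of the contour equation for the confined Muskat problem. -/
def muskatIntegrand (l : ℝ) (f : ℝ → ℝ) (x η : ℝ) : ℝ :=
  (deriv f x - deriv f (x - η)) * kernelOne l f x η +
    (deriv f x + deriv f (x - η)) * kernelTwo l f x η

/-- `f` (time first, space second) is a classical solution on `[0,T]`, with initial datum `f₀`, of
`∂ₜf = (ρ₂ - ρ₁)/(8l) P.V. ∫ [(∂ₓf(x) - ∂ₓf(x-η)) Ξ₁ + (∂ₓf(x) + ∂ₓf(x-η)) Ξ₂] dη`, with
`f ∈ C([0,T], H³_l(ℝ)) ∩ C([0,T], C²(ℝ)) ∩ C¹([0,T], C(ℝ))`. -/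
structure IsClassicalSolution (l ρ₁ ρ₂ T : ℝ) (f₀ : ℝ → ℝ) (f : ℝ → ℝ → ℝ) : Prop where
  initial : f 0 = f₀
  sobolev : ContinuousInHl 3 l T f
  space : ContinuousInC 2 T f
  evolution : ∃ ft : ℝ → ℝ → ℝ, ContinuousInC 0 T ft ∧
    ∀ t ∈ Icc 0 T, ∀ x : ℝ,
      HasDerivWithinAt (fun τ => f τ x) (ft t x) (Icc 0 T) t ∧
      ∃ I : ℝ, HasPVIntegral (muskatIntegrand l (f t) x) I ∧ ft t x = (ρ₂ - ρ₁) / (8 * l) * I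

/-- The left-hand side of the condition `Φ_l(a, b) ≤ 0` (third smallness condition, with
`a = ‖f₀‖_{L^∞}` and `b = ‖∂ₓf₀‖_{L^∞}`), and of the second equation of the system for
`(x(l), y(l))`. -/
def smallnessFun (l a b : ℝ) : ℝ :=
  (b + |2 * (Real.cos (Real.pi / (2 * l)) - 2) * (1 / Real.cos (Real.pi / (4 * l))) ^ 4| * b ^ 3)
      * ((1 + b * (b + Real.tan (Real.pi / (2 * l) * (b / 2)) / Real.tanh (Real.pi / (4 * l))))
          / (6 * Real.tanh (Real.pi / (4 * l))))
      * (Real.pi / (2 * l)) ^ 5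
    + 4 * Real.tan (Real.pi / (2 * l) * a) - 4 * b * Real.cos (Real.pi / l * a)

/-- `(x, y)` is the nontrivial solution of the system that defines `(x(l), y(l))`, with both tangents
on their principal branches: `0 < x < l` and `0 < y < 2l`. -/
structure IsThresholdPair (l x y : ℝ) : Prop where
  x_pos : 0 < x
  x_lt : x < l
  y_pos : 0 < y
  y_lt : y < 2 * l
  eq_one : Real.tan (Real.pi * x / (2 * l)) - y * Real.tanh (Real.pi / (4 * l)) = 0
  eq_two : smallnessFun l x y = 0

end Muskat

end

noncomputable section

namespace Muskat

/-- The error term in the bound for the second variation kernel. -/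
def slackPoly (T : ℝ) : ℝ := 7 / 20 * (1 - T) + 19 / 5 * T ^ 2 * (1 - T)

/-- The bound, divided by the slope, for the second variation kernel, with `m` the squared slope. -/
def boundPoly (m T : ℝ) : ℝ := 1 + T + m * (1 - 2 * T) + slackPoly T

theorem slackPoly_nonneg {T : ℝ} (h1 : T ≤ 1) : 0 ≤ slackPoly T := by
  unfold slackPoly
  have : 0 ≤ 1 - T := by linarith
  positivity

theorem boundPoly_nonneg {m T : ℝ} (hm0 : 0 ≤ m) (hm1 : m ≤ 1) (h0 : 0 ≤ T) (h1 : T ≤ 1) :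
    0 ≤ boundPoly m T := by
  have := slackPoly_nonneg h1
  unfold boundPoly
  nlinarith [mul_nonneg hm0 h0, mul_nonneg hm0 (sub_nonneg.2 h1), mul_nonneg (sub_nonneg.2 hm1) h0]

/-- The gain in the second kernel when the first one is positive. -/
def gainPoly (m T : ℝ) : ℝ := slackPoly T + (1 - m) * T ^ 2 + m ^ 2 * (T - T ^ 2)

theorem second_kernel_le {m T r : ℝ} (hm0 : 0 ≤ m) (hm1 : m ≤ 1) (h0 : 0 ≤ T) (h1 : T ≤ 1)
    (hr0 : 0 ≤ r) (hr1 : r ≤ 1) :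
    (1 + m * r ^ 2) * (1 + (1 - m) * T * r - m * T ^ 2 * r ^ 2) / (1 + m * T ^ 2 * r ^ 2) ^ 2
      ≤ boundPoly m T := by
  have hm1' : 0 ≤ 1 - m := by linarith
  have h1' : 0 ≤ 1 - T := by linarith
  have hq : 0 ≤ 1 - T ^ 2 := by nlinarith
  have hr2 : r ^ 2 ≤ 1 := by nlinarith
  have hb : 0 ≤ m * T ^ 2 * r ^ 2 := by positivity
  have hβ : 0 ≤ (1 - m) * T * r := by positivity
  have hA : (1 + m * r ^ 2) * (1 + (1 - m) * T * r - m * T ^ 2 * r ^ 2) / (1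
      + m * T ^ 2 * r ^ 2) ^ 2
      ≤ (1 + m * (1 - T ^ 2)) * (1 + (1 - m) * T) := by
    rw [div_le_iff₀ (by positivity)]
    have e1 : 1 + m * r ^ 2 ≤ (1 + m * (1 - T ^ 2)) * (1 + m * T ^ 2 * r ^ 2) := by
      have : 0 ≤ m * (1 - T ^ 2) * (1 - r ^ 2) := by
        have : 0 ≤ 1 - r ^ 2 := by linarith
        positivity
      have : 0 ≤ m * (1 - T ^ 2) * (m * T ^ 2 * r ^ 2) := by positivity
      nlinarith
    have e2 : 1 + (1 - m) * T * r - m * T ^ 2 * r ^ 2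
        ≤ (1 + (1 - m) * T) * (1 + m * T ^ 2 * r ^ 2) := by
      have h3 : (1 - m) * T * r ≤ (1 - m) * T := mul_le_of_le_one_right (by positivity) hr1
      have h4 : 0 ≤ (1 - m) * T * (m * T ^ 2 * r ^ 2) := by positivity
      nlinarith
    calc (1 + m * r ^ 2) * (1 + (1 - m) * T * r - m * T ^ 2 * r ^ 2)
        ≤ (1 + m * r ^ 2) * ((1 + (1 - m) * T) * (1 + m * T ^ 2 * r ^ 2)) := by gcongr
      _ ≤ ((1 + m * (1 - T ^ 2)) * (1 + m * T ^ 2 * r ^ 2))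
            * ((1 + (1 - m) * T) * (1 + m * T ^ 2 * r ^ 2)) := by gcongr
      _ = _ := by ring
  refine hA.trans ?_
  have h5 : m * (2 + T - m * (1 + T)) ≤ 9 / 8 := by
    nlinarith [sq_nonneg (4 * m - 3), mul_nonneg (mul_nonneg hm0 hm1') h1']
  have h6 : 0 ≤ (1 - T) * (7 / 20 + 19 / 5 * T ^ 2 - T * (m * (2 + T - m * (1 + T)))) := by
    apply mul_nonneg h1'
    nlinarith [mul_le_mul_of_nonneg_left h5 h0, sq_nonneg (T - 3 / 20)]
  unfold boundPoly slackPoly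
  nlinarith

theorem second_kernel_le_gain {m T r : ℝ} (hm0 : 0 ≤ m) (hm1 : m ≤ 1) (h0 : 0 ≤ T) (h1 : T ≤ 1)
    (hr0 : 0 ≤ r) (hr1 : r ≤ 1 - T) :
    (1 + m * r ^ 2) * (1 + (1 - m) * T * r - m * T ^ 2 * r ^ 2) / (1 + m * T ^ 2 * r ^ 2) ^ 2
      ≤ boundPoly m T - gainPoly m T := by
  have hm1' : 0 ≤ 1 - m := by linarith
  have h1' : 0 ≤ 1 - T := by linarith
  have hA : (1 + m * r ^ 2) * (1 + (1 - m) * T * r - m * T ^ 2 * r ^ 2) / (1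
      + m * T ^ 2 * r ^ 2) ^ 2
      ≤ (1 + m * r ^ 2) * (1 + (1 - m) * T * r) := by
    rw [div_le_iff₀ (by positivity)]
    have e1 : 1 ≤ (1 + m * T ^ 2 * r ^ 2) ^ 2 := by
      have : 0 ≤ m * T ^ 2 * r ^ 2 := by positivity
      nlinarith
    have e2 : 0 ≤ (1 + m * r ^ 2) * (1 + (1 - m) * T * r) := by positivity
    have e3 : 0 ≤ (1 + m * r ^ 2) * (m * T ^ 2 * r ^ 2) := by positivity
    nlinarith [mul_le_mul_of_nonneg_left e1 e2]
  have hB : (1 + m * r ^ 2) * (1 + (1 - m) * T * r)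
      ≤ (1 + m * (1 - T) ^ 2) * (1 + (1 - m) * T * (1 - T)) := by gcongr
  have hC : (1 - T) ^ 2 ≤ 1 := by nlinarith
  have hD : 0 ≤ m * (1 - m) * T * (1 - T) * (1 - (1 - T) ^ 2) := by
    have : 0 ≤ 1 - (1 - T) ^ 2 := by linarith
    positivity
  refine hA.trans (hB.trans ?_)
  unfold boundPoly gainPoly
  nlinarith [hD]

theorem bernstein_three_nonneg {c0 c1 c2 c3 m : ℝ} (hm0 : 0 ≤ m) (hm1 : m ≤ 1) (h0 : 0 ≤ c0)
    (h1 : 0 ≤ 3 * c0 + c1) (h2 : 0 ≤ 3 * c0 + 2 * c1 + c2) (h3 : 0 ≤ c0 + c1 + c2 + c3) :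
    0 ≤ c0 + c1 * m + c2 * m ^ 2 + c3 * m ^ 3 := by
  have hm : 0 ≤ 1 - m := by linarith
  have : c0 + c1 * m + c2 * m ^ 2 + c3 * m ^ 3 = (1 - m) ^ 3 * c0 + m * (1 - m) ^ 2 * (3 * c0 + c1)
      + m ^ 2 * (1 - m) * (3 * c0 + 2 * c1 + c2) + m ^ 3 * (c0 + c1 + c2 + c3) := by ring
  rw [this]
  positivity

theorem small_gain_coeff_zero {T : ℝ} (h0 : 0 ≤ T) (h1 : T ≤ 27/40) :
    1/100 ≤ 3 * (slackPoly T) - 1 := by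
  unfold slackPoly
  rcases le_total T (1/4) with h | h
  · nlinarith [sq_nonneg (T - 1/15), mul_nonneg (sq_nonneg T) (sub_nonneg.2 h)]
  · nlinarith [mul_nonneg (mul_nonneg (sub_nonneg.2 h) (sub_nonneg.2 h1)) h0,
        mul_nonneg (sub_nonneg.2 h) (sub_nonneg.2 h1)]

theorem small_gain_coeff_one {T : ℝ} (h0 : 0 ≤ T) (h1 : T ≤ 27/40) :
    0 ≤ 3 * (3 * (slackPoly T) - 1) + T^2 * (-3 + (1+3*T^2)*((slackPoly T) + T^2 - 1)) := by
  unfold slackPoly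
  rcases le_total T (1/4) with h | h
  · nlinarith [sq_nonneg (T - 1/15), mul_nonneg (sq_nonneg T) (sub_nonneg.2 h), pow_nonneg h0 3,
        pow_nonneg h0 4, mul_nonneg (pow_nonneg h0 4) (sub_nonneg.2 h)]
  · nlinarith [mul_nonneg (mul_nonneg (sub_nonneg.2 h) (sub_nonneg.2 h1)) h0,
        mul_nonneg (sub_nonneg.2 h) (sub_nonneg.2 h1),
        mul_nonneg (mul_nonneg (sub_nonneg.2 h) (sub_nonneg.2 h1)) (pow_nonneg h0 2),
        mul_nonneg (mul_nonneg (sub_nonneg.2 h) (sub_nonneg.2 h1)) (pow_nonneg h0 3),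
        mul_nonneg (mul_nonneg (sub_nonneg.2 h) (sub_nonneg.2 h1)) (pow_nonneg h0 5)]

theorem small_gain_coeff_two {T : ℝ} (h0 : 0 ≤ T) (h1 : T ≤ 27/40) :
    0 ≤ 3 * (3 * (slackPoly T) - 1) + 2 * (T^2 * (-3 + (1+3*T^2)*((slackPoly T) + T^2 - 1)))
    + (3*(T-T^2) - T^4*(1+3*T^2)) := by
  unfold slackPoly
  rcases le_total T (1/4) with h | h
  · nlinarith [sq_nonneg (T - 1/15), mul_nonneg (sq_nonneg T) (sub_nonneg.2 h), pow_nonneg h0 3,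
        pow_nonneg h0 4, mul_nonneg (pow_nonneg h0 4) (sub_nonneg.2 h)]
  · nlinarith [mul_nonneg (mul_nonneg (sub_nonneg.2 h) (sub_nonneg.2 h1)) h0,
        mul_nonneg (sub_nonneg.2 h) (sub_nonneg.2 h1),
        mul_nonneg (mul_nonneg (sub_nonneg.2 h) (sub_nonneg.2 h1)) (pow_nonneg h0 2),
        mul_nonneg (mul_nonneg (sub_nonneg.2 h) (sub_nonneg.2 h1)) (pow_nonneg h0 3),
        mul_nonneg (mul_nonneg (sub_nonneg.2 h) (sub_nonneg.2 h1)) (pow_nonneg h0 5)]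

theorem small_gain_coeff_three {T : ℝ} (h0 : 0 ≤ T) (h1 : T ≤ 27/40) :
    0 ≤ (3 * (slackPoly T) - 1) + (T^2 * (-3 + (1+3*T^2)*((slackPoly T) + T^2 - 1)))
    + (3*(T-T^2) - T^4*(1+3*T^2)) + (T-T^2)*T^2*(1+3*T^2) := by
  unfold slackPoly
  rcases le_total T (1/4) with h | h
  · nlinarith [sq_nonneg (T - 1/15), mul_nonneg (sq_nonneg T) (sub_nonneg.2 h), pow_nonneg h0 3,
        pow_nonneg h0 4, mul_nonneg (pow_nonneg h0 4) (sub_nonneg.2 h)]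
  · nlinarith [mul_nonneg (mul_nonneg (sub_nonneg.2 h) (sub_nonneg.2 h1)) h0,
        mul_nonneg (sub_nonneg.2 h) (sub_nonneg.2 h1),
        mul_nonneg (mul_nonneg (sub_nonneg.2 h) (sub_nonneg.2 h1)) (pow_nonneg h0 2),
        mul_nonneg (mul_nonneg (sub_nonneg.2 h) (sub_nonneg.2 h1)) (pow_nonneg h0 3),
        mul_nonneg (mul_nonneg (sub_nonneg.2 h) (sub_nonneg.2 h1)) (pow_nonneg h0 5)]

theorem large_gain_coeff_zero {T : ℝ} (h0 : 27/40 ≤ T) (h1 : T ≤ 1) :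
    0 ≤ T^3*((slackPoly T)+T^2) - (1-T) := by
  unfold slackPoly
  nlinarith [mul_nonneg (sub_nonneg.2 h0) (sub_nonneg.2 h1),
      mul_nonneg (mul_nonneg (sub_nonneg.2 h0) (sub_nonneg.2 h1)) (pow_nonneg (by linarith :
      (0:ℝ) ≤ T) 2), mul_nonneg (mul_nonneg (sub_nonneg.2 h0) (sub_nonneg.2 h1))
      (pow_nonneg (by linarith : (0:ℝ) ≤ T) 3),
      mul_nonneg (mul_nonneg (sub_nonneg.2 h0) (sub_nonneg.2 h1)) (pow_nonneg (by linarith :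
      (0:ℝ) ≤ T) 4), mul_nonneg (mul_nonneg (sub_nonneg.2 h0) (sub_nonneg.2 h1)) (by linarith :
      (0:ℝ) ≤ T) , pow_nonneg (sub_nonneg.2 h0) 2, pow_nonneg (sub_nonneg.2 h0) 3]

theorem large_gain_coeff_one {T : ℝ} (h0 : 27/40 ≤ T) (h1 : T ≤ 1) :
    0 ≤ 3*(T^3*((slackPoly T)+T^2) - (1-T)) + (T^2*((slackPoly T)+T^2) - T^5 - (1-T)*T^2) := by
  unfold slackPoly
  nlinarith [mul_nonneg (sub_nonneg.2 h0) (sub_nonneg.2 h1),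
      mul_nonneg (mul_nonneg (sub_nonneg.2 h0) (sub_nonneg.2 h1)) (pow_nonneg (by linarith :
      (0:ℝ) ≤ T) 2), mul_nonneg (mul_nonneg (sub_nonneg.2 h0) (sub_nonneg.2 h1))
      (pow_nonneg (by linarith : (0:ℝ) ≤ T) 3),
      mul_nonneg (mul_nonneg (sub_nonneg.2 h0) (sub_nonneg.2 h1)) (pow_nonneg (by linarith :
      (0:ℝ) ≤ T) 4), mul_nonneg (mul_nonneg (sub_nonneg.2 h0) (sub_nonneg.2 h1)) (by linarith :
      (0:ℝ) ≤ T) , pow_nonneg (sub_nonneg.2 h0) 2, pow_nonneg (sub_nonneg.2 h0) 3]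

theorem large_gain_coeff_two {T : ℝ} (h0 : 27/40 ≤ T) (h1 : T ≤ 1) :
    0 ≤ 3*(T^3*((slackPoly T)+T^2) - (1-T)) + 2*(T^2*((slackPoly T)+T^2) - T^5 - (1-T)*T^2)
    + (T^4*(1-T)-T^4) := by
  unfold slackPoly
  nlinarith [mul_nonneg (sub_nonneg.2 h0) (sub_nonneg.2 h1),
      mul_nonneg (mul_nonneg (sub_nonneg.2 h0) (sub_nonneg.2 h1)) (pow_nonneg (by linarith :
      (0:ℝ) ≤ T) 2), mul_nonneg (mul_nonneg (sub_nonneg.2 h0) (sub_nonneg.2 h1))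
      (pow_nonneg (by linarith : (0:ℝ) ≤ T) 3),
      mul_nonneg (mul_nonneg (sub_nonneg.2 h0) (sub_nonneg.2 h1)) (pow_nonneg (by linarith :
      (0:ℝ) ≤ T) 4), mul_nonneg (mul_nonneg (sub_nonneg.2 h0) (sub_nonneg.2 h1)) (by linarith :
      (0:ℝ) ≤ T) , pow_nonneg (sub_nonneg.2 h0) 2, pow_nonneg (sub_nonneg.2 h0) 3]

theorem large_gain_coeff_three {T : ℝ} (h0 : 27/40 ≤ T) (h1 : T ≤ 1) :
    0 ≤ (1-T)*(T^2*(1+T)*(7/20+19/5*T^2+T) - (1+T^2)) := by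
  apply mul_nonneg (by linarith)
  nlinarith [sub_nonneg.2 h0, pow_nonneg (sub_nonneg.2 h0) 2, pow_nonneg (sub_nonneg.2 h0) 3,
      pow_nonneg (sub_nonneg.2 h0) 4, pow_nonneg (sub_nonneg.2 h0) 5]

theorem gain_ineq_small {m T : ℝ} (hm0 : 0 ≤ m) (hm1 : m ≤ 1) (h0 : 0 ≤ T) (h1 : T ≤ 27 / 40) :
    (1 + 3 * T ^ 2) / 3 * (1 + m * T ^ 2 - T ^ 2 * m * gainPoly m T) ≤ gainPoly m T := by
  have c0 := small_gain_coeff_zero h0 h1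
  have := bernstein_three_nonneg hm0 hm1 (by linarith) (small_gain_coeff_one h0 h1)
    (small_gain_coeff_two h0 h1) (small_gain_coeff_three h0 h1)
  unfold gainPoly
  linear_combination (1 / 3) * this

theorem gain_ineq_large {m T : ℝ} (hm0 : 0 ≤ m) (hm1 : m ≤ 1) (h0 : 27 / 40 ≤ T) (h1 : T ≤ 1) :
    (1 - T) * (1 + m * T ^ 2 - T ^ 2 * m * gainPoly m T) ≤ T ^ 3 * (1 + m) * gainPoly m T := by
  have := bernstein_three_nonneg (c3 :=
      T ^ 3 * (1 - T) * T ^ 0) hm0 hm1 (large_gain_coeff_zero h0 h1)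
    (large_gain_coeff_one h0 h1) (large_gain_coeff_two h0 h1) (by
      have := large_gain_coeff_three h0 h1
      unfold slackPoly
      linear_combination this)
  unfold gainPoly
  linear_combination this

theorem first_kernel_le {m T x : ℝ} (hm0 : 0 ≤ m) (hm1 : m ≤ 1) (h0 : 0 < T) (h1 : T < 1)
    (hx1 : 1 ≤ x) (hx : x ≤ 1 + (1 + m) * T ^ 2 * (1 + 3 * T ^ 2) / 3) (hxT : T * x ≤ 1) :
    (1 + m * T ^ 2 * x ^ 2) * (1 + m * x) * (x - 1) / (T ^ 2 * (1 + m * x ^ 2) ^ 2)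
      ≤ gainPoly m T := by
  have hE : 0 ≤ gainPoly m T := by
    unfold gainPoly
    have := slackPoly_nonneg h1.le
    have : 0 ≤ (1 - m) * T ^ 2 := mul_nonneg (by linarith) (by positivity)
    have : 0 ≤ m ^ 2 * (T - T ^ 2) := mul_nonneg (by positivity) (by nlinarith)
    linarith
  set E := gainPoly m T with hEdef
  set w := x - 1 with hw
  have hw0 : 0 ≤ w := by linarith
  have hxw : x = 1 + w := by rw [hw]; ring
  have key : (1 + m * T ^ 2) * w ≤ T ^ 2 * E * (1 + m + m * w) := by
    have hlin : w * (1 + m * T ^ 2 - T ^ 2 * m * E) ≤ T ^ 2 * (1 + m) * E := by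
      rcases le_total (1 + m * T ^ 2 - T ^ 2 * m * E) 0 with hneg | hpos
      · have : 0 ≤ T ^ 2 * (1 + m) * E := by positivity
        nlinarith
      rcases le_total T (27 / 40) with hT | hT
      · have a1 := gain_ineq_small hm0 hm1 h0.le hT
        have a2 : w ≤ (1 + m) * T ^ 2 * ((1 + 3 * T ^ 2) / 3) := by linarith
        calc w * (1 + m * T ^ 2 - T ^ 2 * m * E)
            ≤ (1 + m) * T ^ 2 * ((1 + 3 * T ^ 2) / 3) * (1 + m * T ^ 2 - T ^ 2 * m * E) := by gcongr
          _ = (1 + m) * T ^ 2 * ((1 + 3 * T ^ 2) / 3 * (1 + m * T ^ 2 - T ^ 2 * m * E)) := by ring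
          _ ≤ (1 + m) * T ^ 2 * E := by gcongr
          _ = _ := by ring
      · have a1 := gain_ineq_large hm0 hm1 hT h1.le
        have a2 : T * w ≤ 1 - T := by rw [hw]; linarith
        have a3 : T * (w * (1 + m * T ^ 2 - T ^ 2 * m * E)) ≤ T * (T ^ 2 * (1 + m) * E) := by
          calc T * (w * (1 + m * T ^ 2 - T ^ 2 * m * E))
              = (T * w) * (1 + m * T ^ 2 - T ^ 2 * m * E) := by ring
            _ ≤ (1 - T) * (1 + m * T ^ 2 - T ^ 2 * m * E) := by gcongr
            _ ≤ _ := a1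
            _ = _ := by ring
        exact le_of_mul_le_mul_left a3 h0
    linarith
  have f1 : (1 + m * T ^ 2 * x ^ 2) * (1 + m) ≤ (1 + m * T ^ 2) * (1 + m * x ^ 2) := by
    have : 0 ≤ m * (1 - T ^ 2) * (x ^ 2 - 1) :=
      mul_nonneg (mul_nonneg hm0 (by nlinarith)) (by nlinarith)
    nlinarith
  have f2 : (1 + m * x) * (1 + m + m * w) ≤ (1 + m) * (1 + m * x ^ 2) := by
    rw [hxw]
    have : 0 ≤ m * w ^ 2 := by positivity
    nlinarith
  rw [div_le_iff₀ (by positivity)]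
  have hp : 0 < (1 + m) * (1 + m + m * w) := by positivity
  refine le_of_mul_le_mul_right ?_ hp
  calc (1 + m * T ^ 2 * x ^ 2) * (1 + m * x) * w * ((1 + m) * (1 + m + m * w))
      = ((1 + m * T ^ 2 * x ^ 2) * (1 + m)) * ((1 + m * x) * (1 + m + m * w)) * w := by ring
    _ ≤ ((1 + m * T ^ 2) * (1 + m * x ^ 2)) * ((1 + m) * (1 + m * x ^ 2)) * w := by gcongr
    _ = ((1 + m * T ^ 2) * w) * ((1 + m) * (1 + m * x ^ 2) ^ 2) := by ring
    _ ≤ (T ^ 2 * E * (1 + m + m * w)) * ((1 + m) * (1 + m * x ^ 2) ^ 2) := by gcongr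
    _ = _ := by ring

theorem sq_tanh_le {m q : ℝ} (hm0 : 0 ≤ m) (hm1 : m ≤ 1) (hq0 : 0 ≤ q)
   (h : q * (1 + (1 + m) * q * (1 + 3 * q) / 3) ^ 2 ≤ 1) : q ≤ 1/2 - m/10 := by
  by_contra hc
  push Not at hc
  rcases le_total q (1/2) with hq | hq
  · have hm : 5 - 10 * q ≤ m := by linarith
    have h4 : 2/5 ≤ q := by linarith
    have h5 : (6 - 10 * q) * q * (1 + 3 * q) / 3 ≤ (1 + m) * q * (1 + 3 * q) / 3 := by
      gcongr; linarith
    have h6 : 0 ≤ (6 - 10 * q) * q * (1 + 3 * q) / 3 := by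
      have : 0 ≤ 6 - 10 * q := by linarith
      positivity
    have h7 : q * (1 + (6 - 10 * q) * q * (1 + 3 * q) / 3) ^ 2 ≤ 1 := le_trans (by gcongr) h
    have h8 : 1/2 + (1/2-q) * 3/5  ≤ (6 - 10 * q) * q * (1 + 3 * q) / 3 + 1/12:= by
      nlinarith [mul_nonneg (sub_nonneg.2 h4) (sub_nonneg.2 hq),
          mul_nonneg (mul_nonneg (sub_nonneg.2 h4) (sub_nonneg.2 hq)) hq0]
    nlinarith [mul_nonneg (sub_nonneg.2 h4) (sub_nonneg.2 hq)]
  · have h5 : (5:ℝ)/12 ≤ (1 + m) * q * (1 + 3 * q) / 3 := by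
      nlinarith [mul_nonneg hm0 hq0, mul_nonneg (mul_nonneg hm0 hq0) hq0]
    nlinarith [mul_nonneg (sub_nonneg.2 h5) (sub_nonneg.2 h5), mul_nonneg hq0 (sub_nonneg.2 h5)]

theorem kappa_ineq {m q : ℝ} (hm0 : 0 ≤ m) (hm1 : m ≤ 1) (hq0 : 0 ≤ q) (h : q ≤ 1/2 - m/10) :
   m * (1 + 3 * q) * (2 + (1 + m) * q * (1 + 3 * q) / 3) / 3 ≤ 4 - 5 * q := by
  have hq : 0 ≤ 1/2 - m/10 := by linarith
  have : m * (1 + 3 * q) * (2 + (1 + m) * q * (1 + 3 * q) / 3) / 3 ≤ m * (1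
      + 3 * (1/2 - m/10)) * (2 + (1 + m) * (1/2 - m/10) * (1 + 3 * (1/2 - m/10)) / 3) / 3 :=
      by gcongr
  refine this.trans ?_
  nlinarith [mul_nonneg hm0 (sub_nonneg.2 hm1),
      mul_nonneg (mul_nonneg hm0 (sub_nonneg.2 hm1)) hm0,
      mul_nonneg (mul_nonneg (mul_nonneg hm0 (sub_nonneg.2 hm1)) hm0) hm0,
      mul_nonneg (mul_nonneg (mul_nonneg (mul_nonneg hm0 (sub_nonneg.2 hm1)) hm0) hm0) hm0]

/-- A polynomial majorant of `tan (M * artanh T)`, as long as it is at most `M`. -/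
def slopeBound (M T : ℝ) : ℝ := M * T * (1 + (1 + M ^ 2) * T ^ 2 * (1 + 3 * T ^ 2) / 3)

theorem slopeBound_mono {M a b : ℝ} (hM : 0 ≤ M) (ha : 0 ≤ a) (hab : a ≤ b) :
    slopeBound M a ≤ slopeBound M b := by
  have : 0 ≤ b := ha.trans hab
  unfold slopeBound
  gcongr

theorem slopeBound_supersolution {M T : ℝ} (hM0 : 0 < M) (hM1 : M ≤ 1) (h0 : 0 ≤ T)
    (h : slopeBound M T ≤ M) :
    1 + slopeBound M T ^ 2 ≤ (1 + (1 + M ^ 2) * (T ^ 2 + 5 * T ^ 4)) * (1 - T ^ 2) := by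
  unfold slopeBound at *
  have hm1 : M ^ 2 ≤ 1 := by nlinarith
  have hm0 : 0 ≤ M ^ 2 := by positivity
  have hq0 : 0 ≤ T ^ 2 := by positivity
  generalize hm : M ^ 2 = m at *
  have hT : T * (1 + (1 + m) * T ^ 2 * (1 + 3 * T ^ 2) / 3) ≤ 1 := by
    refine le_of_mul_le_mul_left ?_ hM0
    linarith
  have hP : (M * T * (1 + (1 + m) * T ^ 2 * (1 + 3 * T ^ 2) / 3)) ^ 2
      = m * (T ^ 2 * (1 + (1 + m) * T ^ 2 * (1 + 3 * T ^ 2) / 3) ^ 2) := by rw [← hm]; ring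
  have hq : T ^ 2 * (1 + (1 + m) * T ^ 2 * (1 + 3 * T ^ 2) / 3) ^ 2 ≤ 1 := by
    rw [← mul_pow]
    exact pow_le_one₀ (by positivity) hT
  rw [hP, show T ^ 4 = T ^ 2 * T ^ 2 by ring]
  generalize T ^ 2 = q at *
  have h3 := kappa_ineq hm0 hm1 hq0 (sq_tanh_le hm0 hm1 hq0 hq)
  have h4 : 0 ≤ (1 + m) * q ^ 2 := by positivity
  nlinarith [mul_le_mul_of_nonneg_left h3 h4]

theorem hasDerivAt_tanh (x : ℝ) : HasDerivAt Real.tanh (1 - Real.tanh x ^ 2) x := by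
  have h := (Real.hasDerivAt_sinh x).div (Real.hasDerivAt_cosh x) (Real.cosh_pos x).ne'
  have e : Real.tanh = fun x => Real.sinh x / Real.cosh x := funext Real.tanh_eq_sinh_div_cosh
  have hc := (Real.cosh_pos x).ne'
  rw [e]
  refine h.congr_deriv ?_
  field_simp

theorem tanh_nonneg {x : ℝ} (hx : 0 ≤ x) : 0 ≤ Real.tanh x := by
  rw [Real.tanh_eq_sinh_div_cosh]
  have := Real.sinh_nonneg_iff.2 hx
  positivity

theorem tanh_mono : Monotone Real.tanh :=
  monotone_of_hasDerivAt_nonneg hasDerivAt_tanh fun x => by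
    have := Real.tanh_sq_lt_one x
    simp only [Pi.zero_apply]
    linarith

theorem le_arctan_slopeBound {M y : ℝ} (hM0 : 0 < M) (hM1 : M ≤ 1) (hy : 0 ≤ y)
    (h : slopeBound M (Real.tanh y) ≤ M) : M * y ≤ Real.arctan (slopeBound M (Real.tanh y)) := by
  have hd : ∀ s : ℝ, HasDerivAt (fun s => Real.arctan (slopeBound M (Real.tanh s)) - M * s)
      (1 / (1 + slopeBound M (Real.tanh s) ^ 2) *
        (M * (1 + (1 + M ^ 2) * (Real.tanh s ^ 2
            + 5 * Real.tanh s ^ 4)) * (1 - Real.tanh s ^ 2)) - M) s := by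
    intro s
    have h1 : HasDerivAt (fun T : ℝ => slopeBound M T)
        (M * (1 + (1 + M ^ 2) * (Real.tanh s ^ 2 + 5 * Real.tanh s ^ 4))) (Real.tanh s) := by
      unfold slopeBound
      have h0 := hasDerivAt_id' (Real.tanh s)
      refine ((h0.const_mul M).fun_mul ((((h0.fun_pow 2).const_mul (1 + M ^ 2)).fun_mul
        (((h0.fun_pow 2).const_mul 3).const_add 1)).div_const 3 |>.const_add 1)).congr_deriv ?_
      push_cast
      ring
    have h2 := (h1.comp s (hasDerivAt_tanh s)).arctan.fun_sub ((hasDerivAt_id' s).const_mul M)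
    exact h2.congr_deriv (by simp)
  have hmono : MonotoneOn (fun s => Real.arctan (slopeBound M (Real.tanh s)) - M * s)
      (Icc 0 y) := by
    apply monotoneOn_of_deriv_nonneg (convex_Icc 0 y)
    · exact fun s _ => (hd s).continuousAt.continuousWithinAt
    · exact fun s _ => (hd s).differentiableAt.differentiableWithinAt
    · intro s hs
      rw [interior_Icc] at hs
      rw [(hd s).deriv]
      have hT0 : 0 ≤ Real.tanh s := tanh_nonneg hs.1.le
      have hle : slopeBound M (Real.tanh s) ≤ M :=
        (slopeBound_mono hM0.le hT0 (tanh_mono hs.2.le)).trans h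
      have := slopeBound_supersolution hM0 hM1 hT0 hle
      have hpos : 0 < 1 + slopeBound M (Real.tanh s) ^ 2 := by positivity
      rw [sub_nonneg, one_div, ← div_eq_inv_mul, le_div_iff₀ hpos]
      nlinarith [mul_le_mul_of_nonneg_left this hM0.le]
  have := hmono (left_mem_Icc.2 hy) (right_mem_Icc.2 hy) hy
  simp [slopeBound] at this
  unfold slopeBound
  linarith

theorem abs_tan_le_slopeBound {M y τ : ℝ} (hM0 : 0 < M) (hM1 : M ≤ 1) (hy : 0 ≤ y)
    (hτ : |τ| ≤ M * y) (hτM : |τ| ≤ Real.arctan M) :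
    |Real.tan τ| ≤ slopeBound M (Real.tanh y) := by
  have hlt := Real.arctan_lt_pi_div_two M
  have habs : |Real.tan τ| = Real.tan |τ| := by
    rcases le_total 0 τ with h | h
    · rw [abs_of_nonneg h] at *
      exact abs_of_nonneg (Real.tan_nonneg_of_nonneg_of_le_pi_div_two h (by linarith))
    · rw [abs_of_nonpos h] at *
      rw [Real.tan_neg, abs_of_nonpos]
      have := Real.tan_nonneg_of_nonneg_of_le_pi_div_two (neg_nonneg.2 h) (by linarith)
      rw [Real.tan_neg] at this
      linarith
  have key : ∀ z, |τ| ≤ Real.arctan z → |Real.tan τ| ≤ z := by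
    intro z hz
    rw [habs, ← Real.tan_arctan z]
    have := Real.arctan_lt_pi_div_two z
    exact Real.strictMonoOn_tan.monotoneOn ⟨by linarith [abs_nonneg τ, Real.pi_pos], by linarith⟩
      ⟨by linarith [abs_nonneg τ, Real.pi_pos], this⟩ hz
  rcases le_total M (slopeBound M (Real.tanh y)) with h | h
  · exact (key M hτM).trans h
  · exact key _ (hτ.trans (le_arctan_slopeBound hM0 hM1 hy h))

theorem second_term_le {M T s : ℝ} (hM0 : 0 < M) (hM1 : M ≤ 1) (h0 : 0 < T) :
    (1 + s ^ 2) * (1 + M * T * s) * (M - T * s) / (1 + T ^ 2 * s ^ 2) ^ 2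
      ≤ M * ((1 + M ^ 2 * (|s| / M) ^ 2) * (1 + (1 - M ^ 2) * T * (|s| / M)
          - M ^ 2 * T ^ 2 * (|s| / M) ^ 2) / (1 + M ^ 2 * T ^ 2 * (|s| / M) ^ 2) ^ 2) := by
  have hs : M ^ 2 * (|s| / M) ^ 2 = s ^ 2 := by
    rw [div_pow, sq_abs]; field_simp
  have hs' : M ^ 2 * T ^ 2 * (|s| / M) ^ 2 = T ^ 2 * s ^ 2 := by rw [← hs]; ring
  have hMs : M * (|s| / M) = |s| := by field_simp
  rw [hs, hs', ← mul_div_assoc]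
  apply div_le_div_of_nonneg_right _ (by positivity)
  have hM : 0 ≤ 1 - M ^ 2 := by nlinarith
  have h1 : (1 + M * T * s) * (M - T * s)
      ≤ M * (1 + (1 - M ^ 2) * T * (|s| / M) - T ^ 2 * s ^ 2) := by
    have e : M * (1 + (1 - M ^ 2) * T * (|s| / M) - T ^ 2 * s ^ 2)
        = M + (1 - M ^ 2) * T * (M * (|s| / M)) - M * T ^ 2 * s ^ 2 := by ring
    rw [e, hMs]
    have h2 : 0 ≤ (1 - M ^ 2) * T * (|s| + s) :=
      mul_nonneg (by positivity) (by linarith [neg_abs_le s])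
    nlinarith
  calc (1 + s ^ 2) * (1 + M * T * s) * (M - T * s)
      = (1 + s ^ 2) * ((1 + M * T * s) * (M - T * s)) := by ring
    _ ≤ (1 + s ^ 2) * (M * (1 + (1 - M ^ 2) * T * (|s| / M) - T ^ 2 * s ^ 2)) := by gcongr
    _ = _ := by ring

theorem first_term_le {M T t : ℝ} (hM0 : 0 < M) (hM1 : M ≤ 1) (h0 : 0 < T) :
    -((1 + t ^ 2) * (T + M * t) * (M * T - t)) / (T ^ 2 + t ^ 2) ^ 2
      ≤ (1 + t ^ 2) * (T + M * |t|) * (|t| - M * T) / (T ^ 2 + t ^ 2) ^ 2 := by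
  apply div_le_div_of_nonneg_right _ (by positivity)
  have h1 : -((T + M * t) * (M * T - t)) ≤ (T + M * |t|) * (|t| - M * T) := by
    have hM : 0 ≤ 1 - M ^ 2 := by nlinarith
    have h2 : 0 ≤ (1 - M ^ 2) * T * (|t| - t) :=
      mul_nonneg (by positivity) (by linarith [le_abs_self t])
    nlinarith [sq_abs t]
  have : 0 ≤ 1 + t ^ 2 := by positivity
  nlinarith [mul_le_mul_of_nonneg_left h1 this]

theorem kernel_sum_le {M T t s : ℝ} (hM0 : 0 < M) (hM1 : M ≤ 1) (h0 : 0 < T) (h1 : T < 1)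
    (hts : |t| + |s| ≤ M) (ht : |t| ≤ slopeBound M T) :
    -((1 + t ^ 2) * (T + M * t) * (M * T - t)) / (T ^ 2 + t ^ 2) ^ 2
      + (1 + s ^ 2) * (1 + M * T * s) * (M - T * s) / (1 + T ^ 2 * s ^ 2) ^ 2
      ≤ M * boundPoly (M ^ 2) T := by
  have hm0 : 0 ≤ M ^ 2 := by positivity
  have hm1 : M ^ 2 ≤ 1 := by nlinarith
  have hr0 : 0 ≤ |s| / M := by positivity
  have hr1 : |s| / M ≤ 1 := by
    rw [div_le_one hM0]; linarith [abs_nonneg t]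
  refine (add_le_add (first_term_le hM0 hM1 h0) (second_term_le hM0 hM1 h0)).trans ?_
  rcases le_total |t| (M * T) with hcase | hcase
  · have hneg : (1 + t ^ 2) * (T + M * |t|) * (|t| - M * T) / (T ^ 2 + t ^ 2) ^ 2 ≤ 0 := by
      apply div_nonpos_of_nonpos_of_nonneg _ (by positivity)
      exact mul_nonpos_of_nonneg_of_nonpos (by positivity) (by linarith)
    have := mul_le_mul_of_nonneg_left (second_kernel_le hm0 hm1 h0.le h1.le hr0 hr1) hM0.le
    linarith
  · set x := |t| / (M * T) with hx
    have htx : |t| = M * T * x := by rw [hx]; field_simp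
    have hx1 : 1 ≤ x := by rw [hx, one_le_div (by positivity)]; exact hcase
    have hTx : T * x + |s| / M ≤ 1 := by
      refine le_of_mul_le_mul_left ?_ hM0
      have : M * (|s| / M) = |s| := by field_simp
      nlinarith
    have hr2 : |s| / M ≤ 1 - T := by nlinarith
    have hf := first_kernel_le hm0 hm1 h0 h1 hx1 (by
      unfold slopeBound at ht
      rw [htx] at ht
      exact le_of_mul_le_mul_left ht (by positivity)) (by linarith)
    have hs := second_kernel_le_gain hm0 hm1 h0.le h1.le hr0 hr2
    have e : (1 + t ^ 2) * (T + M * |t|) * (|t| - M * T) / (T ^ 2 + t ^ 2) ^ 2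
        = M * ((1 + M ^ 2 * T ^ 2 * x ^ 2) * (1 + M ^ 2 * x) * (x - 1)
            / (T ^ 2 * (1 + M ^ 2 * x ^ 2) ^ 2)) := by
      rw [← sq_abs t, htx]
      field_simp
    rw [e]
    have := mul_le_mul_of_nonneg_left (add_le_add hf hs) hM0.le
    linarith

/-- The second variation of the kernels in the direction `(1, M)`. -/
def secondVariation (M y δ σ : ℝ) : ℝ :=
  ((1 - M ^ 2) * Real.sinh y * Real.sin δ - 2 * M * (Real.cosh y * Real.cos δ - 1))
      / (Real.cosh y - Real.cos δ) ^ 2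
    + (2 * M * (Real.cosh y * Real.cos σ + 1) - (1 - M ^ 2) * Real.sinh y * Real.sin σ)
      / (Real.cosh y + Real.cos σ) ^ 2

theorem secondVariation_eq {M y δ σ : ℝ} (hy : 0 < y) (hδ : Real.cos δ ≠ 0) (hσ : Real.cos σ ≠ 0) :
    secondVariation M (2 * y) (2 * δ) (2 * σ) = (1 - Real.tanh y ^ 2) *
      (-((1 + Real.tan δ ^ 2) * (Real.tanh y + M * Real.tan δ) * (M * Real.tanh y - Real.tan δ))
          / (Real.tanh y ^ 2 + Real.tan δ ^ 2) ^ 2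
      + (1 + Real.tan σ ^ 2) * (1 + M * Real.tanh y * Real.tan σ) * (M - Real.tanh y * Real.tan σ)
          / (1 + Real.tanh y ^ 2 * Real.tan σ ^ 2) ^ 2) := by
  have hc := (Real.cosh_pos y).ne'
  have hs := Real.sinh_pos_iff.2 hy
  set T := Real.tanh y with hT
  have hT1 : T ^ 2 < 1 := Real.tanh_sq_lt_one y
  have hT0 : 0 < T := by rw [hT, Real.tanh_eq_sinh_div_cosh]; exact div_pos hs (Real.cosh_pos y)
  have hsh : Real.sinh y = T * Real.cosh y := by
    rw [hT, Real.tanh_eq_sinh_div_cosh]; field_simp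
  have hcosh : Real.cosh y ^ 2 = 1 / (1 - T ^ 2) := by
    have h1 := Real.cosh_sq y
    rw [hsh] at h1
    rw [eq_div_iff (by linarith)]
    linarith
  have hC : Real.cosh (2 * y) = (1 + T ^ 2) / (1 - T ^ 2) := by
    rw [Real.cosh_two_mul, hsh, mul_pow, hcosh]; ring
  have hS : Real.sinh (2 * y) = 2 * T / (1 - T ^ 2) := by
    rw [Real.sinh_two_mul, hsh,
        show 2 * (T * Real.cosh y) * Real.cosh y = 2 * T * Real.cosh y ^ 2 by ring, hcosh]; ring
  have hcos : ∀ a : ℝ, Real.cos a ≠ 0 → Real.cos (2 * a) = (1 - Real.tan a ^ 2) / (1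
      + Real.tan a ^ 2)
      ∧ Real.sin (2 * a) = 2 * Real.tan a / (1 + Real.tan a ^ 2) := by
    intro a ha
    have h2 := Real.inv_one_add_tan_sq ha
    rw [div_eq_mul_inv, div_eq_mul_inv, h2]
    have h3 : Real.tan a * Real.cos a = Real.sin a := Real.tan_mul_cos ha
    refine ⟨?_, ?_⟩
    · rw [Real.cos_two_mul', ← h3]; ring
    · rw [Real.sin_two_mul, ← h3]; ring
  unfold secondVariation
  rw [hC, hS, (hcos δ hδ).1, (hcos δ hδ).2, (hcos σ hσ).1, (hcos σ hσ).2]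
  generalize Real.tan δ = t
  generalize Real.tan σ = s
  have h1 : 1 - T ^ 2 ≠ 0 := by linarith
  have h2 : 1 + t ^ 2 ≠ 0 := by positivity
  have h3 : 1 + s ^ 2 ≠ 0 := by positivity
  have h4 : T ^ 2 + t ^ 2 ≠ 0 := by positivity
  have h5 : 1 + T ^ 2 * s ^ 2 ≠ 0 := by positivity
  have e1 : (1 + T ^ 2) / (1 - T ^ 2) - (1 - t ^ 2) / (1 + t ^ 2)
      = 2 * (T ^ 2 + t ^ 2) / ((1 - T ^ 2) * (1 + t ^ 2)) := by field_simp; ring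
  have e2 : (1 + T ^ 2) / (1 - T ^ 2) + (1 - s ^ 2) / (1 + s ^ 2)
      = 2 * (1 + T ^ 2 * s ^ 2) / ((1 - T ^ 2) * (1 + s ^ 2)) := by field_simp; ring
  rw [e1, e2]
  field_simp
  ring

theorem secondVariation_le {M y δ σ : ℝ} (hM0 : 0 < M) (hM1 : M ≤ 1) (hy : 0 < y)
    (hδ : |δ| ≤ M * y) (hδσ : |δ| / 2 + |σ| / 2 ≤ Real.arctan M) :
    secondVariation M y δ σ
      ≤ (1 - Real.tanh (y / 2) ^ 2) * (M * boundPoly (M ^ 2) (Real.tanh (y / 2))) := by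
  have hlt := Real.arctan_lt_pi_div_two M
  have hδ' : |δ / 2| = |δ| / 2 := by rw [abs_div]; norm_num
  have hσ' : |σ / 2| = |σ| / 2 := by rw [abs_div]; norm_num
  have h1 : |δ / 2| ≤ Real.arctan M := by rw [hδ']; linarith [abs_nonneg σ]
  have h2 : |σ / 2| ≤ Real.arctan M := by rw [hσ']; linarith [abs_nonneg δ]
  have hc1 : 0 < Real.cos (δ / 2) := Real.cos_pos_of_mem_Ioo (abs_lt.1 (h1.trans_lt hlt))
  have hc2 : 0 < Real.cos (σ / 2) := Real.cos_pos_of_mem_Ioo (abs_lt.1 (h2.trans_lt hlt))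
  have e := secondVariation_eq (M := M) (half_pos hy) hc1.ne' hc2.ne'
  rw [mul_div_cancel₀ _ two_ne_zero, mul_div_cancel₀ _ two_ne_zero,
      mul_div_cancel₀ _ two_ne_zero] at e
  have hT1 := Real.tanh_sq_lt_one (y / 2)
  have hT0 : 0 < Real.tanh (y / 2) := by
    rw [Real.tanh_eq_sinh_div_cosh]
    exact div_pos (Real.sinh_pos_iff.2 (half_pos hy)) (Real.cosh_pos _)
  rw [e]
  apply mul_le_mul_of_nonneg_left _ (by linarith)
  apply kernel_sum_le hM0 hM1 hT0 (by nlinarith)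
  · have habs : ∀ a : ℝ, |a| ≤ Real.arctan M → |Real.tan a| = Real.tan |a| := by
      intro a ha
      have hnn := Real.tan_nonneg_of_nonneg_of_le_pi_div_two (abs_nonneg a) (by linarith)
      rcases abs_choice a with h | h
      · rw [h] at hnn ⊢; exact abs_of_nonneg hnn
      · rw [h] at hnn ⊢; rw [Real.tan_neg] at hnn ⊢; exact abs_of_nonpos (by linarith)
    rw [habs _ h1, habs _ h2]
    set a := |δ / 2| with ha
    set b := |σ / 2| with hb
    have ha0 : 0 ≤ a := abs_nonneg _
    have hb0 : 0 ≤ b := abs_nonneg _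
    have hab : a + b ≤ Real.arctan M := by rw [hδ', hσ']; exact hδσ
    have hca : 0 < Real.cos a := Real.cos_pos_of_mem_Ioo ⟨by linarith, by linarith⟩
    have hcb : 0 < Real.cos b := Real.cos_pos_of_mem_Ioo ⟨by linarith, by linarith⟩
    have hcab : 0 < Real.cos (a + b) := Real.cos_pos_of_mem_Ioo ⟨by linarith, by linarith⟩
    have hsab : 0 ≤ Real.sin (a + b) := Real.sin_nonneg_of_nonneg_of_le_pi (by linarith)
        (by linarith)
    have hsa : 0 ≤ Real.sin a := Real.sin_nonneg_of_nonneg_of_le_pi (by linarith) (by linarith)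
    have hsb : 0 ≤ Real.sin b := Real.sin_nonneg_of_nonneg_of_le_pi (by linarith) (by linarith)
    have h3 : Real.tan a + Real.tan b ≤ Real.tan (a + b) := by
      rw [Real.tan_eq_sin_div_cos, Real.tan_eq_sin_div_cos, Real.tan_eq_sin_div_cos,
        div_add_div _ _ hca.ne' hcb.ne', ← Real.sin_add]
      apply div_le_div_of_nonneg_left hsab hcab
      rw [Real.cos_add]
      nlinarith [mul_nonneg hsa hsb]
    refine h3.trans ?_
    rw [← Real.tan_arctan M]
    rw [Real.tan_arctan M]
    conv_rhs => rw [← Real.tan_arctan M]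
    exact Real.strictMonoOn_tan.monotoneOn ⟨by linarith, by linarith⟩ ⟨by linarith, hlt⟩ hab
  · apply abs_tan_le_slopeBound hM0 hM1 (half_pos hy).le _ h1
    rw [hδ']; linarith

theorem exists_support_bound {φ : ℝ → ℝ} (hφ : HasCompactSupport φ) :
    ∃ R : ℝ, 0 < R ∧ ∀ x, R ≤ |x| → φ x = 0 := by
  obtain ⟨R, hR⟩ := hφ.isCompact.isBounded.subset_closedBall (0 : ℝ)
  refine ⟨|R| + 1, by positivity, fun x hx => ?_⟩
  by_contra h
  have h1 := hR (subset_tsupport φ h)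
  rw [Metric.mem_closedBall, dist_zero_right, Real.norm_eq_abs] at h1
  linarith [le_abs_self R]

theorem integral_eq_intervalIntegral_of_support {φ : ℝ → ℝ} {R : ℝ}
    (h : ∀ x, R ≤ |x| → φ x = 0) : ∫ x, φ x = ∫ x in (-R)..R, φ x := by
  rw [intervalIntegral.integral_eq_integral_of_support_subset]
  intro x hx
  by_contra h2
  apply hx
  apply h
  rw [mem_Ioc, not_and_or, not_lt, not_le] at h2
  rcases h2 with h2 | h2
  · exact le_abs.2 (Or.inr (by linarith))
  · exact le_abs.2 (Or.inl h2.le)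

theorem iteratedDeriv_smooth {φ : ℝ → ℝ} (hφ : ContDiff ℝ ∞ φ) (j : ℕ) :
    ContDiff ℝ ∞ (iteratedDeriv j φ) := by
  induction j with
  | zero => simpa using hφ
  | succ j ih =>
    rw [iteratedDeriv_succ]
    exact (contDiff_infty_iff_deriv.1 ih).2

theorem iteratedDeriv_hasCompactSupport {φ : ℝ → ℝ} (hφ : HasCompactSupport φ) (j : ℕ) :
    HasCompactSupport (iteratedDeriv j φ) := by
  induction j with
  | zero => simpa using hφ
  | succ j ih =>
    rw [iteratedDeriv_succ]
    exact ih.deriv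

theorem const_of_integral_mul_deriv_eq_zero {h : ℝ → ℝ} (hc : Continuous h)
    (H : ∀ φ : ℝ → ℝ, ContDiff ℝ ∞ φ → HasCompactSupport φ → ∫ x, h x * deriv φ x = 0) :
    ∃ c, ∀ x, h x = c := by
  obtain ⟨ρ⟩ : Nonempty (ContDiffBump (0 : ℝ)) := inferInstance
  set r : ℝ → ℝ := ρ.normed volume with hr
  have hrs : ContDiff ℝ ∞ r := ρ.contDiff_normed
  have hrc : HasCompactSupport r := ρ.hasCompactSupport_normed
  have hr1 : ∫ x, r x = 1 := ρ.integral_normed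
  set c := ∫ x, h x * r x with hcdef
  have key : ∀ ψ : ℝ → ℝ, ContDiff ℝ ∞ ψ → HasCompactSupport ψ →
      ∫ x, ψ x • h x = ∫ x, ψ x • c := by
    intro ψ hψ hψc
    set a := ∫ x, ψ x with ha
    set χ : ℝ → ℝ := fun x => ψ x - a * r x with hχ
    have hχs : ContDiff ℝ ∞ χ := hψ.sub (contDiff_const.mul hrs)
    have hχc : HasCompactSupport χ := hψc.sub (hrc.mul_left (f := fun _ => a))
    obtain ⟨R, hR, hRχ⟩ := exists_support_bound hχc
    have hint : ∫ x, χ x = 0 := by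
      rw [hχ, integral_sub (hψ.continuous.integrable_of_hasCompactSupport hψc)
        ((hrs.continuous.integrable_of_hasCompactSupport hrc).const_mul a),
        integral_const_mul, hr1, ← ha]
      ring
    have hii : ∀ u v, IntervalIntegrable χ volume u v := fun u v =>
      hχs.continuous.intervalIntegrable u v
    set φ : ℝ → ℝ := fun x => ∫ y in (-R)..x, χ y with hφ
    have hd : ∀ x, HasDerivAt φ (χ x) x := fun x =>
      intervalIntegral.integral_hasDerivAt_right (hii _ _)
        hχs.continuous.aestronglyMeasurable.stronglyMeasurableAtFilter hχs.continuous.continuousAt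
    have hderiv : deriv φ = χ := funext fun x => (hd x).deriv
    have hφs : ContDiff ℝ ∞ φ := by
      rw [contDiff_infty_iff_deriv, hderiv]
      exact ⟨fun x => (hd x).differentiableAt, hχs⟩
    have hzero : ∀ x, R ≤ |x| → φ x = 0 := by
      intro x hx
      rcases le_abs'.1 hx with h1 | h1
      · apply intervalIntegral.integral_zero_ae
        refine Eventually.of_forall fun y hy => hRχ y ?_
        rw [uIoc_of_ge h1] at hy
        exact le_abs.2 (Or.inr (by linarith [hy.2]))
      · have e : φ x = (∫ y in (-R)..R, χ y) + ∫ y in R..x, χ y :=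
          (intervalIntegral.integral_add_adjacent_intervals (hii _ _) (hii _ _)).symm
        rw [e, ← integral_eq_intervalIntegral_of_support hRχ, hint, zero_add]
        apply intervalIntegral.integral_zero_ae
        refine Eventually.of_forall fun y hy => hRχ y ?_
        rw [uIoc_of_le h1] at hy
        exact le_abs.2 (Or.inl hy.1.le)
    have hφc : HasCompactSupport φ := by
      apply HasCompactSupport.intro (isCompact_closedBall (0 : ℝ) R)
      intro x hx
      apply hzero
      rw [Metric.mem_closedBall, dist_zero_right, Real.norm_eq_abs, not_le] at hx
      exact hx.le
    have := H φ hφs hφc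
    rw [hderiv] at this
    have i1 : Integrable fun x => h x * ψ x :=
      (hc.mul hψ.continuous).integrable_of_hasCompactSupport hψc.mul_left
    have i2 : Integrable fun x => h x * r x :=
      (hc.mul hrs.continuous).integrable_of_hasCompactSupport hrc.mul_left
    have e : (fun x => h x * χ x) = fun x => h x * ψ x - a * (h x * r x) := by
      funext x; simp only [hχ]; ring
    rw [e, integral_sub i1 (i2.const_mul a), integral_const_mul, ← hcdef] at this
    simp only [smul_eq_mul]
    rw [integral_mul_const, ← ha]
    simp_rw [mul_comm (ψ _)]
    linarith
  have hae := ae_eq_of_integral_contDiff_smul_eq (μ := (volume : Measure ℝ))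
    hc.locallyIntegrable (continuous_const (y := c)).locallyIntegrable key
  exact ⟨c, fun x => congrFun (Continuous.ae_eq_iff_eq volume hc continuous_const |>.1 hae) x⟩

/-- A continuous function with a locally integrable weak derivative is its primitive. -/
theorem sub_eq_integral_of_weakDeriv {h g : ℝ → ℝ} (hc : Continuous h)
    (hg : LocallyIntegrable g volume)
    (H : ∀ φ : ℝ → ℝ, ContDiff ℝ ∞ φ → HasCompactSupport φ →
      ∫ x, h x * deriv φ x = - ∫ x, g x * φ x) (a b : ℝ) :
    h b - h a = ∫ x in a..b, g x := by
  have hgi : ∀ u v, IntervalIntegrable g volume u v := fun u v =>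
    (hg.integrableOn_isCompact isCompact_uIcc).intervalIntegrable
  set F : ℝ → ℝ := fun x => ∫ y in (0 : ℝ)..x, g y with hF
  have hFc : Continuous F := intervalIntegral.continuous_primitive hgi 0
  have hFd : ∀ φ : ℝ → ℝ, ContDiff ℝ ∞ φ → HasCompactSupport φ →
      ∫ x, F x * deriv φ x = - ∫ x, g x * φ x := by
    intro φ hφ hφc
    obtain ⟨R, hR, hRφ⟩ := exists_support_bound hφc
    obtain ⟨R', hR', hRφ'⟩ := exists_support_bound hφc.deriv
    set S := max R R' with hS
    have hS0 : 0 < S := lt_max_of_lt_left hR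
    have z1 : ∀ x, S ≤ |x| → F x * deriv φ x = 0 := fun x hx => by
      rw [hRφ' x ((le_max_right _ _).trans hx), mul_zero]
    have z2 : ∀ x, S ≤ |x| → g x * φ x = 0 := fun x hx => by
      rw [hRφ x ((le_max_left _ _).trans hx), mul_zero]
    rw [integral_eq_intervalIntegral_of_support z1, integral_eq_intervalIntegral_of_support z2]
    have ac1 : AbsolutelyContinuousOnInterval F (-S) S :=
      (hgi (-S) S).absolutelyContinuousOnInterval_intervalIntegral
        (by rw [uIcc_of_le (by linarith)]; exact ⟨by linarith, hS0.le⟩)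
    have ac2 : AbsolutelyContinuousOnInterval φ (-S) S := by
      have : φ = fun x => φ (-S) + ∫ y in (-S)..x, deriv φ y := by
        funext x
        rw [intervalIntegral.integral_deriv_eq_sub (fun y _ => hφ.differentiable (by simp) y)
          ((hφ.continuous_deriv (by simp)).intervalIntegrable _ _)]
        ring
      have h1 := ((hφ.continuous_deriv (by simp)).intervalIntegrable (μ := volume) (-S) S
        ).absolutelyContinuousOnInterval_intervalIntegral (c := -S) (by simp)
      obtain h2 := (LipschitzWith.const (α := ℝ) (φ (-S))).lipschitzOnWith (s := uIcc (-S) S)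
        |>.absolutelyContinuousOnInterval
      rw [this]
      exact h2.add h1
    rw [ac1.integral_mul_deriv_eq_deriv_mul ac2,
        hRφ S (by rw [abs_of_pos hS0]; exact le_max_left _ _),
      hRφ (-S) (by rw [abs_neg, abs_of_pos hS0]; exact le_max_left _ _)]
    simp only [mul_zero, sub_zero, zero_sub, neg_inj]
    apply intervalIntegral.integral_congr_ae
    filter_upwards [LocallyIntegrable.ae_hasDerivAt_integral hg] with x hx _
    rw [(hx 0).deriv]
  obtain ⟨c, hconst⟩ := const_of_integral_mul_deriv_eq_zero (hc.sub hFc) (by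
    intro φ hφ hφc
    have i1 : Integrable fun x => h x * deriv φ x :=
      (hc.mul (hφ.continuous_deriv (by simp))).integrable_of_hasCompactSupport hφc.deriv.mul_left
    have i2 : Integrable fun x => F x * deriv φ x :=
      (hFc.mul (hφ.continuous_deriv (by simp))).integrable_of_hasCompactSupport hφc.deriv.mul_left
    have : (fun x => (h - F) x * deriv φ x) = fun x => h x * deriv φ x - F x * deriv φ x := by
      funext x; simp only [Pi.sub_apply]; ring
    rw [this, integral_sub i1 i2, H φ hφ hφc, hFd φ hφ hφc]
    ring)
  have ha := hconst a
  have hb := hconst b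
  simp only [Pi.sub_apply] at ha hb
  have := intervalIntegral.integral_add_adjacent_intervals (hgi 0 a) (hgi a b)
  simp only [hF] at ha hb
  linarith

theorem abs_intervalIntegral_le_sqrt {g : ℝ → ℝ} (hg : MemLp g 2 volume) (a b : ℝ) :
    |∫ x in a..b, g x| ≤ (eLpNorm g 2 volume).toReal * √|b - a| := by
  wlog hab : a ≤ b generalizing a b
  · rw [intervalIntegral.integral_symm, abs_neg, abs_sub_comm]
    exact this b a (le_of_not_ge hab)
  rw [intervalIntegral.integral_of_le hab]
  have h1 : ENNReal.ofReal |∫ x in Ioc a b,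
      g x| ≤ eLpNorm g 2 volume * ENNReal.ofReal √|b - a| := by
    calc ENNReal.ofReal |∫ x in Ioc a b, g x| = ‖∫ x in Ioc a b, g x‖ₑ := by
          rw [← Real.norm_eq_abs, ofReal_norm]
      _ ≤ ∫⁻ x in Ioc a b, ‖g x‖ₑ := enorm_integral_le_lintegral_enorm _
      _ = eLpNorm g 1 (volume.restrict (Ioc a b)) := by rw [eLpNorm_one_eq_lintegral_enorm]
      _ ≤ eLpNorm g 2 (volume.restrict (Ioc a b)) * (volume.restrict (Ioc a b)) univ
            ^ (1 / (1 : ENNReal).toReal - 1 / (2 : ENNReal).toReal) :=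
          eLpNorm_le_eLpNorm_mul_rpow_measure_univ (by norm_num) hg.1.restrict
      _ ≤ eLpNorm g 2 volume * ENNReal.ofReal √|b - a| := by
          gcongr
          · exact Measure.restrict_le_self
          · rw [Measure.restrict_apply_univ, Real.volume_Ioc, abs_of_nonneg (by linarith),
              Real.sqrt_eq_rpow, ENNReal.ofReal_rpow_of_nonneg (by linarith) (by norm_num)]
            norm_num
  rw [← ENNReal.toReal_ofReal (Real.sqrt_nonneg |b - a|), ← ENNReal.toReal_mul,
    ← ENNReal.toReal_ofReal (abs_nonneg (∫ x in Ioc a b, g x))]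
  exact ENNReal.toReal_mono (ENNReal.mul_ne_top hg.2.ne ENNReal.ofReal_ne_top) h1

theorem tendsto_atTop_zero_of_sq_integrable {h : ℝ → ℝ} {C : ℝ} (hc : Continuous h)
    (hL : Integrable fun x => h x ^ 2) (hh : ∀ x y, |h x - h y| ≤ C * √|x - y|) :
    Tendsto h atTop (𝓝 0) := by
  have hC : 0 ≤ C := by
    have := (abs_nonneg _).trans (hh 1 0)
    simpa using this
  have hii : ∀ u v, IntervalIntegrable (fun x => h x ^ 2) volume u v := fun u v =>
    (hc.pow 2).intervalIntegrable u v
  rw [Metric.tendsto_nhds]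
  intro ε hε
  obtain ⟨r, hr0, hr⟩ : ∃ r : ℝ, 0 < r ∧ C * √r ≤ ε / 2 := by
    refine ⟨(ε / (2 * (C + 1))) ^ 2, by positivity, ?_⟩
    rw [Real.sqrt_sq (by positivity), mul_div_assoc', div_le_div_iff₀ (by positivity) (by norm_num)]
    nlinarith
  have hF : Tendsto (fun x => (∫ y in (0 : ℝ)..x, h y ^ 2)) atTop
      (𝓝 (∫ y in Ioi (0 : ℝ), h y ^ 2)) :=
    intervalIntegral_tendsto_integral_Ioi 0 hL.integrableOn tendsto_id
  have hd : Tendsto (fun x => ∫ y in x..(x + r), h y ^ 2) atTop (𝓝 0) := by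
    have h1 := (hF.comp (tendsto_atTop_add_const_right atTop r tendsto_id)).sub hF
    rw [sub_self] at h1
    refine h1.congr fun x => ?_
    simp only [Function.comp, id]
    have := intervalIntegral.integral_add_adjacent_intervals (hii 0 x) (hii x (x + r))
    linarith
  have hsmall := hd.eventually (gt_mem_nhds (show (0 : ℝ) < (ε / 2) ^ 2 * r by positivity))
  filter_upwards [hsmall] with x hx
  rw [dist_zero_right, Real.norm_eq_abs]
  by_contra hge
  push Not at hge
  have hlow : ∀ y ∈ Icc x (x + r), (ε / 2) ^ 2 ≤ h y ^ 2 := by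
    intro y hy
    have h1 := hh x y
    have h2 : √|x - y| ≤ √r := Real.sqrt_le_sqrt (by rw [abs_le]; constructor <;> linarith [hy.1,
        hy.2])
    have h3 : |h x - h y| ≤ ε / 2 := h1.trans ((mul_le_mul_of_nonneg_left h2 hC).trans hr)
    have h4 : ε / 2 ≤ |h y| := by
      have := abs_sub_abs_le_abs_sub (h x) (h y)
      linarith
    rw [← sq_abs (h y)]
    gcongr
  have : ∫ _ in x..(x + r), (ε / 2) ^ 2 ≤ ∫ y in x..(x + r), h y ^ 2 :=
    intervalIntegral.integral_mono_on (by linarith) (by simp) (hii _ _) hlow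
  rw [intervalIntegral.integral_const, smul_eq_mul] at this
  linarith

theorem tendsto_cocompact_zero_of_memLp {h : ℝ → ℝ} {C : ℝ} (hc : Continuous h)
    (hL : MemLp h 2 volume) (hh : ∀ x y, |h x - h y| ≤ C * √|x - y|) :
    Tendsto h (cocompact ℝ) (𝓝 0) := by
  rw [cocompact_eq_atBot_atTop, tendsto_sup]
  refine ⟨?_, tendsto_atTop_zero_of_sq_integrable hc hL.integrable_sq hh⟩
  have h1 := tendsto_atTop_zero_of_sq_integrable (h := fun x => h (-x)) (C := C)
    (hc.comp continuous_neg) hL.integrable_sq.comp_neg (fun x y => by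
      have := hh (-x) (-y)
      rwa [show -x - -y = -(x - y) by ring, abs_neg] at this)
  simpa [Function.comp_def] using! h1.comp tendsto_neg_atBot_atTop

theorem integral_mul_deriv_of_compact {f φ : ℝ → ℝ} (hf : ContDiff ℝ 1 f) (hφ : ContDiff ℝ ∞ φ)
    (hφc : HasCompactSupport φ) : ∫ x, f x * deriv φ x = - ∫ x, deriv f x * φ x := by
  have c1 := hf.continuous
  have c2 := hf.continuous_deriv le_rfl
  have c3 := hφ.continuous
  have c4 := hφ.continuous_deriv (by simp)
  apply integral_mul_deriv_eq_deriv_mul_of_integrable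
  · exact fun x _ => (hf.differentiable (by simp) x).hasDerivAt
  · exact fun x _ => (hφ.differentiable (by simp) x).hasDerivAt
  · exact (c1.mul c4).integrable_of_hasCompactSupport hφc.deriv.mul_left
  · exact (c2.mul c3).integrable_of_hasCompactSupport hφc.mul_left
  · exact (c1.mul c3).integrable_of_hasCompactSupport hφc.mul_left

theorem contDiff_deriv {f : ℝ → ℝ} {n : ℕ} (hf : ContDiff ℝ (n + 1) f) : ContDiff ℝ n (deriv f) :=
  ((contDiff_succ_iff_deriv (n := n)).1 hf).2.2

/-- The weak derivative of order `k
    + 1` is the weak derivative of the classical one of order `k`. -/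
theorem weakDeriv_iteratedDeriv {f g : ℝ → ℝ} {k : ℕ} (hf : ContDiff ℝ k f)
    (h : IsWeakDeriv (k + 1) f g) (φ : ℝ → ℝ) (hφ : ContDiff ℝ ∞ φ) (hφc : HasCompactSupport φ) :
    ∫ x, iteratedDeriv k f x * deriv φ x = - ∫ x, g x * φ x := by
  have key : ∀ j ≤ k, ∫ x, f x * iteratedDeriv (k + 1) φ x
      = (-1) ^ j * ∫ x, iteratedDeriv j f x * iteratedDeriv (k + 1 - j) φ x := by
    intro j
    induction j with
    | zero => simp
    | succ j ih =>
      intro hj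
      rw [ih (by omega), show k + 1 - j = (k + 1 - (j + 1)) + 1 by omega, iteratedDeriv_succ,
        integral_mul_deriv_of_compact
          (ContDiff.iterate_deriv' 1 j (hf.of_le (by exact_mod_cast (by omega :
              1 + j ≤ k))) |> fun h => by
            rwa [← iteratedDeriv_eq_iterate] at h)
          (iteratedDeriv_smooth hφ _) (iteratedDeriv_hasCompactSupport hφc _), iteratedDeriv_succ,
        pow_succ]
      ring
  have h1 := h φ hφ hφc
  rw [key k le_rfl, show k + 1 - k = 1 by omega, iteratedDeriv_one, pow_succ] at h1
  have h2 : ((-1 : ℝ) ^ k) ≠ 0 := pow_ne_zero _ (by norm_num)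
  apply mul_left_cancel₀ h2
  linarith

theorem memLp_iteratedDeriv {f g : ℝ → ℝ} {k : ℕ} (hf : ContDiff ℝ k f) (hg : MemLp g 2 volume)
    (h : IsWeakDeriv k f g) : MemLp (iteratedDeriv k f) 2 volume := by
  have hgl : LocallyIntegrable g volume := hg.locallyIntegrable (by norm_num)
  have hcont : Continuous (iteratedDeriv k f) := hf.continuous_iteratedDeriv k le_rfl
  have : ∀ᵐ x, g x = iteratedDeriv k f x := by
    apply ae_eq_of_integral_contDiff_smul_eq hgl hcont.locallyIntegrable
    intro φ hφ hφc
    simp only [smul_eq_mul]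
    simp_rw [mul_comm (φ _)]
    cases k with
    | zero =>
      have := h φ hφ hφc
      simp at this
      simpa using this.symm
    | succ k =>
      have h1 := weakDeriv_iteratedDeriv (hf.of_le (by norm_cast; omega)) h φ hφ hφc
      rw [integral_mul_deriv_of_compact _ hφ hφc, ← iteratedDeriv_succ] at h1
      · linarith
      · have := ContDiff.iterate_deriv' 1 k (hf.of_le (by exact_mod_cast (by omega :
            1 + k ≤ k + 1)))
        rwa [← iteratedDeriv_eq_iterate] at this
  exact hg.ae_eq this

theorem iteratedDeriv_holder {f g : ℝ → ℝ} {k : ℕ} (hf : ContDiff ℝ k f) (hg : MemLp g 2 volume)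
    (h : IsWeakDeriv (k + 1) f g) (x y : ℝ) :
    |iteratedDeriv k f x - iteratedDeriv k f y| ≤ (eLpNorm g 2 volume).toReal * √|x - y| := by
  rw [sub_eq_integral_of_weakDeriv (hf.continuous_iteratedDeriv k le_rfl)
    (hg.locallyIntegrable (by norm_num)) (weakDeriv_iteratedDeriv hf h) y x]
  exact abs_intervalIntegral_le_sqrt hg y x

theorem bounded_of_tendsto_cocompact {h : ℝ → ℝ} (hc : Continuous h)
    (h0 : Tendsto h (cocompact ℝ) (𝓝 0)) : ∃ C, ∀ x, |h x| ≤ C := by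
  have h1 := (h0.eventually (Metric.closedBall_mem_nhds (0 : ℝ) one_pos))
  obtain ⟨K, hK, hK'⟩ := mem_cocompact.1 h1
  obtain ⟨C, hC⟩ := hK.exists_bound_of_continuousOn hc.continuousOn
  refine ⟨max C 1, fun x => ?_⟩
  by_cases hx : x ∈ K
  · exact (hC x hx).trans (le_max_left _ _)
  · have := hK' hx
    simp only [mem_ofPred_eq, dist_zero_right, Real.norm_eq_abs] at this
    exact this.trans (le_max_right _ _)

/-- The qualitative regularity of a classical solution that the maximum principles use. -/
structure RegularFlow (T : ℝ) (f : ℝ → ℝ → ℝ) : Prop where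
  contDiff : ∀ t ∈ Icc 0 T, ContDiff ℝ 2 (f t)
  decay : ∀ t ∈ Icc 0 T, ∀ j ≤ 2, Tendsto (iteratedDeriv j (f t)) (cocompact ℝ) (𝓝 0)
  uniform : ∀ j ≤ 2, ∀ t₀ ∈ Icc 0 T,
    TendstoUniformly (fun t => iteratedDeriv j (f t)) (iteratedDeriv j (f t₀)) (𝓝[Icc 0 T] t₀)
  holder : ∀ t₀ ∈ Icc 0 T, ∃ C : ℝ, ∀ᶠ t in 𝓝[Icc 0 T] t₀, ∀ x y,
    |iteratedDeriv 2 (f t) x - iteratedDeriv 2 (f t) y| ≤ C * √|x - y|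

theorem IsClassicalSolution.regularFlow {l ρ₁ ρ₂ T : ℝ} {f₀ : ℝ → ℝ} {f : ℝ → ℝ → ℝ}
    (hf : IsClassicalSolution l ρ₁ ρ₂ T f₀ f) : RegularFlow T f where
  contDiff := hf.space.1
  uniform := hf.space.2
  decay := by
    intro t ht j hj
    have hc : ContDiff ℝ j (f t) := (hf.space.1 t ht).of_le (by exact_mod_cast hj)
    obtain ⟨g, hg, -⟩ := hf.sobolev.2 j (by omega)
    obtain ⟨g', hg', -⟩ := hf.sobolev.2 (j + 1) (by omega)
    exact tendsto_cocompact_zero_of_memLp (hc.continuous_iteratedDeriv j le_rfl)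
      (memLp_iteratedDeriv hc (hg t ht).1 (hg t ht).2)
      (iteratedDeriv_holder hc (hg' t ht).1 (hg' t ht).2)
  holder := by
    intro t₀ ht₀
    obtain ⟨g, hg, hcont⟩ := hf.sobolev.2 3 le_rfl
    refine ⟨1 + (eLpNorm (g t₀) 2 volume).toReal, ?_⟩
    filter_upwards [(hcont t₀ ht₀).eventually (gt_mem_nhds one_pos), self_mem_nhdsWithin]
      with t ht htm x y
    refine (iteratedDeriv_holder (k := 2) (hf.space.1 t htm) (hg t htm).1 (hg t htm).2 x y).trans ?_
    gcongr
    have h1 : eLpNorm (g t) 2 volume ≤ 1 + eLpNorm (g t₀) 2 volume := by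
      calc eLpNorm (g t) 2 volume = eLpNorm ((g t - g t₀) + g t₀) 2 volume := by simp
        _ ≤ eLpNorm (g t - g t₀) 2 volume + eLpNorm (g t₀) 2 volume :=
          eLpNorm_add_le ((hg t htm).1.1.sub (hg t₀ ht₀).1.1) (hg t₀ ht₀).1.1 (by norm_num)
        _ ≤ _ := by gcongr
    have h2 := ENNReal.toReal_mono (ENNReal.add_ne_top.2 ⟨ENNReal.one_ne_top,
        (hg t₀ ht₀).1.2.ne⟩) h1
    rwa [ENNReal.toReal_add ENNReal.one_ne_top (hg t₀ ht₀).1.2.ne, ENNReal.toReal_one] at h2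

theorem IsWeakDeriv.neg {k : ℕ} {f g : ℝ → ℝ} (h : IsWeakDeriv k f g) : IsWeakDeriv k (-f)
    (-g) := by
  intro φ hφ hφc
  have := h φ hφ hφc
  simp only [Pi.neg_apply, neg_mul, integral_neg]
  rw [this]
  ring

theorem iteratedDeriv_neg_eq (j : ℕ) (f : ℝ → ℝ) : iteratedDeriv j (-f) = - iteratedDeriv j f := by
  funext x
  exact iteratedDeriv_neg j f x

theorem muskatIntegrand_neg (l : ℝ) (f : ℝ → ℝ) (x : ℝ) :
    muskatIntegrand l (-f) x = - muskatIntegrand l f x := by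
  funext η
  have h : deriv (-f) = - deriv f := funext fun x => deriv.neg
  have e1 : Real.pi / (2 * l) * (-f x - -f (x - η)) = -(Real.pi / (2 * l) * (f x - f (x - η))) := by ring
  have e2 : Real.pi / (2 * l) * (-f x + -f (x - η)) = -(Real.pi / (2 * l) * (f x
      + f (x - η))) := by ring
  simp only [muskatIntegrand, kernelOne, kernelTwo, h, Pi.neg_apply, e1, e2, Real.cos_neg]
  ring

theorem HasPVIntegral.neg {g : ℝ → ℝ} {I : ℝ} (h : HasPVIntegral g I) : HasPVIntegral (-g)
    (-I) := by
  unfold HasPVIntegral at *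
  refine (Tendsto.neg h).congr fun p => ?_
  simp only [Pi.neg_apply, intervalIntegral.integral_neg]
  ring

theorem tendstoUniformly_neg {ι : Type*} {F : ι → ℝ → ℝ} {G : ℝ → ℝ} {L : Filter ι}
    (h : TendstoUniformly F G L) : TendstoUniformly (fun i => - F i) (-G) L := by
  rw [Metric.tendstoUniformly_iff] at *
  intro ε hε
  filter_upwards [h ε hε] with i hi x
  simpa [dist_neg_neg] using hi x

theorem IsClassicalSolution.neg {l ρ₁ ρ₂ T : ℝ} {f₀ : ℝ → ℝ} {f : ℝ → ℝ → ℝ}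
    (hf : IsClassicalSolution l ρ₁ ρ₂ T f₀ f) :
    IsClassicalSolution l ρ₁ ρ₂ T (-f₀) (fun t => - f t) where
  initial := by rw [hf.initial]
  sobolev := by
    refine ⟨fun t ht => ?_, fun k hk => ?_⟩
    · obtain ⟨⟨h1, h2⟩, h3⟩ := hf.sobolev.1 t ht
      refine ⟨⟨h1.neg, fun k hk => ?_⟩, by rwa [eLpNorm_neg]⟩
      obtain ⟨g, hg, hg'⟩ := h2 k hk
      exact ⟨-g, hg.neg, hg'.neg⟩
    · obtain ⟨g, hg, hg'⟩ := hf.sobolev.2 k hk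
      refine ⟨fun t => - g t, fun t ht => ⟨(hg t ht).1.neg, (hg t ht).2.neg⟩, fun t₀ ht₀ => ?_⟩
      refine (hg' t₀ ht₀).congr fun t => ?_
      rw [← eLpNorm_neg]
      congr 1
      funext x
      simp only [Pi.neg_apply, Pi.sub_apply]
      ring
  space := by
    refine ⟨fun t ht => (hf.space.1 t ht).neg, fun j hj t₀ ht₀ => ?_⟩
    simp only [iteratedDeriv_neg_eq]
    exact tendstoUniformly_neg (hf.space.2 j hj t₀ ht₀)
  evolution := by
    obtain ⟨ft, h1, h2⟩ := hf.evolution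
    refine ⟨fun t => - ft t, ⟨fun t ht => (h1.1 t ht).neg, fun j hj t₀ ht₀ => ?_⟩, fun t ht x => ?_⟩
    · simp only [iteratedDeriv_neg_eq]
      exact tendstoUniformly_neg (h1.2 j hj t₀ ht₀)
    · obtain ⟨h3, I, hI, h4⟩ := h2 t ht x
      refine ⟨h3.neg, -I, ?_, ?_⟩
      · rw [muskatIntegrand_neg]; exact hI.neg
      · simp only [Pi.neg_apply, h4]; ring

theorem tendsto_prod_of_tendstoUniformly {u : ℝ → ℝ → ℝ} {t₀ x₀ : ℝ} {L : Filter ℝ}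
    (hc : Continuous (u t₀)) (hu : TendstoUniformly u (u t₀) L) :
    Tendsto (fun p : ℝ × ℝ => u p.1 p.2) (L ×ˢ 𝓝 x₀) (𝓝 (u t₀ x₀)) := by
  rw [Metric.tendsto_nhds]
  intro ε hε
  have h1 := Metric.tendstoUniformly_iff.1 hu (ε / 2) (half_pos hε)
  have h2 := Metric.tendsto_nhds.1 (hc.tendsto x₀) (ε / 2) (half_pos hε)
  filter_upwards [h1.prod_mk h2] with p hp
  have := dist_triangle (u p.1 p.2) (u t₀ p.2) (u t₀ x₀)
  have h3 := hp.1 p.2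
  rw [dist_comm] at h3
  linarith [hp.2]

/-- A maximum principle: a bound that is not crossed at the points where it is attained holds for
all times. -/
theorem abs_le_of_not_crossed {T S : ℝ} {u : ℝ → ℝ → ℝ} (hS : 0 < S)
    (hc : ∀ t ∈ Icc 0 T, Continuous (u t))
    (hdecay : ∀ t ∈ Icc 0 T, Tendsto (u t) (cocompact ℝ) (𝓝 0))
    (hunif : ∀ t₀ ∈ Icc 0 T, TendstoUniformly u (u t₀) (𝓝[Icc 0 T] t₀))
    (h0 : ∀ x, |u 0 x| ≤ S)
    (hup : ∀ t₀ ∈ Ico 0 T, (∀ x, |u t₀ x| ≤ S) → ∀ x₀, u t₀ x₀ = S →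
      ∀ᶠ p in 𝓝[Icc t₀ T] t₀ ×ˢ 𝓝 x₀, u p.1 p.2 ≤ S)
    (hdown : ∀ t₀ ∈ Ico 0 T, (∀ x, |u t₀ x| ≤ S) → ∀ x₀, u t₀ x₀ = -S →
      ∀ᶠ p in 𝓝[Icc t₀ T] t₀ ×ˢ 𝓝 x₀, -S ≤ u p.1 p.2) :
    ∀ t ∈ Icc 0 T, ∀ x, |u t x| ≤ S := by
  rcases lt_or_ge T 0 with hT | hT
  · intro t ht; linarith [ht.1, ht.2]
  set s : Set ℝ := {t | ∀ x, |u t x| ≤ S} with hs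
  have hclosed : IsClosed (s ∩ Icc 0 T) := by
    apply isClosed_of_closure_subset
    intro t ht
    have htI : t ∈ Icc 0 T := by
      have := closure_mono inter_subset_right ht
      rwa [isClosed_Icc.closure_eq] at this
    refine ⟨fun x => ?_, htI⟩
    have : (𝓝[s ∩ Icc 0 T] t).NeBot := mem_closure_iff_nhdsWithin_neBot.1 ht
    have h1 : Tendsto (fun τ => u τ x) (𝓝[s ∩ Icc 0 T] t) (𝓝 (u t x)) :=
      ((hunif t htI).tendsto_at x).mono_left (nhdsWithin_mono t inter_subset_right)
    exact le_of_tendsto h1.abs (by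
      filter_upwards [self_mem_nhdsWithin] with τ hτ using hτ.1 x)
  have hsub := hclosed.Icc_subset_of_forall_mem_nhdsWithin (a := 0) (b := T) h0 (by
    rintro t₀ ⟨ht₀s, ht₀⟩
    have ht₀I : t₀ ∈ Icc 0 T := ⟨ht₀.1, ht₀.2.le⟩
    have hle : 𝓝[Icc t₀ T] t₀ ≤ 𝓝[Icc 0 T] t₀ := nhdsWithin_mono _ (Icc_subset_Icc_left ht₀.1)
    have hun : TendstoUniformly u (u t₀) (𝓝[Icc t₀ T] t₀) := fun v hv => hle (hunif t₀ ht₀I v hv)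
    have hev : ∀ᶠ t in 𝓝[Icc t₀ T] t₀, t ∈ s := by
      obtain ⟨K, hK, hK'⟩ := mem_cocompact.1
        ((hdecay t₀ ht₀I).eventually (Metric.ball_mem_nhds (0 : ℝ) (half_pos hS)))
      have hKev : ∀ᶠ t in 𝓝[Icc t₀ T] t₀, ∀ x ∈ K, |u t x| ≤ S := by
        refine hK.induction_on (p := fun A => ∀ᶠ t in 𝓝[Icc t₀ T] t₀, ∀ x ∈ A, |u t x| ≤ S)
          (by simp) ?_ ?_ ?_
        · intro A B hAB hB
          filter_upwards [hB] with t ht x hx using ht x (hAB hx)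
        · intro A B hA hB
          filter_upwards [hA, hB] with t h1 h2 x hx
          exact hx.elim (h1 x) (h2 x)
        · intro x₀ _
          have hj := tendsto_prod_of_tendstoUniformly (x₀ := x₀) (hc t₀ ht₀I) hun
          have h1 : ∀ᶠ p in 𝓝[Icc t₀ T] t₀ ×ˢ 𝓝 x₀, u p.1 p.2 ≤ S := by
            rcases (abs_le.1 (ht₀s x₀)).2.eq_or_lt with h | h
            · exact hup t₀ ht₀ ht₀s x₀ h
            · exact (hj.eventually (gt_mem_nhds h)).mono fun _ h => le_of_lt h
          have h2 : ∀ᶠ p in 𝓝[Icc t₀ T] t₀ ×ˢ 𝓝 x₀, -S ≤ u p.1 p.2 := by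
            rcases (abs_le.1 (ht₀s x₀)).1.eq_or_lt with h | h
            · exact hdown t₀ ht₀ ht₀s x₀ h.symm
            · exact (hj.eventually (lt_mem_nhds h)).mono fun _ h => le_of_lt h
          obtain ⟨pa, ha, pb, hb, hab⟩ := eventually_prod_iff.1 (h1.and h2)
          refine ⟨{x | pb x}, mem_nhdsWithin_of_mem_nhds hb, ?_⟩
          filter_upwards [ha] with t ht x hx
          exact abs_le.2 ⟨(hab ht hx).2, (hab ht hx).1⟩
      filter_upwards [hKev, Metric.tendstoUniformly_iff.1 hun (S / 2) (half_pos hS)] with t h1 h2 x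
      by_cases hx : x ∈ K
      · exact h1 x hx
      · have h3 := hK' hx
        simp only [mem_ofPred_eq, dist_zero_right, Real.norm_eq_abs] at h3
        have h4 := h2 x
        rw [dist_comm, Real.dist_eq] at h4
        have := abs_sub_abs_le_abs_sub (u t x) (u t₀ x)
        linarith
    have h5 : Ioo t₀ T ⊆ Icc t₀ T := Ioo_subset_Icc_self
    rw [← nhdsWithin_Ioo_eq_nhdsGT ht₀.2]
    exact nhdsWithin_mono _ h5 hev)
  exact fun t ht => hsub ht

theorem hasDerivAt_arctan_tan_div_tanh {δ : ℝ → ℝ} {p η k : ℝ} (hδ : HasDerivAt δ p η)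
    (hη : η ≠ 0) (hk : 0 < k) (hc : Real.cos (k * δ η / 2) ≠ 0) :
    HasDerivAt (fun η => Real.arctan (Real.tan (k * δ η / 2) / Real.tanh (k * η / 2)))
      (k / 2 * ((p * Real.sinh (k * η) - Real.sin (k * δ η))
        / (Real.cosh (k * η) - Real.cos (k * δ η)))) η := by
  have hsh : Real.sinh (k * η / 2) ≠ 0 := by
    rw [Ne, Real.sinh_eq_zero]; positivity
  have hch := (Real.cosh_pos (k * η / 2)).ne'
  have hth : Real.tanh (k * η / 2) ≠ 0 := by
    rw [Real.tanh_eq_sinh_div_cosh]; exact div_ne_zero hsh hch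
  have h1 : HasDerivAt (fun η => k * δ η / 2) (k * p / 2) η := (hδ.const_mul k).div_const 2
  have h2 : HasDerivAt (fun η => k * η / 2) (k / 2) η := by
    simpa using ((hasDerivAt_id η).const_mul k).div_const 2
  have h3 := (((Real.hasDerivAt_tan hc).comp η h1).fun_div ((hasDerivAt_tanh _).comp η h2) hth).arctan
  refine h3.congr_deriv ?_
  simp only [Function.comp]
  have e1 : k * η = 2 * (k * η / 2) := by ring
  have e2 : k * δ η = 2 * (k * δ η / 2) := by ring
  rw [show Real.cosh (k * η) = 1 + 2 * Real.sinh (k * η / 2) ^ 2 by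
      rw [e1, Real.cosh_two_mul, Real.cosh_sq, ← e1]; ring,
    show Real.sinh (k * η) = 2 * Real.sinh (k * η / 2) * Real.cosh (k * η / 2) by
      rw [e1, Real.sinh_two_mul, ← e1],
    show Real.cos (k * δ η) = 1 - 2 * Real.sin (k * δ η / 2) ^ 2 by
      rw [e2, Real.cos_two_mul, Real.cos_sq', ← e2]; ring,
    show Real.sin (k * δ η) = 2 * Real.sin (k * δ η / 2) * Real.cos (k * δ η / 2) by
      rw [e2, Real.sin_two_mul, ← e2],
    Real.tan_eq_sin_div_cos, Real.tanh_eq_sinh_div_cosh]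
  have i1 := Real.sin_sq_add_cos_sq (k * δ η / 2)
  have i2 := Real.cosh_sq (k * η / 2)
  generalize Real.sin (k * δ η / 2) = s at *
  generalize Real.cos (k * δ η / 2) = c at *
  generalize Real.sinh (k * η / 2) = a at *
  generalize Real.cosh (k * η / 2) = b at *
  have i3 : 0 < a ^ 2 + s ^ 2 := by positivity
  have d1 : 1 + (s / c / (a / b)) ^ 2 = (a ^ 2 + s ^ 2) / (c ^ 2 * a ^ 2) := by
    field_simp
    linear_combination a ^ 2 * i1 + s ^ 2 * i2
  have d2 : 1 + 2 * a ^ 2 - (1 - 2 * s ^ 2) = 2 * (a ^ 2 + s ^ 2) := by ring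
  rw [d1, d2]
  field_simp
  linear_combination (-(c * s)) * i2

theorem hasDerivAt_arctan_tan_mul_tanh {σ : ℝ → ℝ} {p η k : ℝ} (hσ : HasDerivAt σ p η)
    (hc : Real.cos (k * σ η / 2) ≠ 0) :
    HasDerivAt (fun η => Real.arctan (Real.tan (k * σ η / 2) * Real.tanh (k * η / 2)))
      (k / 2 * ((p * Real.sinh (k * η) + Real.sin (k * σ η))
        / (Real.cosh (k * η) + Real.cos (k * σ η)))) η := by
  have hch := (Real.cosh_pos (k * η / 2)).ne'
  have h1 : HasDerivAt (fun η => k * σ η / 2) (k * p / 2) η := (hσ.const_mul k).div_const 2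
  have h2 : HasDerivAt (fun η => k * η / 2) (k / 2) η := by
    simpa using ((hasDerivAt_id η).const_mul k).div_const 2
  have h3 := (((Real.hasDerivAt_tan hc).comp η h1).fun_mul ((hasDerivAt_tanh _).comp η h2)).arctan
  refine h3.congr_deriv ?_
  simp only [Function.comp]
  have e1 : k * η = 2 * (k * η / 2) := by ring
  have e2 : k * σ η = 2 * (k * σ η / 2) := by ring
  rw [show Real.cosh (k * η) = 1 + 2 * Real.sinh (k * η / 2) ^ 2 by
      rw [e1, Real.cosh_two_mul, Real.cosh_sq, ← e1]; ring,
    show Real.sinh (k * η) = 2 * Real.sinh (k * η / 2) * Real.cosh (k * η / 2) by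
      rw [e1, Real.sinh_two_mul, ← e1],
    show Real.cos (k * σ η) = 2 * Real.cos (k * σ η / 2) ^ 2 - 1 by
      rw [e2, Real.cos_two_mul, ← e2],
    show Real.sin (k * σ η) = 2 * Real.sin (k * σ η / 2) * Real.cos (k * σ η / 2) by
      rw [e2, Real.sin_two_mul, ← e2],
    Real.tan_eq_sin_div_cos, Real.tanh_eq_sinh_div_cosh]
  have i1 := Real.sin_sq_add_cos_sq (k * σ η / 2)
  have i2 := Real.cosh_sq (k * η / 2)
  generalize Real.sin (k * σ η / 2) = s at *
  generalize Real.cos (k * σ η / 2) = c at *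
  generalize Real.sinh (k * η / 2) = a at *
  generalize Real.cosh (k * η / 2) = b at *
  have i3 : 0 < a ^ 2 + c ^ 2 := by positivity
  have d1 : 1 + (s / c * (a / b)) ^ 2 = (a ^ 2 + c ^ 2) / (c ^ 2 * b ^ 2) := by
    field_simp
    linear_combination a ^ 2 * i1 + c ^ 2 * i2
  have d2 : 1 + 2 * a ^ 2 + (2 * c ^ 2 - 1) = 2 * (a ^ 2 + c ^ 2) := by ring
  rw [d1, d2]
  field_simp
  linear_combination (k * c * s) * i2

theorem continuous_tanh : Continuous Real.tanh :=
  continuous_iff_continuousAt.2 fun x => (hasDerivAt_tanh x).continuousAt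

theorem tendsto_tanh_atTop : Tendsto Real.tanh atTop (𝓝 1) := by
  have h1 : Tendsto (fun x : ℝ => 1 - 2 * Real.exp (-x) ) atTop (𝓝 1) := by
    have := (Real.tendsto_exp_neg_atTop_nhds_zero.const_mul 2).const_sub 1
    simpa using this
  refine tendsto_of_tendsto_of_tendsto_of_le_of_le' h1 tendsto_const_nhds ?_ ?_
  · filter_upwards [eventually_ge_atTop 0] with x hx
    rw [Real.tanh_eq_sinh_div_cosh, le_div_iff₀ (Real.cosh_pos x), Real.sinh_eq, Real.cosh_eq]
    have h2 : Real.exp x * Real.exp (-x) = 1 := by rw [← Real.exp_add]; simp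
    nlinarith [Real.exp_pos (-x), Real.exp_le_one_iff.2 (neg_nonpos.2 hx), Real.exp_pos x]
  · exact Eventually.of_forall fun x => (Real.tanh_lt_one x).le

theorem one_lt_cosh_mul {k η : ℝ} (hk : 0 < k) (hη : η ≠ 0) : 1 < Real.cosh (k * η) :=
  Real.one_lt_cosh.2 (mul_ne_zero hk.ne' hη)

theorem cosh_sub_cos_pos {k η a : ℝ} (hk : 0 < k) (hη : η ≠ 0) :
    0 < Real.cosh (k * η) - Real.cos a := by
  linarith [one_lt_cosh_mul hk hη, Real.cos_le_one a]

theorem cosh_add_cos_pos {k η a : ℝ} (hk : 0 < k) (hη : η ≠ 0) :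
    0 < Real.cosh (k * η) + Real.cos a := by
  linarith [one_lt_cosh_mul hk hη, Real.neg_one_le_cos a]

theorem ne_zero_of_mem_uIcc {a b η : ℝ} (h : 0 < a * b) (hη : η ∈ uIcc a b) : η ≠ 0 := by
  rintro rfl
  rcases mem_uIcc.1 hη with h1 | h1 <;> nlinarith [h1.1, h1.2]

/-- The value of the principal value integral at a maximum, apart from total derivatives. -/
def maxDefect (k S : ℝ) (g : ℝ → ℝ) (x η : ℝ) : ℝ :=
  -Real.sin (k * (S - g (x - η))) / (Real.cosh (k * η) - Real.cos (k * (S - g (x - η))))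
    + Real.sin (k * (S + g (x - η))) / (Real.cosh (k * η) + Real.cos (k * (S + g (x - η))))
    - Real.sin (k * (2 * S)) / (Real.cosh (k * η) + Real.cos (k * (2 * S)))

/-- The total derivative part of the principal value integral at a maximum. -/
def maxPotential (k S : ℝ) (g : ℝ → ℝ) (x η : ℝ) : ℝ :=
  Real.arctan (Real.tan (k * (S - g (x - η)) / 2) / Real.tanh (k * η / 2))
    + Real.arctan (Real.tan (k * (S + g (x - η)) / 2) * Real.tanh (k * η / 2))
    - Real.arctan (Real.tan (k * (2 * S) / 2) * Real.tanh (k * η / 2))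

section Max

variable {k S x₀ : ℝ} {g : ℝ → ℝ}

theorem cos_half_pos {a : ℝ} (h0 : 0 ≤ a) (h1 : a ≤ 2 * S) (hk : 0 < k)
    (hkS : k * S ≤ Real.pi / 4) : 0 < Real.cos (k * a / 2) := by
  have : k * a ≤ k * (2 * S) := by gcongr
  have : 0 ≤ k * a := by positivity
  apply Real.cos_pos_of_mem_Ioo
  constructor <;> linarith [Real.pi_pos]

theorem hasDerivAt_comp_sub {g : ℝ → ℝ} (hg : ContDiff ℝ 1 g) (x η : ℝ) :
    HasDerivAt (fun η => g (x - η)) (-deriv g (x - η)) η := by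
  have h := (hg.differentiable (by simp) (x - η)).hasDerivAt
  exact (h.comp η ((hasDerivAt_id' η).const_sub x)).congr_deriv (by simp)

theorem hasDerivAt_maxPotential (hg : ContDiff ℝ 1 g) (hk : 0 < k) (hkS : k * S ≤ Real.pi / 4)
    (hle : ∀ x, |g x| ≤ S) {η : ℝ} (hη : η ≠ 0) :
    HasDerivAt (maxPotential k S g x₀) (k / 2 * (maxDefect k S g x₀ η
      + deriv g (x₀ - η) * (Real.sinh (k * η) / (Real.cosh (k * η) - Real.cos (k * (S - g (x₀ - η))))
        - Real.sinh (k * η) / (Real.cosh (k * η) + Real.cos (k * (S + g (x₀ - η))))))) η := by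
  have hS : 0 ≤ S := (abs_nonneg _).trans (hle 0)
  have hb := abs_le.1 (hle (x₀ - η))
  have h0 := hasDerivAt_comp_sub hg x₀ η
  have h1 := hasDerivAt_arctan_tan_div_tanh (h0.const_sub S) hη hk
    (cos_half_pos (by linarith) (by linarith) hk hkS).ne'
  have h2 := hasDerivAt_arctan_tan_mul_tanh (h0.const_add S) (k := k)
    (cos_half_pos (by linarith) (by linarith) hk hkS).ne'
  have h3 := hasDerivAt_arctan_tan_mul_tanh (hasDerivAt_const η (2 * S)) (k := k)
    (cos_half_pos (by linarith) le_rfl hk hkS).ne'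
  refine ((h1.fun_add h2).fun_sub h3).congr_deriv ?_
  unfold maxDefect
  ring

theorem continuousOn_maxDefect (hg : Continuous g) (hk : 0 < k) {a b : ℝ} (hab : 0 < a * b) :
    ContinuousOn (maxDefect k S g x₀) (uIcc a b) := by
  have hne : ∀ η ∈ uIcc a b, η ≠ 0 := fun η hη => ne_zero_of_mem_uIcc hab hη
  unfold maxDefect
  refine ((ContinuousOn.div ?_ ?_ ?_).add (ContinuousOn.div ?_ ?_ ?_)).sub (ContinuousOn.div ?_ ?_ ?_)
  any_goals exact Continuous.continuousOn (by fun_prop)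
  · exact fun η hη => (cosh_sub_cos_pos hk (hne η hη)).ne'
  · exact fun η hη => (cosh_add_cos_pos hk (hne η hη)).ne'
  · exact fun η hη => (cosh_add_cos_pos hk (hne η hη)).ne'

theorem maxDefect_nonpos (hk : 0 < k) (hkS : k * S ≤ Real.pi / 4) (hle : ∀ x, |g x| ≤ S)
    {η : ℝ} (hη : η ≠ 0) : maxDefect k S g x₀ η ≤ 0 ∧
      (g (x₀ - η) < S → maxDefect k S g x₀ η < 0) := by
  have hS : 0 ≤ S := (abs_nonneg _).trans (hle 0)
  have hb := abs_le.1 (hle (x₀ - η))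
  have hpi := Real.pi_pos
  set a := g (x₀ - η) with ha
  have m1 : k * (S - a) ≤ k * (2 * S) := by gcongr; linarith
  have m2 : k * (S + a) ≤ k * (2 * S) := by gcongr; linarith
  have n1 : 0 ≤ k * (S - a) := mul_nonneg hk.le (by linarith)
  have n2 : 0 ≤ k * (S + a) := mul_nonneg hk.le (by linarith)
  have d1 := cosh_sub_cos_pos (a := k * (S - a)) hk hη
  have d2 := cosh_add_cos_pos (a := k * (S + a)) hk hη
  have d3 := cosh_add_cos_pos (a := k * (2 * S)) hk hη
  have hsin : Real.sin (k * (S + a)) ≤ Real.sin (k * (2 * S)) :=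
    Real.sin_le_sin_of_le_of_le_pi_div_two (by linarith) (by linarith) m2
  have hcos : Real.cos (k * (2 * S)) ≤ Real.cos (k * (S + a)) :=
    Real.cos_le_cos_of_nonneg_of_le_pi n2 (by linarith) m2
  have hs2 : 0 ≤ Real.sin (k * (2 * S)) :=
    Real.sin_nonneg_of_nonneg_of_le_pi (by positivity) (by linarith)
  have e1 : Real.sin (k * (S + a)) / (Real.cosh (k * η) + Real.cos (k * (S + a)))
      ≤ Real.sin (k * (2 * S)) / (Real.cosh (k * η) + Real.cos (k * (2 * S))) := by
    gcongr
  unfold maxDefect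
  rw [← ha]
  constructor
  · have : 0 ≤ Real.sin (k * (S - a)) := Real.sin_nonneg_of_nonneg_of_le_pi n1 (by linarith)
    have : 0 ≤ Real.sin (k * (S - a)) / (Real.cosh (k * η) - Real.cos (k * (S - a))) :=
        by positivity
    rw [neg_div]
    linarith
  · intro hlt
    have : 0 < Real.sin (k * (S - a)) :=
      Real.sin_pos_of_pos_of_lt_pi (mul_pos hk (by linarith)) (by linarith)
    have : 0 < Real.sin (k * (S - a)) / (Real.cosh (k * η) - Real.cos (k * (S - a))) :=
        by positivity
    rw [neg_div]
    linarith

theorem tendsto_maxPotential_of_tanh {L : Filter ℝ} {s : ℝ} (hs : s = 1 ∨ s = -1) (hk : 0 < k)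
    (hS : 0 ≤ S)
    (hkS : k * S ≤ Real.pi / 4) (hg : Tendsto (fun η => g (x₀ - η)) L (𝓝 0))
    (ht : Tendsto (fun η => Real.tanh (k * η / 2)) L (𝓝 s)) :
    Tendsto (maxPotential k S g x₀) L (𝓝 0) := by
  have hpi := Real.pi_pos
  have hs0 : s ≠ 0 := by rcases hs with rfl | rfl <;> norm_num
  have hc := cos_half_pos (a := S) hS (by linarith) hk hkS
  have t1 : Tendsto (fun η => Real.tan (k * (S - g (x₀ - η)) / 2)) L (𝓝 (Real.tan (k * S / 2))) := by
    refine (Real.continuousAt_tan.2 hc.ne').tendsto.comp ?_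
    simpa using ((hg.const_sub S).const_mul k).div_const 2
  have t2 : Tendsto (fun η => Real.tan (k * (S
      + g (x₀ - η)) / 2)) L (𝓝 (Real.tan (k * S / 2))) := by
    refine (Real.continuousAt_tan.2 hc.ne').tendsto.comp ?_
    simpa using ((hg.const_add S).const_mul k).div_const 2
  have h1 := Real.continuous_arctan.tendsto _ |>.comp (t1.div ht hs0)
  have h2 := Real.continuous_arctan.tendsto _ |>.comp (t2.mul ht)
  have h3 := Real.continuous_arctan.tendsto _ |>.comp (ht.const_mul (Real.tan (k * (2 * S) / 2)))
  have h4 := (h1.add h2).sub h3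
  have hk0 : 0 ≤ k * S := by positivity
  have a1 : Real.arctan (Real.tan (k * S / 2)) = k * S / 2 :=
    Real.arctan_tan (by linarith) (by linarith)
  have a2 : Real.arctan (Real.tan (k * (2 * S) / 2)) = k * (2 * S) / 2 :=
    Real.arctan_tan (by linarith) (by linarith)
  have hzero : Real.arctan (Real.tan (k * S / 2) / s) + Real.arctan (Real.tan (k * S / 2) * s)
      - Real.arctan (Real.tan (k * (2 * S) / 2) * s) = 0 := by
    rcases hs with rfl | rfl
    · rw [div_one, mul_one, mul_one, a1, a2]; ring
    · rw [div_neg, div_one, mul_neg, mul_one, mul_neg, mul_one, Real.arctan_neg, Real.arctan_neg,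
          a1, a2]
      ring
  rw [hzero] at h4
  exact h4

theorem tendsto_maxPotential_zero (hg : ContDiff ℝ 1 g) (hk : 0 < k) (hmax : g x₀ = S)
    (hd : deriv g x₀ = 0) (hc0 : Real.cos (k * (2 * S) / 2) ≠ 0) :
    Tendsto (maxPotential k S g x₀) (𝓝[≠] 0) (𝓝 0) := by
  have hth0 : Tendsto (fun η : ℝ => Real.tanh (k * η / 2)) (𝓝[≠] 0) (𝓝 0) := by
    have : Continuous fun η : ℝ => Real.tanh (k * η / 2) :=
      continuous_tanh.comp (by fun_prop)
    simpa using (this.tendsto 0).mono_left nhdsWithin_le_nhds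
  have h0 := hasDerivAt_comp_sub hg x₀ 0
  rw [sub_zero, hd, neg_zero] at h0
  have hgc : Tendsto (fun η => g (x₀ - η)) (𝓝[≠] 0) (𝓝 S) := by
    have := h0.continuousAt.tendsto.mono_left (nhdsWithin_le_nhds (s := {0}ᶜ))
    simpa [hmax] using this
  have hδ : HasDerivAt (fun η => Real.tan (k * (S - g (x₀ - η)) / 2)) 0 0 := by
    have h1 : HasDerivAt (fun η => k * (S - g (x₀ - η)) / 2) 0 0 := by
      simpa using ((h0.const_sub S).const_mul k).div_const 2
    have h2 := (Real.hasDerivAt_tan (x := k * (S - g (x₀ - 0)) / 2) (by simp [hmax])).comp 0 h1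
    exact h2.congr_deriv (by simp)
  have hτ : HasDerivAt (fun η : ℝ => Real.tanh (k * η / 2)) (k / 2) 0 := by
    have h1 : HasDerivAt (fun η : ℝ => k * η / 2) (k / 2) 0 := by
      simpa using ((hasDerivAt_id (0 : ℝ)).const_mul k).div_const 2
    have h2 := (hasDerivAt_tanh (k * 0 / 2)).comp 0 h1
    exact h2.congr_deriv (by simp)
  have hq : Tendsto (fun η => Real.tan (k * (S - g (x₀ - η)) / 2) / Real.tanh (k * η / 2))
      (𝓝[≠] 0) (𝓝 0) := by
    have h1 := hδ.tendsto_slope_zero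
    have h2 := hτ.tendsto_slope_zero
    have h3 := h1.div h2 (by positivity)
    simp only [zero_div] at h3
    refine h3.congr' ?_
    filter_upwards [self_mem_nhdsWithin] with η hη
    simp only [zero_add, Pi.div_apply, sub_zero, hmax, sub_self, mul_zero, zero_div, Real.tan_zero,
      Real.tanh_zero, smul_eq_mul]
    exact mul_div_mul_left _ _ (inv_ne_zero hη)
  have t2 : Tendsto (fun η => Real.tan (k * (S + g (x₀ - η)) / 2)) (𝓝[≠] 0)
      (𝓝 (Real.tan (k * (2 * S) / 2))) := by
    refine (Real.continuousAt_tan.2 hc0).tendsto.comp ?_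
    have := ((hgc.const_add S).const_mul k).div_const 2
    rwa [← two_mul] at this
  have h1 := Real.continuous_arctan.tendsto _ |>.comp hq
  have h2 := Real.continuous_arctan.tendsto _ |>.comp (t2.mul hth0)
  have h3 := Real.continuous_arctan.tendsto _ |>.comp (hth0.const_mul (Real.tan (k * (2 * S) / 2)))
  have h4 := (h1.add h2).sub h3
  simp only [mul_zero, Real.arctan_zero, add_zero, sub_zero] at h4
  exact h4

end Max

/-- The velocity of the interface is negative at a positive maximum. -/
theorem pvIntegral_neg_of_max {l S x₀ I : ℝ} {g : ℝ → ℝ} (hl : 0 < l) (hg : ContDiff ℝ 1 g)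
    (hdec : Tendsto g (cocompact ℝ) (𝓝 0)) (hS : 0 < S)
    (hkS : Real.pi / (2 * l) * S ≤ Real.pi / 4) (hle : ∀ x, |g x| ≤ S) (hmax : g x₀ = S)
    (hI : HasPVIntegral (muskatIntegrand l g x₀) I) : I < 0 := by
  set k := Real.pi / (2 * l) with hkdef
  have hk : 0 < k := by have := Real.pi_pos; positivity
  have hpi := Real.pi_pos
  have hd : deriv g x₀ = 0 :=
    IsLocalMax.deriv_eq_zero (Eventually.of_forall fun x => by
      rw [hmax]; exact (abs_le.1 (hle x)).2)
  have hgc := hg.continuous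
  have hm : ∀ η, muskatIntegrand l g x₀ η = -(deriv g (x₀ - η) *
      (Real.sinh (k * η) / (Real.cosh (k * η) - Real.cos (k * (S - g (x₀ - η))))
        - Real.sinh (k * η) / (Real.cosh (k * η) + Real.cos (k * (S + g (x₀ - η)))))) := by
    intro η
    simp only [muskatIntegrand, kernelOne, kernelTwo, ← hkdef, hmax, hd]
    ring
  have hint : ∀ a b, 0 < a * b → ∫ η in a..b, muskatIntegrand l g x₀ η
      = (∫ η in a..b, maxDefect k S g x₀ η)
        - 2 / k * (maxPotential k S g x₀ b - maxPotential k S g x₀ a) := by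
    intro a b hab
    have hne : ∀ η ∈ uIcc a b, η ≠ 0 := fun η hη => ne_zero_of_mem_uIcc hab hη
    have hD := (continuousOn_maxDefect (S := S) (x₀ := x₀) hgc hk hab)
    have hM : ContinuousOn (muskatIntegrand l g x₀) (uIcc a b) := by
      have hfun : muskatIntegrand l g x₀ = fun η => -(deriv g (x₀ - η) *
        (Real.sinh (k * η) / (Real.cosh (k * η) - Real.cos (k * (S - g (x₀ - η))))
        - Real.sinh (k * η) / (Real.cosh (k * η) + Real.cos (k * (S + g (x₀ - η)))))) := funext hm
      rw [hfun]
      have hg' := hg.continuous_deriv le_rfl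
      refine ContinuousOn.neg (ContinuousOn.mul ?_ (ContinuousOn.sub (ContinuousOn.div ?_ ?_ ?_)
        (ContinuousOn.div ?_ ?_ ?_)))
      any_goals exact Continuous.continuousOn (by fun_prop)
      · exact fun η hη => (cosh_sub_cos_pos hk (hne η hη)).ne'
      · exact fun η hη => (cosh_add_cos_pos hk (hne η hη)).ne'
    have hftc := intervalIntegral.integral_eq_sub_of_hasDerivAt (f := maxPotential k S g x₀)
      (f' := fun η => k / 2 * (maxDefect k S g x₀ η - muskatIntegrand l g x₀ η)) (a := a) (b := b)
      (fun η hη => (hasDerivAt_maxPotential hg hk hkS hle (hne η hη)).congr_deriv (by rw [hm]; ring))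
      ((continuousOn_const.mul (hD.sub hM)).intervalIntegrable)
    rw [intervalIntegral.integral_const_mul,
      intervalIntegral.integral_sub hD.intervalIntegrable hM.intervalIntegrable] at hftc
    rw [← hftc]
    field_simp
    ring
  obtain ⟨R₀, hR₀, hfar⟩ : ∃ R₀ : ℝ, 0 < R₀ ∧ ∀ η, R₀ ≤ η → g (x₀ - η) < S := by
    have h1 : Tendsto (fun η => g (x₀ - η)) atTop (𝓝 0) := by
      refine (hdec.mono_left ?_).comp (tendsto_atBot_add_const_left atTop x₀ tendsto_neg_atTop_atBot)
      rw [cocompact_eq_atBot_atTop]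
      exact le_sup_left
    obtain ⟨R, hR⟩ := eventually_atTop.1 (h1.eventually (gt_mem_nhds hS))
    exact ⟨max R 1, by positivity, fun η hη => hR η ((le_max_left _ _).trans hη)⟩
  set c := -∫ η in R₀..(R₀ + 1), maxDefect k S g x₀ η with hc
  have hcpos : 0 < c := by
    rw [hc, ← intervalIntegral.integral_neg]
    have hcont := continuousOn_maxDefect (S := S) (x₀ := x₀) hgc hk
      (show 0 < R₀ * (R₀ + 1) by positivity)
    apply intervalIntegral.intervalIntegral_pos_of_pos_on hcont.neg.intervalIntegrable _ (by linarith)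
    intro η hη
    have := (maxDefect_nonpos (x₀ := x₀) hk hkS hle (hR₀.trans hη.1).ne').2 (hfar η hη.1.le)
    simpa using this
  have hneg1 : ∀ ε R : ℝ, 0 < ε → ε < R → ∫ η in (-R)..(-ε), maxDefect k S g x₀ η ≤ 0 := by
    intro ε R hε hR
    have h1 : 0 ≤ ∫ η in (-R)..(-ε), -maxDefect k S g x₀ η := by
      apply intervalIntegral.integral_nonneg (by linarith)
      intro η hη
      have := (maxDefect_nonpos (x₀ := x₀) hk hkS hle (show η ≠ 0 by linarith [hη.2])).1
      linarith
    rw [intervalIntegral.integral_neg] at h1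
    linarith
  have hneg2 : ∀ ε R : ℝ, 0 < ε → ε < R₀ → R₀ + 1 < R → ∫ η in ε..R, maxDefect k S g x₀ η ≤ -c := by
    intro ε R hε hεR hR
    have hcont := continuousOn_maxDefect (S := S) (x₀ := x₀) hgc hk
      (show 0 < ε * R by have : 0 < R := by linarith
                         positivity)
    have h1 := intervalIntegral.integral_mono_interval (μ := volume)
        (f := fun η => -maxDefect k S g x₀ η)
      hεR.le (by linarith : R₀ ≤ R₀ + 1) hR.le (by
        filter_upwards [ae_restrict_mem measurableSet_Ioc] with η hη
        have := (maxDefect_nonpos (x₀ := x₀) hk hkS hle (hε.trans hη.1).ne').1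
        simpa using this) hcont.neg.intervalIntegrable
    rw [intervalIntegral.integral_neg, intervalIntegral.integral_neg] at h1
    linarith
  set W := maxPotential k S g x₀ with hW
  have htop : Tendsto (fun η : ℝ => k * η / 2) atTop atTop :=
    (tendsto_id.const_mul_atTop hk).atTop_div_const two_pos
  have hWtop : Tendsto W atTop (𝓝 0) := by
    refine tendsto_maxPotential_of_tanh (Or.inl rfl) hk hS.le hkS ?_ (tendsto_tanh_atTop.comp htop)
    refine (hdec.mono_left ?_).comp (tendsto_atBot_add_const_left atTop x₀ tendsto_neg_atTop_atBot)
    rw [cocompact_eq_atBot_atTop]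
    exact le_sup_left
  have hWbot : Tendsto (fun R => W (-R)) atTop (𝓝 0) := by
    suffices h : Tendsto W atBot (𝓝 0) from h.comp tendsto_neg_atTop_atBot
    refine tendsto_maxPotential_of_tanh (Or.inr rfl) hk hS.le hkS ?_ ?_
    · refine (hdec.mono_left ?_).comp (tendsto_atTop_add_const_left atBot x₀ tendsto_neg_atBot_atTop)
      rw [cocompact_eq_atBot_atTop]
      exact le_sup_right
    · have h1 := ((tendsto_tanh_atTop.comp htop).comp tendsto_neg_atBot_atTop).neg
      refine h1.congr fun η => ?_
      simp only [Function.comp]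
      rw [show k * -η / 2 = -(k * η / 2) by ring, Real.tanh_neg, neg_neg]
  have hW0 := tendsto_maxPotential_zero (x₀ := x₀) hg hk hmax hd
    (cos_half_pos (by linarith : 0 ≤ 2 * S) le_rfl hk hkS).ne'
  have hWp : Tendsto W (𝓝[>] 0) (𝓝 0) := hW0.mono_left (nhdsWithin_mono 0 fun x hx => ne_of_gt hx)
  have hWm : Tendsto (fun ε => W (-ε)) (𝓝[>] 0) (𝓝 0) := by
    refine hW0.comp (tendsto_nhdsWithin_iff.2 ⟨?_, ?_⟩)
    · simpa using (continuous_neg.tendsto (0 : ℝ)).mono_left nhdsWithin_le_nhds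
    · filter_upwards [self_mem_nhdsWithin] with ε hε
      exact neg_ne_zero.2 (ne_of_gt hε)
  have hlim : Tendsto (fun p : ℝ × ℝ => -c - 2 / k * ((W (-p.1) - W (-p.2)) + (W p.2 - W p.1)))
      ((𝓝[>] (0 : ℝ)) ×ˢ atTop) (𝓝 (-c)) := by
    have h1 := ((((hWm.comp (tendsto_fst (g := atTop))).sub
      (hWbot.comp (tendsto_snd (f := 𝓝[>] (0 : ℝ))))).add
      ((hWtop.comp (tendsto_snd (f := 𝓝[>] (0 : ℝ)))).sub
        (hWp.comp (tendsto_fst (g := atTop))))).const_mul (2 / k)).const_sub (-c)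
    simp only [sub_zero, add_zero, mul_zero] at h1
    exact h1
  have hle' : I ≤ -c := by
    refine le_of_tendsto_of_tendsto hI hlim ?_
    have e1 : ∀ᶠ ε in 𝓝[>] (0 : ℝ), 0 < ε ∧ ε < R₀ := by
      filter_upwards [Ioo_mem_nhdsGT hR₀] with ε hε using hε
    filter_upwards [e1.prod_mk (eventually_gt_atTop (R₀ + 1))] with p hp
    obtain ⟨⟨hp1, hp2⟩, hp3⟩ := hp
    rw [hint _ _ (by nlinarith), hint _ _ (by nlinarith)]
    have h1 := hneg1 p.1 p.2 hp1 (by linarith)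
    have h2 := hneg2 p.1 p.2 hp1 hp2 hp3
    rw [mul_add]
    linarith
  linarith

theorem eventually_le_of_deriv_nonpos {α : Type*} {A : Filter α} {T t₀ : ℝ} (ht₀ : t₀ ∈ Ico 0 T)
    {v vt : ℝ → α → ℝ}
    (hd : ∀ t ∈ Icc 0 T, ∀ a, HasDerivWithinAt (fun τ => v τ a) (vt t a) (Icc 0 T) t)
    (h : ∀ᶠ p in 𝓝[Icc t₀ T] t₀ ×ˢ A, vt p.1 p.2 ≤ 0) :
    ∀ᶠ p in 𝓝[Icc t₀ T] t₀ ×ˢ A, v p.1 p.2 ≤ v t₀ p.2 := by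
  obtain ⟨pa, hpa, pb, hpb, hab⟩ := eventually_prod_iff.1 h
  obtain ⟨ε, hε, hball⟩ := Metric.mem_nhdsWithin_iff.1 hpa
  have hmem : Metric.ball t₀ ε ∩ Icc t₀ T ∈ 𝓝[Icc t₀ T] t₀ :=
    inter_mem (mem_nhdsWithin_of_mem_nhds (Metric.ball_mem_nhds t₀ hε)) self_mem_nhdsWithin
  refine eventually_prod_iff.2 ⟨_, hmem, pb, hpb, ?_⟩
  rintro t ⟨ht, ht'⟩ a ha
  rw [Metric.mem_ball, Real.dist_eq] at ht
  rcases eq_or_lt_of_le ht'.1 with rfl | hlt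
  · exact le_rfl
  have hsub : ∀ s ∈ Icc t₀ t, s ∈ Icc 0 T := fun s hs => ⟨ht₀.1.trans hs.1, hs.2.trans ht'.2⟩
  obtain ⟨c, hc, hc'⟩ := exists_hasDerivAt_eq_slope (fun τ => v τ a) (fun τ => vt τ a) hlt
    (fun s hs => ((hd s (hsub s hs) a).continuousWithinAt).mono hsub)
    (fun s hs => (hd s (hsub s (Ioo_subset_Icc_self hs)) a).hasDerivAt
      (Icc_mem_nhds (ht₀.1.trans_lt hs.1) (hs.2.trans_le ht'.2)))
  have hneg : vt c a ≤ 0 := by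
    refine hab (hball ⟨?_, hc.1.le, hc.2.le.trans ht'.2⟩) ha
    rw [Metric.mem_ball, Real.dist_eq, abs_of_pos (by linarith [hc.1])]
    rw [abs_of_pos (by linarith)] at ht
    linarith [hc.2]
  have h1 : v t a - v t₀ a ≤ 0 := by
    by_contra hcon
    have := div_pos (not_le.1 hcon) (sub_pos.2 hlt)
    linarith
  linarith

theorem IsClassicalSolution.abs_apply_le {l ρ₁ ρ₂ T S : ℝ} {f₀ : ℝ → ℝ} {f : ℝ → ℝ → ℝ}
    (hf : IsClassicalSolution l ρ₁ ρ₂ T f₀ f) (hl : 0 < l) (hρ : ρ₁ < ρ₂) (hS : 0 < S)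
    (hkS : Real.pi / (2 * l) * S ≤ Real.pi / 4) (h0 : ∀ x, |f₀ x| ≤ S) :
    ∀ t ∈ Icc 0 T, ∀ x, |f t x| ≤ S := by
  have hup : ∀ {g₀ : ℝ → ℝ} {g : ℝ → ℝ → ℝ}, IsClassicalSolution l ρ₁ ρ₂ T g₀ g →
      ∀ t₀ ∈ Ico 0 T, (∀ x, |g t₀ x| ≤ S) → ∀ x₀, g t₀ x₀ = S →
      ∀ᶠ p in 𝓝[Icc t₀ T] t₀ ×ˢ 𝓝 x₀, g p.1 p.2 ≤ S := by
    intro g₀ g hg t₀ ht₀ hle x₀ hx₀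
    obtain ⟨gt, hgt, hev⟩ := hg.evolution
    have ht₀' : t₀ ∈ Icc 0 T := ⟨ht₀.1, ht₀.2.le⟩
    obtain ⟨-, I, hI, hgI⟩ := hev t₀ ht₀' x₀
    have hR := hg.regularFlow
    have hIneg := pvIntegral_neg_of_max hl ((hR.contDiff t₀ ht₀').of_le (by norm_num))
      (by simpa using hR.decay t₀ ht₀' 0 (by simp)) hS hkS hle hx₀ hI
    have hneg : gt t₀ x₀ < 0 := by
      rw [hgI]
      exact mul_neg_of_pos_of_neg (div_pos (by linarith) (by linarith)) hIneg
    have hlim := tendsto_prod_of_tendstoUniformly (x₀ := x₀) (hgt.1 t₀ ht₀').continuous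
      (by simpa using hgt.2 0 le_rfl t₀ ht₀')
    have hev' : ∀ᶠ p in 𝓝[Icc t₀ T] t₀ ×ˢ 𝓝 x₀, gt p.1 p.2 ≤ 0 := by
      have hmono : 𝓝[Icc t₀ T] t₀ ≤ 𝓝[Icc 0 T] t₀ :=
        nhdsWithin_mono _ (Icc_subset_Icc_left ht₀.1)
      exact ((hlim.mono_left (prod_mono_left _ hmono)).eventually (gt_mem_nhds hneg)).mono
        fun p hp => le_of_lt hp
    filter_upwards [eventually_le_of_deriv_nonpos ht₀ (fun t ht x => (hev t ht x).1) hev'] with p hp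
    exact hp.trans (le_of_abs_le (hle _))
  have hR := hf.regularFlow
  refine abs_le_of_not_crossed hS (fun t ht => (hR.contDiff t ht).continuous)
    (fun t ht => by simpa using hR.decay t ht 0 (by simp))
    (fun t ht => by simpa using hR.uniform 0 (by simp) t ht) (by rwa [hf.initial])
    (fun t₀ ht₀ hle x₀ hx₀ => hup hf t₀ ht₀ hle x₀ hx₀) ?_
  intro t₀ ht₀ hle x₀ hx₀
  filter_upwards [hup hf.neg t₀ ht₀ (by simpa using hle) x₀ (by simp [hx₀])] with p hp
  have : -f p.1 p.2 ≤ S := hp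
  linarith

/-- The `x`-derivative of the integrand of the contour equation. -/
def slopeIntegrand (k : ℝ) (g : ℝ → ℝ) (x η : ℝ) : ℝ :=
  (deriv (deriv g) x - deriv (deriv g) (x - η)) *
      (Real.sinh (k * η) / (Real.cosh (k * η) - Real.cos (k * (g x - g (x - η)))))
    - (deriv g x - deriv g (x - η)) ^ 2 * (k * Real.sinh (k * η) * Real.sin (k * (g x - g (x - η)))
      / (Real.cosh (k * η) - Real.cos (k * (g x - g (x - η)))) ^ 2)
    + (deriv (deriv g) x + deriv (deriv g) (x - η)) *
      (Real.sinh (k * η) / (Real.cosh (k * η) + Real.cos (k * (g x + g (x - η)))))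
    + (deriv g x + deriv g (x - η)) ^ 2 * (k * Real.sinh (k * η) * Real.sin (k * (g x + g (x - η)))
      / (Real.cosh (k * η) + Real.cos (k * (g x + g (x - η)))) ^ 2)

theorem hasDerivAt_comp_sub_const {h : ℝ → ℝ} (hh : ContDiff ℝ 1 h) (x η : ℝ) :
    HasDerivAt (fun x => h (x - η)) (deriv h (x - η)) x := by
  have h1 := (hh.differentiable (by simp) (x - η)).hasDerivAt
  exact (h1.comp x ((hasDerivAt_id' x).sub_const η)).congr_deriv (by simp)

theorem hasDerivAt_muskatIntegrand {l x η : ℝ} {g : ℝ → ℝ} (hl : 0 < l) (hg : ContDiff ℝ 2 g)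
    (hη : η ≠ 0) :
    HasDerivAt (fun x => muskatIntegrand l g x η)
      (slopeIntegrand (Real.pi / (2 * l)) g x η) x := by
  have hg1 : ContDiff ℝ 1 g := hg.of_le (by norm_num)
  have hg2 : ContDiff ℝ 1 (deriv g) := contDiff_deriv (n := 1) hg
  have hk : 0 < Real.pi / (2 * l) := by have := Real.pi_pos; positivity
  unfold muskatIntegrand kernelOne kernelTwo slopeIntegrand
  set k := Real.pi / (2 * l)
  have a0 := (hg1.differentiable (by simp) x).hasDerivAt
  have a1 := hasDerivAt_comp_sub_const hg1 x η
  have b0 := (hg2.differentiable (by simp) x).hasDerivAt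
  have b1 := hasDerivAt_comp_sub_const hg2 x η
  have d1 := (cosh_sub_cos_pos (a := k * (g x - g (x - η))) hk hη).ne'
  have d2 := (cosh_add_cos_pos (a := k * (g x + g (x - η))) hk hη).ne'
  have c1 := (hasDerivAt_const x (Real.sinh (k * η))).fun_div
    ((((a0.fun_sub a1).const_mul k).cos).const_sub (Real.cosh (k * η))) d1
  have c2 := (hasDerivAt_const x (Real.sinh (k * η))).fun_div
    ((((a0.fun_add a1).const_mul k).cos).const_add (Real.cosh (k * η))) d2
  refine (((b0.fun_sub b1).fun_mul c1).fun_add ((b0.fun_add b1).fun_mul c2)).congr_deriv ?_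
  generalize Real.cosh (k * η) - Real.cos (k * (g x - g (x - η))) = D at *
  generalize Real.cosh (k * η) + Real.cos (k * (g x + g (x - η))) = E at *
  field_simp
  ring

/-- The total derivative part of `slopeIntegrand` at a point of maximal slope `M`. -/
def slopePotential (k M : ℝ) (g : ℝ → ℝ) (x η : ℝ) : ℝ :=
  (M * Real.sinh (k * η) - Real.sin (k * (g x - g (x - η))))
      / (Real.cosh (k * η) - Real.cos (k * (g x - g (x - η))))
    + (M * Real.sinh (k * η) + Real.sin (k * (g x + g (x - η))))
      / (Real.cosh (k * η) + Real.cos (k * (g x + g (x - η))))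
    + (M - deriv g (x - η)) *
      (Real.sinh (k * η) / (Real.cosh (k * η) - Real.cos (k * (g x - g (x - η)))))
    + (M + deriv g (x - η)) *
      (Real.sinh (k * η) / (Real.cosh (k * η) + Real.cos (k * (g x + g (x - η)))))

theorem hasDerivAt_slopePotential {k M x η : ℝ} {g : ℝ → ℝ} (hk : 0 < k) (hg : ContDiff ℝ 2 g)
    (hη : η ≠ 0) (h1 : deriv g x = M) (h2 : deriv (deriv g) x = 0) :
    HasDerivAt (slopePotential k M g x)
      (k * secondVariation M (k * η) (k * (g x - g (x - η))) (k * (g x + g (x - η)))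
        - slopeIntegrand k g x η) η := by
  have hg1 : ContDiff ℝ 1 g := hg.of_le (by norm_num)
  have hg2 : ContDiff ℝ 1 (deriv g) := contDiff_deriv (n := 1) hg
  have a1 := hasDerivAt_comp_sub hg1 x η
  have b1 := hasDerivAt_comp_sub hg2 x η
  have d1 := (cosh_sub_cos_pos (a := k * (g x - g (x - η))) hk hη).ne'
  have d2 := (cosh_add_cos_pos (a := k * (g x + g (x - η))) hk hη).ne'
  have hy : HasDerivAt (fun η : ℝ => k * η) k η := by simpa using (hasDerivAt_id' η).const_mul k
  have e1 := (a1.const_sub (g x)).const_mul k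
  have e2 := (a1.const_add (g x)).const_mul k
  have f1 := ((hy.sinh.const_mul M).fun_sub e1.sin).fun_div (hy.cosh.fun_sub e1.cos) d1
  have f2 := ((hy.sinh.const_mul M).fun_add e2.sin).fun_div (hy.cosh.fun_add e2.cos) d2
  have f3 := (b1.const_sub M).fun_mul (hy.sinh.fun_div (hy.cosh.fun_sub e1.cos) d1)
  have f4 := (b1.const_add M).fun_mul (hy.sinh.fun_div (hy.cosh.fun_add e2.cos) d2)
  refine (((f1.fun_add f2).fun_add f3).fun_add f4).congr_deriv ?_
  unfold secondVariation slopeIntegrand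
  rw [h1, h2]
  have hC := Real.cosh_sq (k * η)
  have hs1 := Real.sin_sq_add_cos_sq (k * (g x - g (x - η)))
  have hs2 := Real.sin_sq_add_cos_sq (k * (g x + g (x - η)))
  generalize Real.sin (k * (g x - g (x - η))) = s1 at *
  generalize Real.cos (k * (g x - g (x - η))) = c1 at *
  generalize Real.sin (k * (g x + g (x - η))) = s2 at *
  generalize Real.cos (k * (g x + g (x - η))) = c2 at *
  generalize Real.sinh (k * η) = s at *
  generalize Real.cosh (k * η) = C at *
  generalize deriv g (x - η) = p at *
  generalize deriv (deriv g) (x - η) = r at *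
  field_simp
  linear_combination (k * ((2 * M - p) * (C + c2) ^ 2 + (2 * M + p) * (C - c1) ^ 2)) * hC
    + k * p * (C + c2) ^ 2 * hs1 - k * p * (C - c1) ^ 2 * hs2

theorem sinh_div_cosh_sub_one_le {y : ℝ} (hy : 0 < y) :
    Real.sinh y / (Real.cosh y - 1) ≤ 1 + 2 / y := by
  have hu : 0 < y / 2 := by positivity
  have h1 : Real.sinh y = 2 * Real.sinh (y / 2) * Real.cosh (y / 2) := by
    rw [← Real.sinh_two_mul]; ring_nf
  have h2 : Real.cosh y - 1 = 2 * Real.sinh (y / 2) ^ 2 := by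
    have h3 := Real.cosh_two_mul (y / 2)
    have h4 := Real.cosh_sq (y / 2)
    rw [show 2 * (y / 2) = y by ring] at h3
    linarith
  have hs : 0 < Real.sinh (y / 2) := Real.sinh_pos_iff.2 hu
  have h3 : y / 2 ≤ Real.sinh (y / 2) := Real.self_le_sinh_iff.2 hu.le
  have h4 : Real.cosh (y / 2) ≤ Real.sinh (y / 2) + 1 := by
    have := Real.cosh_sub_sinh (y / 2)
    have := Real.exp_le_one_iff.2 (show -(y / 2) ≤ 0 by linarith)
    linarith
  rw [h1, h2, div_le_iff₀ (by positivity)]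
  have h5 : 1 ≤ 2 / y * Real.sinh (y / 2) := by
    rw [div_mul_eq_mul_div, le_div_iff₀ hy]; linarith
  nlinarith

theorem inv_cosh_sub_one_le {y : ℝ} (hy : 0 < y) : 1 / (Real.cosh y - 1) ≤ 2 / y ^ 2 := by
  have h1 : 1 + y ^ 2 / 2 ≤ Real.cosh y := by
    have h3 : y / 2 ≤ Real.sinh (y / 2) := Real.self_le_sinh_iff.2 (by positivity)
    have h4 := Real.cosh_two_mul (y / 2)
    have h5 := Real.cosh_sq (y / 2)
    rw [show 2 * (y / 2) = y by ring] at h4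
    nlinarith
  rw [div_le_div_iff₀ (by nlinarith [pow_pos hy 2]) (by positivity)]
  linarith

theorem inv_cosh_sub_one_le_exp {y y₀ : ℝ} (h0 : 0 < y₀) (hy : y₀ ≤ y) :
    1 / (Real.cosh y - 1) ≤ 2 / (1 - Real.exp (-y₀)) ^ 2 * Real.exp (-y) := by
  have h1 : Real.exp (-y₀) < 1 := by simpa using h0
  have h2 : Real.exp (-y) ≤ Real.exp (-y₀) := Real.exp_le_exp.2 (by linarith)
  have h3 : Real.exp y * Real.exp (-y) = 1 := by rw [← Real.exp_add]; simp
  have h4 := Real.exp_pos (-y)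
  have h5 : 0 < Real.cosh y - 1 := by
    linarith [Real.one_lt_cosh.2 (show y ≠ 0 by linarith)]
  rw [div_mul_eq_mul_div, div_le_div_iff₀ h5 (by have : 0 < 1 - Real.exp (-y₀) := by linarith
                                                 positivity)]
  have h6 : 2 * Real.exp (-y) * (Real.cosh y - 1) = (1 - Real.exp (-y)) ^ 2 := by
    rw [Real.cosh_eq]; linear_combination h3
  rw [h6, one_mul]
  gcongr

/-- Bounds on `g` and its first two derivatives, with a Hölder bound on the second. -/
structure SlopeBounds (S K : ℝ) (g : ℝ → ℝ) : Prop where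
  contDiff : ContDiff ℝ 2 g
  abs_apply_le : ∀ x, |g x| ≤ S
  abs_deriv_le : ∀ x, |deriv g x| ≤ K
  abs_deriv2_le : ∀ x, |deriv (deriv g) x| ≤ K
  holder : ∀ x y, |deriv (deriv g) x - deriv (deriv g) y| ≤ K * √|x - y|

section Bounds

variable {k S K : ℝ} {g : ℝ → ℝ}

theorem abs_sub_le_of_deriv_le {h : ℝ → ℝ} (hh : ContDiff ℝ 1 h) (hK : ∀ x, |deriv h x| ≤ K)
    (x y : ℝ) : |h x - h y| ≤ K * |x - y| := by
  have := convex_univ.norm_image_sub_le_of_norm_deriv_le (𝕜 := ℝ) (f := h) (C := K) (x := y)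
      (y := x)
    (fun z _ => hh.differentiable (by simp) z) (fun z _ => hK z) (mem_univ _) (mem_univ _)
  simpa using this

theorem SlopeBounds.nonneg (hg : SlopeBounds S K g) : 0 ≤ K :=
  (abs_nonneg _).trans (hg.abs_deriv_le 0)

theorem SlopeBounds.cos_nonneg (hg : SlopeBounds S K g) (hk : 0 < k) (hkS : k * S ≤ Real.pi / 4)
    (x y : ℝ) : 0 ≤ Real.cos (k * (g x + g y)) := by
  have h1 : |k * (g x + g y)| ≤ Real.pi / 2 := by
    rw [abs_mul, abs_of_pos hk]
    calc k * |g x + g y| ≤ k * (S + S) := by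
          gcongr
          exact (abs_add_le _ _).trans (add_le_add (hg.abs_apply_le x) (hg.abs_apply_le y))
      _ ≤ Real.pi / 2 := by linarith
  have := abs_le.1 h1
  exact Real.cos_nonneg_of_mem_Icc ⟨this.1, this.2⟩

theorem abs_mul_div_le {v v' s E E' : ℝ} (hv : |v| ≤ v') (hE' : 0 < E') (hE : E' ≤ E) :
    |v * (s / E)| ≤ v' * (|s| / E') := by
  rw [abs_mul, abs_div, abs_of_pos (hE'.trans_le hE)]
  have := (abs_nonneg v).trans hv
  have := hE'.trans_le hE
  gcongr

theorem abs_sq_mul_div_sq_le {v v' s z z' E E' : ℝ} (hk : 0 < k) (hv : |v| ≤ v') (hz : |z| ≤ z')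
    (hE' : 0 < E') (hE : E' ≤ E) :
    |v ^ 2 * (k * s * z / E ^ 2)| ≤ v' ^ 2 * (k * |s| * z' / E' ^ 2) := by
  rw [abs_mul, abs_div, abs_mul, abs_mul, abs_of_pos hk, abs_pow, abs_pow,
    abs_of_pos (hE'.trans_le hE)]
  have := (abs_nonneg z).trans hz
  gcongr

set_option maxHeartbeats 400000 in
theorem abs_slopeIntegrand_le_near (hg : SlopeBounds S K g) (hk : 0 < k)
    (hkS : k * S ≤ Real.pi / 4) (x : ℝ) {η : ℝ} (hη : η ≠ 0) (hη1 : |η| ≤ 1) :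
    |slopeIntegrand k g x η|
      ≤ (K * (1 + 2 / k) + 2 * K ^ 3 * (1 + 2 / k) + 2 * K + 4 * K ^ 2 * k) * (1 / √|η|) := by
  have hK := hg.nonneg
  set a := |η| with ha
  have ha0 : 0 < a := abs_pos.2 hη
  have hka : 0 < k * a := by positivity
  set s := Real.sinh (k * a) with hs
  set C := Real.cosh (k * a) with hC
  have hC1 : 0 < C - 1 := by linarith [Real.one_lt_cosh.2 hka.ne']
  have hC0 : 0 < C := by linarith
  have hs0 : 0 < s := Real.sinh_pos_iff.2 hka
  have hsC : s ≤ C := (Real.sinh_lt_cosh _).le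
  have hkη : |k * η| = k * a := by rw [abs_mul, abs_of_pos hk]
  have hcosh : Real.cosh (k * η) = C := by rw [hC, ← hkη, Real.cosh_abs]
  have hsinh : |Real.sinh (k * η)| = s := by rw [hs, ← hkη, Real.abs_sinh]
  set δ := k * (g x - g (x - η)) with hδ
  set σ := k * (g x + g (x - η)) with hσ
  have hcσ : 0 ≤ Real.cos σ := hg.cos_nonneg hk hkS _ _
  have hD : C - 1 ≤ C - Real.cos δ := by linarith [Real.cos_le_one δ]
  have hE : C ≤ C + Real.cos σ := by linarith
  have hxη : |x - (x - η)| = a := by rw [ha]; ring_nf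
  have b0 : |g x - g (x - η)| ≤ K * a := by
    rw [← hxη]; exact abs_sub_le_of_deriv_le (hg.contDiff.of_le (by norm_num)) hg.abs_deriv_le _ _
  have b1 : |deriv g x - deriv g (x - η)| ≤ K * a := by
    rw [← hxη]
    exact abs_sub_le_of_deriv_le (contDiff_deriv (n := 1) hg.contDiff) hg.abs_deriv2_le _ _
  have b2 : |deriv (deriv g) x - deriv (deriv g) (x - η)| ≤ K * √a := by
    rw [← hxη]; exact hg.holder _ _
  have b3 : |deriv (deriv g) x + deriv (deriv g) (x - η)| ≤ 2 * K :=
    (abs_add_le _ _).trans (by linarith [hg.abs_deriv2_le x, hg.abs_deriv2_le (x - η)])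
  have b4 : |deriv g x + deriv g (x - η)| ≤ 2 * K :=
    (abs_add_le _ _).trans (by linarith [hg.abs_deriv_le x, hg.abs_deriv_le (x - η)])
  have b5 : |Real.sin δ| ≤ k * (K * a) := by
    refine (Real.abs_sin_le_abs).trans ?_
    rw [hδ, abs_mul, abs_of_pos hk]
    gcongr
  have hL : s / (C - 1) ≤ (1 + 2 / k) / a := by
    refine (sinh_div_cosh_sub_one_le hka).trans ?_
    rw [le_div_iff₀ ha0]
    have : (1 + 2 / (k * a)) * a = a + 2 / k := by field_simp
    linarith
  have hinv : 1 / (C - 1) ≤ 2 / (k * a) ^ 2 := inv_cosh_sub_one_le hka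
  have hsq : √a / a = 1 / √a := Real.sqrt_div_self'
  have hsq1 : 1 ≤ 1 / √a := by
    rw [le_div_iff₀ (Real.sqrt_pos.2 ha0), one_mul]
    exact Real.sqrt_le_one.2 hη1
  have hT1 : |(deriv (deriv g) x - deriv (deriv g) (x - η)) *
      (Real.sinh (k * η) / (C - Real.cos δ))| ≤ K * (1 + 2 / k) * (1 / √a) := by
    have h1 := abs_mul_div_le (s := Real.sinh (k * η)) b2 hC1 hD
    rw [hsinh] at h1
    calc _ ≤ K * √a * (s / (C - 1)) := h1
      _ ≤ K * √a * ((1 + 2 / k) / a) := by gcongr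
      _ = K * (1 + 2 / k) * (√a / a) := by ring
      _ = _ := by rw [hsq]
  have hT2 : |(deriv g x - deriv g (x - η)) ^ 2 * (k * Real.sinh (k * η) * Real.sin δ
      / (C - Real.cos δ) ^ 2)| ≤ 2 * K ^ 3 * (1 + 2 / k) := by
    have h1 := abs_sq_mul_div_sq_le (s := Real.sinh (k * η)) hk b1 b5 hC1 hD
    rw [hsinh] at h1
    calc _ ≤ (K * a) ^ 2 * (k * s * (k * (K * a)) / (C - 1) ^ 2) := h1
      _ = k ^ 2 * K ^ 3 * a ^ 3 * (s / (C - 1)) * (1 / (C - 1)) := by field_simp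
      _ ≤ k ^ 2 * K ^ 3 * a ^ 3 * ((1 + 2 / k) / a) * (2 / (k * a) ^ 2) := by gcongr
      _ = _ := by field_simp
  have hT3 : |(deriv (deriv g) x + deriv (deriv g) (x - η)) *
      (Real.sinh (k * η) / (C + Real.cos σ))| ≤ 2 * K := by
    have h1 := abs_mul_div_le (s := Real.sinh (k * η)) b3 hC0 hE
    rw [hsinh] at h1
    have : s / C ≤ 1 := (div_le_one hC0).2 hsC
    refine h1.trans ?_
    nlinarith
  have hT4 : |(deriv g x + deriv g (x - η)) ^ 2 * (k * Real.sinh (k * η) * Real.sin σ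
      / (C + Real.cos σ) ^ 2)| ≤ 4 * K ^ 2 * k := by
    have h1 := abs_sq_mul_div_sq_le (s := Real.sinh (k * η)) hk b4 (Real.abs_sin_le_one σ) hC0 hE
    rw [hsinh] at h1
    have : s / C ^ 2 ≤ 1 := (div_le_one (by positivity)).2 (by nlinarith)
    calc _ ≤ (2 * K) ^ 2 * (k * s * 1 / C ^ 2) := h1
      _ = (2 * K) ^ 2 * k * (s / C ^ 2) := by ring
      _ ≤ (2 * K) ^ 2 * k * 1 := by gcongr
      _ = _ := by ring
  have hdef : slopeIntegrand k g x η = (deriv (deriv g) x - deriv (deriv g) (x - η)) *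
      (Real.sinh (k * η) / (C - Real.cos δ)) - (deriv g x - deriv g (x - η)) ^ 2 *
      (k * Real.sinh (k * η) * Real.sin δ / (C - Real.cos δ) ^ 2)
      + (deriv (deriv g) x + deriv (deriv g) (x - η)) * (Real.sinh (k * η) / (C + Real.cos σ))
      + (deriv g x + deriv g (x - η)) ^ 2 *
      (k * Real.sinh (k * η) * Real.sin σ / (C + Real.cos σ) ^ 2) := by
    rw [slopeIntegrand, hcosh, ← hδ, ← hσ]
  rw [hdef]
  clear_value δ σ s C a
  generalize (deriv (deriv g) x - deriv (deriv g) (x - η)) *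
    (Real.sinh (k * η) / (C - Real.cos δ)) = t1 at *
  generalize (deriv g x - deriv g (x - η)) ^ 2 * (k * Real.sinh (k * η) * Real.sin δ
      / (C - Real.cos δ) ^ 2) = t2 at *
  generalize (deriv (deriv g) x + deriv (deriv g) (x - η)) *
      (Real.sinh (k * η) / (C + Real.cos σ)) = t3 at *
  generalize (deriv g x + deriv g (x - η)) ^ 2 * (k * Real.sinh (k * η) * Real.sin σ
      / (C + Real.cos σ) ^ 2) = t4 at *
  generalize 1 / √a = w at *
  have h1 := abs_add_le (t1 - t2 + t3) t4
  have h2 := abs_add_le (t1 - t2) t3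
  have h3 := abs_sub t1 t2
  have c1 : 0 ≤ 2 * K ^ 3 * (1 + 2 / k) + 2 * K + 4 * K ^ 2 * k := by positivity
  have h4 := mul_le_mul_of_nonneg_left hsq1 c1
  linarith

theorem abs_kernel_sub_one_le {y c : ℝ} (hy : 0 < y) (hc : |c| ≤ 1) :
    |Real.sinh y / (Real.cosh y + c) - 1| ≤ 2 / (Real.cosh y - 1) := by
  have h1 : 0 < Real.cosh y - 1 := by linarith [Real.one_lt_cosh.2 hy.ne']
  have h2 := abs_le.1 hc
  have h3 : Real.cosh y - 1 ≤ Real.cosh y + c := by linarith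
  have h4 : 0 < Real.cosh y + c := by linarith
  rw [div_sub_one h4.ne', abs_div, abs_of_pos h4]
  have h5 := Real.cosh_sub_sinh y
  have h6 := Real.exp_le_one_iff.2 (neg_nonpos.2 hy.le)
  have h7 := Real.exp_pos (-y)
  gcongr
  rw [abs_le]
  constructor <;> linarith

theorem abs_slopeSum_le_far (hg : SlopeBounds S K g) (hk : 0 < k) (x : ℝ) {η : ℝ} (hη1 : 1 ≤ η) :
    |slopeIntegrand k g x η + slopeIntegrand k g x (-η)|
      ≤ (16 * K + 16 * K ^ 2 * k * (1 + 2 / k)) * (1 / (Real.cosh (k * η) - 1)) := by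
  have hK := hg.nonneg
  have hkη : 0 < k * η := by positivity
  have hC1 : 0 < Real.cosh (k * η) - 1 := by linarith [Real.one_lt_cosh.2 hkη.ne']
  have hs0 : 0 < Real.sinh (k * η) := Real.sinh_pos_iff.2 hkη
  have hL : Real.sinh (k * η) / (Real.cosh (k * η) - 1) ≤ 1 + 2 / k := by
    refine (sinh_div_cosh_sub_one_le hkη).trans ?_
    gcongr
    nlinarith
  have hker : ∀ {c : ℝ}, |c| ≤ 1 →
      |Real.sinh (k * η) / (Real.cosh (k * η) + c) - 1| ≤ 2 * (1 / (Real.cosh (k * η) - 1)) := by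
    intro c hc
    rw [mul_one_div]
    exact abs_kernel_sub_one_le hkη hc
  have hquad : ∀ {v z c : ℝ}, |v| ≤ 2 * K → |z| ≤ 1 → |c| ≤ 1 →
      |v ^ 2 * (k * Real.sinh (k * η) * z / (Real.cosh (k * η) + c) ^ 2)|
        ≤ 4 * K ^ 2 * k * (1 + 2 / k) * (1 / (Real.cosh (k * η) - 1)) := by
    intro v z c hv hz hc
    have h2 : Real.cosh (k * η) - 1 ≤ Real.cosh (k * η) + c := by linarith [(abs_le.1 hc).1]
    have h3 := abs_sq_mul_div_sq_le (s := Real.sinh (k * η)) hk hv hz hC1 h2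
    rw [abs_of_pos hs0] at h3
    calc _ ≤ (2 * K) ^ 2 * (k * Real.sinh (k * η) * 1 / (Real.cosh (k * η) - 1) ^ 2) := h3
      _ = 4 * K ^ 2 * k * (Real.sinh (k * η) / (Real.cosh (k * η) - 1))
          * (1 / (Real.cosh (k * η) - 1)) := by field_simp; ring
      _ ≤ _ := by gcongr
  have hlin : ∀ {v c : ℝ}, |v| ≤ 2 * K → |c| ≤ 1 →
      |v * (Real.sinh (k * η) / (Real.cosh (k * η) + c) - 1)|
        ≤ 4 * K * (1 / (Real.cosh (k * η) - 1)) := by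
    intro v c hv hc
    rw [abs_mul]
    calc _ ≤ 2 * K * (2 * (1 / (Real.cosh (k * η) - 1))) := by
          gcongr
          exact hker hc
      _ = _ := by ring
  have hcos : ∀ z, |-Real.cos z| ≤ 1 := fun z => by rw [abs_neg]; exact Real.abs_cos_le_one z
  have hd2 : ∀ y z, |deriv (deriv g) y - deriv (deriv g) z| ≤ 2 * K := fun y z =>
    (abs_sub _ _).trans (by linarith [hg.abs_deriv2_le y, hg.abs_deriv2_le z])
  have hs2 : ∀ y z, |deriv (deriv g) y + deriv (deriv g) z| ≤ 2 * K := fun y z =>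
    (abs_add_le _ _).trans (by linarith [hg.abs_deriv2_le y, hg.abs_deriv2_le z])
  have hd1 : ∀ y z, |deriv g y - deriv g z| ≤ 2 * K := fun y z =>
    (abs_sub _ _).trans (by linarith [hg.abs_deriv_le y, hg.abs_deriv_le z])
  have hs1 : ∀ y z, |deriv g y + deriv g z| ≤ 2 * K := fun y z =>
    (abs_add_le _ _).trans (by linarith [hg.abs_deriv_le y, hg.abs_deriv_le z])
  have l1 := abs_le.1 (hlin (hd2 x (x - η)) (hcos (k * (g x - g (x - η)))))
  have l2 := abs_le.1 (hlin (hs2 x (x - η)) (Real.abs_cos_le_one (k * (g x + g (x - η)))))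
  have l3 := abs_le.1 (hlin (hd2 x (x + η)) (hcos (k * (g x - g (x + η)))))
  have l4 := abs_le.1 (hlin (hs2 x (x + η)) (Real.abs_cos_le_one (k * (g x + g (x + η)))))
  have q1 := abs_le.1 (hquad (hd1 x (x - η)) (Real.abs_sin_le_one (k * (g x - g (x - η))))
    (hcos (k * (g x - g (x - η)))))
  have q2 := abs_le.1 (hquad (hs1 x (x - η)) (Real.abs_sin_le_one (k * (g x + g (x - η))))
    (Real.abs_cos_le_one (k * (g x + g (x - η)))))
  have q3 := abs_le.1 (hquad (hd1 x (x + η)) (Real.abs_sin_le_one (k * (g x - g (x + η))))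
    (hcos (k * (g x - g (x + η)))))
  have q4 := abs_le.1 (hquad (hs1 x (x + η)) (Real.abs_sin_le_one (k * (g x + g (x + η))))
    (Real.abs_cos_le_one (k * (g x + g (x + η)))))
  unfold slopeIntegrand
  simp only [mul_neg, Real.cosh_neg, Real.sinh_neg, sub_neg_eq_add, neg_mul, neg_div, mul_neg]
  simp only [← sub_eq_add_neg, mul_sub, mul_one] at l1 l2 l3 l4 q1 q2 q3 q4 ⊢
  rw [abs_le]
  constructor <;> linarith

theorem exists_integrable_bound (hk : 0 < k) (hkS : k * S ≤ Real.pi / 4) (K : ℝ) :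
    ∃ B : ℝ → ℝ, IntegrableOn B (Ioi 0) ∧ ∀ g, SlopeBounds S K g → ∀ x, ∀ η ∈ Ioi (0 : ℝ),
      |slopeIntegrand k g x η + slopeIntegrand k g x (-η)| ≤ B η := by
  set c₁ := 2 * (K * (1 + 2 / k) + 2 * K ^ 3 * (1 + 2 / k) + 2 * K + 4 * K ^ 2 * k)
  set c₂ := (16 * K + 16 * K ^ 2 * k * (1 + 2 / k)) * (2 / (1 - Real.exp (-k)) ^ 2)
  refine ⟨fun η => if η ≤ 1 then c₁ * (1 / √η) else c₂ * Real.exp (-k * η), ?_, ?_⟩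
  · rw [← Ioc_union_Ioi_eq_Ioi zero_le_one]
    refine IntegrableOn.union ?_ ?_
    · have h1 : IntegrableOn (fun η : ℝ => c₁ * (1 / √η)) (Ioc 0 1) := by
        have h2 : IntegrableOn (fun η : ℝ => η ^ (-(1 / 2) : ℝ)) (Ioc 0 1) :=
          (intervalIntegrable_iff_integrableOn_Ioc_of_le zero_le_one).1
            (intervalIntegral.intervalIntegrable_rpow' (by norm_num))
        refine Integrable.const_mul (h2.congr_fun ?_ measurableSet_Ioc) c₁
        intro η hη
        simp only
        rw [Real.rpow_neg hη.1.le, ← Real.sqrt_eq_rpow, one_div]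
      refine h1.congr_fun (fun η hη => ?_) measurableSet_Ioc
      simp [hη.2]
    · have h1 : IntegrableOn (fun η : ℝ => c₂ * Real.exp (-k * η)) (Ioi 1) :=
        (integrableOn_exp_mul_Ioi (by linarith) 1).const_mul c₂
      refine h1.congr_fun (fun η hη => ?_) measurableSet_Ioi
      simp [not_le.2 (mem_Ioi.1 hη)]
  · intro g hg x η hη
    have hη : 0 < η := hη
    have hK := hg.nonneg
    simp only
    split_ifs with h
    · have e1 := abs_slopeIntegrand_le_near hg hk hkS x hη.ne' (by rwa [abs_of_pos hη])
      have e2 := abs_slopeIntegrand_le_near hg hk hkS x (neg_ne_zero.2 hη.ne')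
        (by rwa [abs_neg, abs_of_pos hη])
      rw [abs_of_pos hη] at e1
      rw [abs_neg, abs_of_pos hη] at e2
      refine (abs_add_le _ _).trans ((add_le_add e1 e2).trans (le_of_eq ?_))
      ring
    · push Not at h
      refine (abs_slopeSum_le_far hg hk x h.le).trans ?_
      have := inv_cosh_sub_one_le_exp hk (show k ≤ k * η by nlinarith)
      calc _ ≤ (16 * K + 16 * K ^ 2 * k * (1 + 2 / k)) *
            (2 / (1 - Real.exp (-k)) ^ 2 * Real.exp (-(k * η))) := by gcongr
        _ = _ := by rw [neg_mul]; ring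

end Bounds

theorem tendsto_intervalIntegral_Ioi {F : ℝ → ℝ} (hF : IntegrableOn F (Ioi 0)) :
    Tendsto (fun p : ℝ × ℝ => ∫ η in p.1..p.2, F η) ((𝓝[>] (0 : ℝ)) ×ˢ atTop)
      (𝓝 (∫ η in Ioi 0, F η)) := by
  have h0 : IntegrableOn F (uIcc 0 1) := by
    rw [uIcc_of_le zero_le_one, integrableOn_Icc_iff_integrableOn_Ioc]
    exact hF.mono_set Ioc_subset_Ioi_self
  have h1 : Tendsto (fun ε => ∫ η in (0 : ℝ)..ε, F η) (𝓝[>] 0) (𝓝 0) := by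
    have h2 := (intervalIntegral.continuousOn_primitive_interval h0) 0 left_mem_uIcc
    have h3 : Tendsto (fun ε => ∫ η in (0 : ℝ)..ε, F η) (𝓝[uIcc 0 1] 0) (𝓝 0) := by
      simpa using h2.tendsto
    refine h3.mono_left ?_
    rw [uIcc_of_le zero_le_one]
    exact nhdsWithin_le_of_mem (Icc_mem_nhdsGT zero_lt_one)
  have h2 := intervalIntegral_tendsto_integral_Ioi 0 hF tendsto_id
  have h3 := (h2.comp (tendsto_snd (f := 𝓝[>] (0 : ℝ)))).sub
    (h1.comp (tendsto_fst (g := (atTop : Filter ℝ))))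
  rw [sub_zero] at h3
  refine h3.congr' ?_
  have hpos : ∀ᶠ ε in 𝓝[>] (0 : ℝ), 0 < ε := self_mem_nhdsWithin
  filter_upwards [hpos.prod_mk (eventually_gt_atTop (0 : ℝ))] with p hp
  have hii : ∀ {b : ℝ}, 0 < b → IntervalIntegrable F volume 0 b := fun hb =>
    (intervalIntegrable_iff_integrableOn_Ioc_of_le hb.le).2 (hF.mono_set Ioc_subset_Ioi_self)
  exact intervalIntegral.integral_interval_sub_left (hii hp.2) (hii hp.1)

theorem tendsto_div_sq_of_hasDerivAt {F F' : ℝ → ℝ} (hF : ∀ η, HasDerivAt F (F' η) η)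
    (h0 : F 0 = 0) (h1 : F' 0 = 0) (h2 : HasDerivAt F' 0 0) :
    Tendsto (fun η => F η / η ^ 2) (𝓝[≠] 0) (𝓝 0) := by
  rw [Metric.tendsto_nhds]
  intro c hc
  have h3 := (hasDerivAt_iff_isLittleO.1 h2).def (half_pos hc)
  obtain ⟨r, hr, hball⟩ := Metric.eventually_nhds_iff_ball.1 h3
  have h4 : ∀ᶠ η in 𝓝[≠] (0 : ℝ), η ∈ Metric.ball (0 : ℝ) r :=
    mem_nhdsWithin_of_mem_nhds (Metric.ball_mem_nhds 0 hr)
  filter_upwards [h4, self_mem_nhdsWithin] with η hη hη0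
  have hη0 : η ≠ 0 := hη0
  have hbd : ∀ z ∈ uIcc 0 η, ‖F' z‖ ≤ c / 2 * |η| := by
    intro z hz
    have hz' : |z| ≤ |η| := by simpa using abs_sub_left_of_mem_uIcc hz
    have := hball z (by
      rw [Metric.mem_ball, dist_zero_right, Real.norm_eq_abs] at hη ⊢
      exact hz'.trans_lt hη)
    simp only [h1, sub_zero, smul_zero] at this
    refine this.trans ?_
    rw [Real.norm_eq_abs]
    gcongr
  have hmv := (convex_uIcc (0 : ℝ) η).norm_image_sub_le_of_norm_hasDerivWithin_le
    (fun z _ => (hF z).hasDerivWithinAt) hbd left_mem_uIcc right_mem_uIcc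
  rw [h0, sub_zero, sub_zero, Real.norm_eq_abs, Real.norm_eq_abs] at hmv
  rw [dist_zero_right, norm_div, Real.norm_eq_abs, norm_pow, Real.norm_eq_abs,
    div_lt_iff₀ (by positivity)]
  have : 0 < |η| := abs_pos.2 hη0
  nlinarith [mul_pos hc (mul_pos this this)]

section MaxSlope

variable {k S K M x : ℝ} {g : ℝ → ℝ}

theorem tendsto_slopePotential_zero (hk : 0 < k) (hg : ContDiff ℝ 2 g) (h1 : deriv g x = M)
    (h2 : deriv (deriv g) x = 0) (hc : 0 ≤ Real.cos (k * (g x + g x))) :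
    Tendsto (slopePotential k M g x) (𝓝[≠] 0)
      (𝓝 (Real.sin (k * (g x + g x)) / (1 + Real.cos (k * (g x + g x))))) := by
  have hg1 : ContDiff ℝ 1 g := hg.of_le (by norm_num)
  have hg2 : ContDiff ℝ 1 (deriv g) := contDiff_deriv (n := 1) hg
  have hc0 := hg.continuous
  have hc1 := hg2.continuous
  have a1 := fun η => hasDerivAt_comp_sub hg1 x η
  have b1 := hasDerivAt_comp_sub hg2 x 0
  have hy : ∀ η, HasDerivAt (fun η : ℝ => k * η) k η := fun η => by
    simpa using (hasDerivAt_id' η).const_mul k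
  have e1 := fun η => ((a1 η).const_sub (g x)).const_mul k
  have hF := fun η => ((hy η).sinh.const_mul M).fun_sub (e1 η).sin
  have hF' : HasDerivAt (fun η => M * (Real.cosh (k * η) * k)
      - Real.cos (k * (g x - g (x - η))) * (k * -(-deriv g (x - η)))) 0 0 := by
    refine ((((hy 0).cosh.mul_const k).const_mul M).fun_sub
      ((e1 0).cos.fun_mul (b1.fun_neg.fun_neg.const_mul k))).congr_deriv ?_
    simp [h2]
  have hlim := tendsto_div_sq_of_hasDerivAt hF (by simp) (by simp [h1, mul_comm]) hF'
  have hker : ∀ η ≠ 0, η ^ 2 / (Real.cosh (k * η) - Real.cos (k * (g x - g (x - η))))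
      ≤ 2 / k ^ 2 := by
    intro η hη
    have h3 := inv_cosh_sub_one_le (y := k * |η|) (by positivity)
    rw [← abs_of_pos hk, ← abs_mul, Real.cosh_abs, sq_abs] at h3
    have h4 : 0 < Real.cosh (k * η) - 1 := by linarith [one_lt_cosh_mul hk hη]
    calc _ ≤ η ^ 2 / (Real.cosh (k * η) - 1) := by
          gcongr; exact Real.cos_le_one _
      _ = η ^ 2 * (1 / (Real.cosh (k * η) - 1)) := by ring
      _ ≤ η ^ 2 * (2 / (k * η) ^ 2) := by gcongr
      _ = 2 / k ^ 2 := by field_simp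
  have t1 : Tendsto (fun η => (M * Real.sinh (k * η) - Real.sin (k * (g x - g (x - η))))
      / (Real.cosh (k * η) - Real.cos (k * (g x - g (x - η))))) (𝓝[≠] 0) (𝓝 0) := by
    have h3 := (hlim.abs).mul_const (2 / k ^ 2)
    rw [abs_zero, zero_mul] at h3
    refine squeeze_zero_norm' ?_ h3
    filter_upwards [self_mem_nhdsWithin] with η hη
    have hη : η ≠ 0 := hη
    have hD := cosh_sub_cos_pos (a := k * (g x - g (x - η))) hk hη
    rw [Real.norm_eq_abs, abs_div, abs_of_pos hD, abs_div, abs_of_pos (by positivity : 0 < η ^ 2)]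
    calc _ = |M * Real.sinh (k * η) - Real.sin (k * (g x - g (x - η)))| / η ^ 2
          * (η ^ 2 / (Real.cosh (k * η) - Real.cos (k * (g x - g (x - η))))) := by
          field_simp
      _ ≤ _ := mul_le_mul_of_nonneg_left (hker η hη) (by positivity)
  have t3 : Tendsto (fun η => (M - deriv g (x - η)) *
      (Real.sinh (k * η) / (Real.cosh (k * η) - Real.cos (k * (g x - g (x - η))))))
      (𝓝[≠] 0) (𝓝 0) := by
    have h3 : Tendsto (fun η => (M - deriv g (x - η)) / η) (𝓝[≠] 0) (𝓝 0) := by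
      have h4 : HasDerivAt (fun η => M - deriv g (x - η)) 0 0 :=
        (b1.const_sub M).congr_deriv (by simp [h2])
      refine h4.tendsto_slope_zero.congr fun η => ?_
      simp [h1, div_eq_inv_mul]
    have h5 : Tendsto (fun η => Real.sinh (k * η) / η) (𝓝[≠] 0) (𝓝 k) := by
      have h4 := (hy 0).sinh.tendsto_slope_zero
      simp only [mul_zero, Real.cosh_zero, one_mul] at h4
      refine h4.congr fun η => ?_
      simp [div_eq_inv_mul]
    have h6 := ((h3.mul h5).abs).mul_const (2 / k ^ 2)
    rw [zero_mul, abs_zero, zero_mul] at h6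
    refine squeeze_zero_norm' ?_ h6
    filter_upwards [self_mem_nhdsWithin] with η hη
    have hη : η ≠ 0 := hη
    have hD := cosh_sub_cos_pos (a := k * (g x - g (x - η))) hk hη
    have h7 : (M - deriv g (x - η)) *
      (Real.sinh (k * η) / (Real.cosh (k * η) - Real.cos (k * (g x - g (x - η))))) =
      (M - deriv g (x - η)) / η * (Real.sinh (k * η) / η) *
        (η ^ 2 / (Real.cosh (k * η) - Real.cos (k * (g x - g (x - η))))) := by
      field_simp
    rw [h7, norm_mul, Real.norm_eq_abs, Real.norm_eq_abs, abs_of_pos (by positivity :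
      0 < η ^ 2 / (Real.cosh (k * η) - Real.cos (k * (g x - g (x - η)))))]
    exact mul_le_mul_of_nonneg_left (hker η hη) (by positivity)
  have hE : Real.cosh (k * 0) + Real.cos (k * (g x + g (x - 0))) ≠ 0 := by
    simp only [mul_zero, Real.cosh_zero, sub_zero]; positivity
  have t2 : Tendsto (fun η => (M * Real.sinh (k * η) + Real.sin (k * (g x + g (x - η))))
      / (Real.cosh (k * η) + Real.cos (k * (g x + g (x - η))))) (𝓝[≠] 0)
      (𝓝 (Real.sin (k * (g x + g x)) / (1 + Real.cos (k * (g x + g x))))) := by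
    have h3 : ContinuousAt (fun η => (M * Real.sinh (k * η) + Real.sin (k * (g x + g (x - η))))
      / (Real.cosh (k * η) + Real.cos (k * (g x + g (x - η))))) 0 := by
      refine ContinuousAt.div ?_ ?_ hE
      all_goals exact Continuous.continuousAt (by fun_prop)
    simpa using h3.tendsto.mono_left nhdsWithin_le_nhds
  have t4 : Tendsto (fun η => (M + deriv g (x - η)) *
      (Real.sinh (k * η) / (Real.cosh (k * η) + Real.cos (k * (g x + g (x - η))))))
      (𝓝[≠] 0) (𝓝 0) := by
    have h3 : ContinuousAt (fun η => (M + deriv g (x - η)) *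
      (Real.sinh (k * η) / (Real.cosh (k * η) + Real.cos (k * (g x + g (x - η)))))) 0 := by
      refine ContinuousAt.mul ?_ (ContinuousAt.div ?_ ?_ hE)
      all_goals exact Continuous.continuousAt (by fun_prop)
    simpa using h3.tendsto.mono_left nhdsWithin_le_nhds
  have h := ((t1.add t2).add t3).add t4
  simp only [zero_add, add_zero] at h
  exact h

theorem abs_slopePotential_sub_le (hk : 0 < k) (hM : 0 ≤ M) (hle : ∀ y, |deriv g y| ≤ M)
    {η : ℝ} (hη : 0 < η) :
    |slopePotential k M g x η - slopePotential k M g x (-η) - 8 * M|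
      ≤ (24 * M + 4) * (1 / (Real.cosh (k * η) - 1)) := by
  have hkη : 0 < k * η := by positivity
  have hC1 : 0 < Real.cosh (k * η) - 1 := by linarith [Real.one_lt_cosh.2 hkη.ne']
  have hlin : ∀ {v c : ℝ}, |v| ≤ 3 * M → |c| ≤ 1 →
      |v * (Real.sinh (k * η) / (Real.cosh (k * η) + c) - 1)|
        ≤ 6 * M * (1 / (Real.cosh (k * η) - 1)) := by
    intro v c hv hc
    have := abs_kernel_sub_one_le hkη hc
    rw [abs_mul]
    calc _ ≤ 3 * M * (2 / (Real.cosh (k * η) - 1)) := by gcongr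
      _ = _ := by ring
  have hbdd : ∀ {z c : ℝ}, |z| ≤ 1 → |c| ≤ 1 →
      |z / (Real.cosh (k * η) + c)| ≤ 1 / (Real.cosh (k * η) - 1) := by
    intro z c hz hc
    have h2 : Real.cosh (k * η) - 1 ≤ Real.cosh (k * η) + c := by linarith [(abs_le.1 hc).1]
    rw [abs_div, abs_of_pos (hC1.trans_le h2)]
    gcongr
  have hcos : ∀ z, |-Real.cos z| ≤ 1 := fun z => by rw [abs_neg]; exact Real.abs_cos_le_one z
  have hm : ∀ y, |2 * M - deriv g y| ≤ 3 * M := fun y => by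
    have := abs_le.1 (hle y); rw [abs_le]; constructor <;> linarith
  have hp : ∀ y, |2 * M + deriv g y| ≤ 3 * M := fun y => by
    have := abs_le.1 (hle y); rw [abs_le]; constructor <;> linarith
  have l1 := abs_le.1 (hlin (hm (x - η)) (hcos (k * (g x - g (x - η)))))
  have l2 := abs_le.1 (hlin (hp (x - η)) (Real.abs_cos_le_one (k * (g x + g (x - η)))))
  have l3 := abs_le.1 (hlin (hm (x + η)) (hcos (k * (g x - g (x + η)))))
  have l4 := abs_le.1 (hlin (hp (x + η)) (Real.abs_cos_le_one (k * (g x + g (x + η)))))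
  have q1 := abs_le.1 (hbdd (Real.abs_sin_le_one (k * (g x - g (x - η))))
    (hcos (k * (g x - g (x - η)))))
  have q2 := abs_le.1 (hbdd (Real.abs_sin_le_one (k * (g x + g (x - η))))
    (Real.abs_cos_le_one (k * (g x + g (x - η)))))
  have q3 := abs_le.1 (hbdd (Real.abs_sin_le_one (k * (g x - g (x + η))))
    (hcos (k * (g x - g (x + η)))))
  have q4 := abs_le.1 (hbdd (Real.abs_sin_le_one (k * (g x + g (x + η))))
    (Real.abs_cos_le_one (k * (g x + g (x + η)))))
  unfold slopePotential
  simp only [mul_neg, Real.cosh_neg, Real.sinh_neg, sub_neg_eq_add, neg_div, add_div,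
    sub_div, mul_div_assoc] at l1 l2 l3 l4 q1 q2 q3 q4 ⊢
  simp only [← sub_eq_add_neg] at l1 l2 l3 l4 q1 q2 q3 q4 ⊢
  rw [abs_le]
  constructor <;> linarith

/-- The primitive of `boundPoly`. -/
def boundPrimitive (m T : ℝ) : ℝ :=
  T + T ^ 2 / 2 + m * (T - T ^ 2) + 7 / 20 * (T - T ^ 2 / 2) + 19 / 5 * (T ^ 3 / 3 - T ^ 4 / 4)

theorem hasDerivAt_boundPrimitive (m T : ℝ) :
    HasDerivAt (boundPrimitive m) (boundPoly m T) T := by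
  have p := fun n => hasDerivAt_pow (𝕜 := ℝ) n T
  have h1 := hasDerivAt_id' T
  refine ((((h1.fun_add ((p 2).div_const 2)).fun_add ((h1.fun_sub (p 2)).const_mul m)).fun_add
    ((h1.fun_sub ((p 2).div_const 2)).const_mul (7 / 20))).fun_add
    ((((p 3).div_const 3).fun_sub ((p 4).div_const 4)).const_mul (19 / 5))).congr_deriv ?_
  simp only [boundPoly, slackPoly]
  push_cast
  ring

theorem boundPrimitive_nonneg {m T : ℝ} (hm : 0 ≤ m) (h0 : 0 ≤ T) (h1 : T ≤ 1) :
    0 ≤ boundPrimitive m T := by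
  have h2 : 0 ≤ T - T ^ 2 := by nlinarith
  have h3 : 0 ≤ T ^ 3 / 3 - T ^ 4 / 4 := by nlinarith [pow_nonneg h0 3]
  have h4 : 0 ≤ T - T ^ 2 / 2 := by nlinarith
  unfold boundPrimitive
  positivity

theorem continuousOn_slopeIntegrand (hk : 0 < k) (hg : ContDiff ℝ 2 g) :
    ContinuousOn (slopeIntegrand k g x) {0}ᶜ := by
  have c0 := hg.continuous
  have hg2 : ContDiff ℝ 1 (deriv g) := contDiff_deriv (n := 1) hg
  have c1 := hg2.continuous
  have c2 := hg2.continuous_deriv le_rfl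
  unfold slopeIntegrand
  refine (((ContinuousOn.mul ?_ (ContinuousOn.div ?_ ?_ ?_)).sub
    (ContinuousOn.mul ?_ (ContinuousOn.div ?_ ?_ ?_))).add
    (ContinuousOn.mul ?_ (ContinuousOn.div ?_ ?_ ?_))).add
    (ContinuousOn.mul ?_ (ContinuousOn.div ?_ ?_ ?_))
  any_goals exact Continuous.continuousOn (by fun_prop)
  · exact fun η hη => (cosh_sub_cos_pos hk hη).ne'
  · exact fun η hη => (pow_pos (cosh_sub_cos_pos hk hη) 2).ne'
  · exact fun η hη => (cosh_add_cos_pos hk hη).ne'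
  · exact fun η hη => (pow_pos (cosh_add_cos_pos hk hη) 2).ne'

theorem continuousOn_slopeSum (hk : 0 < k) (hg : ContDiff ℝ 2 g) :
    ContinuousOn (fun η => slopeIntegrand k g x η + slopeIntegrand k g x (-η)) (Ioi 0) :=
  ((continuousOn_slopeIntegrand hk hg).mono fun _ hη => ne_of_gt hη).add
    ((continuousOn_slopeIntegrand hk hg).comp continuousOn_neg
      fun _ hη => neg_ne_zero.2 (ne_of_gt hη))

theorem integrableOn_slopeSum (hk : 0 < k) (hkS : k * S ≤ Real.pi / 4) (hg : SlopeBounds S K g) :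
    IntegrableOn (fun η => slopeIntegrand k g x η + slopeIntegrand k g x (-η)) (Ioi 0) := by
  obtain ⟨B, hB, hle⟩ := exists_integrable_bound hk hkS K
  refine Integrable.mono' hB
    ((continuousOn_slopeSum hk hg.contDiff).aestronglyMeasurable measurableSet_Ioi) ?_
  filter_upwards [ae_restrict_mem measurableSet_Ioi] with η hη
  exact hle g hg x η hη

theorem secondVariation_add_le (hk : 0 < k) (hM0 : 0 < M) (hM1 : M ≤ 1)
    (hkS : k * S ≤ Real.arctan M) (hg : ContDiff ℝ 1 g) (hS : ∀ y, |g y| ≤ S)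
    (hle : ∀ y, |deriv g y| ≤ M) {η : ℝ} (hη : 0 < η) :
    k * secondVariation M (k * η) (k * (g x - g (x - η))) (k * (g x + g (x - η)))
      + k * secondVariation M (k * (-η)) (k * (g x - g (x - -η))) (k * (g x + g (x - -η)))
      ≤ 2 * (k * ((1 - Real.tanh (k * η / 2) ^ 2)
        * (M * boundPoly (M ^ 2) (Real.tanh (k * η / 2))))) := by
  have hkη : 0 < k * η := by positivity
  have hlip : ∀ y, |y - x| = η → |k * (g x - g y)| ≤ M * (k * η) := by
    intro y hy
    rw [abs_mul, abs_of_pos hk]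
    have := abs_sub_le_of_deriv_le hg hle x y
    rw [abs_sub_comm x y, hy] at this
    nlinarith
  have hsum : ∀ y, |k * (g x - g y)| / 2 + |k * (g x + g y)| / 2 ≤ Real.arctan M := by
    intro y
    rw [abs_mul, abs_mul, abs_of_pos hk]
    have h1 := abs_le.1 (hS x)
    have h2 := abs_le.1 (hS y)
    have h3 : |g x - g y| + |g x + g y| ≤ 2 * S := by
      rcases abs_cases (g x - g y) with h | h <;> rcases abs_cases (g x + g y) with h' | h' <;>
        linarith
    nlinarith
  have v1 := secondVariation_le hM0 hM1 hkη (hlip (x - η) (by simp [abs_of_pos hη]))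
    (hsum (x - η))
  have v2 := secondVariation_le (δ := -(k * (g x - g (x + η)))) (σ := -(k * (g x + g (x + η))))
    hM0 hM1 hkη (by rw [abs_neg]; exact hlip (x + η) (by simp [abs_of_pos hη]))
    (by rw [abs_neg, abs_neg]; exact hsum (x + η))
  have hodd : secondVariation M (k * (-η)) (k * (g x - g (x - -η))) (k * (g x + g (x - -η)))
      = secondVariation M (k * η) (-(k * (g x - g (x + η)))) (-(k * (g x + g (x + η)))) := by
    simp only [secondVariation, mul_neg, sub_neg_eq_add, Real.sinh_neg, Real.cosh_neg, Real.sin_neg,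
      Real.cos_neg, neg_mul]
  rw [hodd]
  nlinarith

/-- The slope decreases at a point of maximal slope. -/
theorem integral_slopeSum_neg (hk : 0 < k) (hM0 : 0 < M) (hM1 : M ≤ 1)
    (hkS : k * S ≤ Real.arctan M) (hg : SlopeBounds S K g) (hle : ∀ y, |deriv g y| ≤ M)
    (hmax : deriv g x = M) :
    ∫ η in Ioi 0, (slopeIntegrand k g x η + slopeIntegrand k g x (-η)) < 0 := by
  have hkS' : k * S ≤ Real.pi / 4 := by
    rw [← Real.arctan_one]
    exact hkS.trans (Real.arctan_strictMono.monotone hM1)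
  have h2 : deriv (deriv g) x = 0 :=
    IsLocalMax.deriv_eq_zero (Eventually.of_forall fun y => by
      rw [hmax]; exact (abs_le.1 (hle y)).2)
  set Q : ℝ → ℝ := fun η => slopePotential k M g x η - slopePotential k M g x (-η) with hQ
  set W : ℝ → ℝ := fun η => 4 * M * boundPrimitive (M ^ 2) (Real.tanh (k * η / 2)) with hW
  have hWd : ∀ η, HasDerivAt W (2 * (k * ((1 - Real.tanh (k * η / 2) ^ 2)
        * (M * boundPoly (M ^ 2) (Real.tanh (k * η / 2)))))) η := by
    intro η
    have h1 : HasDerivAt (fun η : ℝ => k * η / 2) (k / 2) η := by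
      simpa using ((hasDerivAt_id η).const_mul k).div_const 2
    have h3 := ((hasDerivAt_boundPrimitive (M ^ 2) (Real.tanh (k * η / 2))).comp η
      ((hasDerivAt_tanh (k * η / 2)).comp η h1)).const_mul (4 * M)
    exact h3.congr_deriv (by ring)
  have hQd : ∀ η, η ≠ 0 → HasDerivAt Q
      ((k * secondVariation M (k * η) (k * (g x - g (x - η))) (k * (g x + g (x - η)))
        - slopeIntegrand k g x η) +
      (k * secondVariation M (k * (-η)) (k * (g x - g (x - -η))) (k * (g x + g (x - -η)))
        - slopeIntegrand k g x (-η))) η := by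
    intro η hη
    have e1 := hasDerivAt_slopePotential hk hg.contDiff hη hmax h2
    have e2 := (hasDerivAt_slopePotential hk hg.contDiff (neg_ne_zero.2 hη) hmax h2).comp η
      (hasDerivAt_neg η)
    exact (e1.fun_sub e2).congr_deriv (by ring)
  have hbound : ∀ ε R : ℝ, 0 < ε → ε < R →
      ∫ η in ε..R, (slopeIntegrand k g x η + slopeIntegrand k g x (-η))
        ≤ 4 * M * (239 / 120) - Q R + Q ε := by
    intro ε R hε hR
    have hpos : ∀ η ∈ Icc ε R, 0 < η := fun η hη => hε.trans_le hη.1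
    have haux : ∀ a b c d w : ℝ, a + b ≤ w → c + d ≤ w - ((a - c) + (b - d)) := by
      intros; linarith
    have h3 := intervalIntegral.integral_le_sub_of_hasDeriv_right_of_le (g := fun η => W η - Q η)
      hR.le
      (fun η hη => ((hWd η).fun_sub (hQd η (hpos η hη).ne')).continuousAt.continuousWithinAt)
      (fun η hη => ((hWd η).fun_sub
        (hQd η (hpos η (Ioo_subset_Icc_self hη)).ne')).hasDerivWithinAt)
      (((continuousOn_slopeSum hk hg.contDiff).mono fun η hη => hpos η hη).integrableOn_Icc)
      (fun η hη => haux _ _ _ _ _ (secondVariation_add_le hk hM0 hM1 hkS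
        (hg.contDiff.of_le (by norm_num)) hg.abs_apply_le hle (hpos η (Ioo_subset_Icc_self hη))))
    have hm1 : M ^ 2 ≤ 1 := by nlinarith
    have h4 : 0 ≤ W ε := by
      have := boundPrimitive_nonneg (sq_nonneg M) (tanh_nonneg (show 0 ≤ k * ε / 2 by positivity))
        (Real.tanh_lt_one _).le
      positivity
    have h5 : W R ≤ 4 * M * (239 / 120) := by
      have hmono : MonotoneOn (boundPrimitive (M ^ 2)) (Icc 0 1) := by
        apply monotoneOn_of_deriv_nonneg (convex_Icc 0 1)
        · exact fun z _ => (hasDerivAt_boundPrimitive _ z).continuousAt.continuousWithinAt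
        · exact fun z _ => (hasDerivAt_boundPrimitive _ z).differentiableAt.differentiableWithinAt
        · intro z hz
          rw [interior_Icc] at hz
          rw [(hasDerivAt_boundPrimitive _ z).deriv]
          exact boundPoly_nonneg (sq_nonneg M) hm1 hz.1.le hz.2.le
      have hT0 := tanh_nonneg (show 0 ≤ k * R / 2 by have : 0 < R := hε.trans hR
                                                     positivity)
      have := hmono ⟨hT0, (Real.tanh_lt_one _).le⟩ (right_mem_Icc.2 zero_le_one)
        (Real.tanh_lt_one _).le
      have h6 : boundPrimitive (M ^ 2) 1 = 239 / 120 := by unfold boundPrimitive; ring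
      rw [h6] at this
      simp only [hW]
      gcongr
    linarith
  have hQtop : Tendsto Q atTop (𝓝 (8 * M)) := by
    have h3 : Tendsto (fun η : ℝ => (24 * M + 4) * (2 / (k * η) ^ 2)) atTop (𝓝 0) := by
      have h4 : Tendsto (fun η : ℝ => (k * η) ^ 2) atTop atTop :=
        (tendsto_pow_atTop two_ne_zero).comp (tendsto_id.const_mul_atTop hk)
      have h5 := (h4.inv_tendsto_atTop.const_mul 2).const_mul (24 * M + 4)
      simp only [mul_zero] at h5
      exact h5
    have h4 : Tendsto (fun η => Q η - 8 * M) atTop (𝓝 0) := by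
      refine squeeze_zero_norm' ?_ h3
      filter_upwards [eventually_gt_atTop 0] with η hη
      refine (abs_slopePotential_sub_le hk hM0.le hle hη).trans ?_
      exact mul_le_mul_of_nonneg_left (inv_cosh_sub_one_le (by positivity)) (by positivity)
    simpa using h4.add_const (8 * M)
  have hQ0 : Tendsto Q (𝓝[>] 0) (𝓝 0) := by
    have h3 := tendsto_slopePotential_zero hk hg.contDiff hmax h2 (hg.cos_nonneg hk hkS' x x)
    have h4 : Tendsto (fun η : ℝ => -η) (𝓝[>] 0) (𝓝[≠] 0) := by
      refine tendsto_nhdsWithin_iff.2 ⟨?_, ?_⟩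
      · simpa using (continuous_neg.tendsto (0 : ℝ)).mono_left nhdsWithin_le_nhds
      · filter_upwards [self_mem_nhdsWithin] with ε hε
        exact neg_ne_zero.2 (ne_of_gt hε)
    have h5 := (h3.mono_left (nhdsWithin_mono 0 fun x hx => ne_of_gt hx)).sub (h3.comp h4)
    rw [sub_self] at h5
    exact h5
  have hlim := tendsto_intervalIntegral_Ioi (integrableOn_slopeSum (x := x) hk hkS' hg)
  have hlim2 : Tendsto (fun p : ℝ × ℝ => 4 * M * (239 / 120) - Q p.2 + Q p.1)
      ((𝓝[>] (0 : ℝ)) ×ˢ atTop) (𝓝 (4 * M * (239 / 120) - 8 * M + 0)) :=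
    ((hQtop.comp tendsto_snd).const_sub _).add (hQ0.comp tendsto_fst)
  have hfin := le_of_tendsto_of_tendsto hlim hlim2 (by
    have e1 : ∀ᶠ ε in 𝓝[>] (0 : ℝ), 0 < ε ∧ ε < 1 := by
      filter_upwards [Ioo_mem_nhdsGT one_pos] with ε hε using hε
    filter_upwards [e1.prod_mk (eventually_gt_atTop (1 : ℝ))] with p hp
    exact hbound p.1 p.2 hp.1.1 (hp.1.2.trans hp.2))
  linarith

end MaxSlope

theorem RegularFlow.eventually_slopeBounds {T S t₀ : ℝ} {f : ℝ → ℝ → ℝ} (hf : RegularFlow T f)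
    (ht₀ : t₀ ∈ Icc 0 T) (hS : ∀ t ∈ Icc 0 T, ∀ x, |f t x| ≤ S) :
    ∃ K, ∀ᶠ t in 𝓝[Icc 0 T] t₀, SlopeBounds S K (f t) := by
  have hbd : ∀ j : ℕ, j ≤ 2 → ∃ C, ∀ᶠ t in 𝓝[Icc 0 T] t₀, ∀ x, |iteratedDeriv j (f t) x| ≤ C := by
    intro j hj
    obtain ⟨C, hC⟩ := bounded_of_tendsto_cocompact
      ((hf.contDiff t₀ ht₀).continuous_iteratedDeriv j (by exact_mod_cast hj))
          (hf.decay t₀ ht₀ j hj)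
    refine ⟨C + 1, ?_⟩
    filter_upwards [Metric.tendstoUniformly_iff.1 (hf.uniform j hj t₀ ht₀) 1 one_pos] with t ht x
    have h1 := ht x
    rw [Real.dist_eq, abs_sub_comm] at h1
    have h2 := abs_sub_abs_le_abs_sub (iteratedDeriv j (f t) x) (iteratedDeriv j (f t₀) x)
    linarith [hC x]
  obtain ⟨C₁, h1⟩ := hbd 1 (by norm_num)
  obtain ⟨C₂, h2⟩ := hbd 2 le_rfl
  obtain ⟨C₃, h3⟩ := hf.holder t₀ ht₀
  refine ⟨max C₁ (max C₂ C₃), ?_⟩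
  have e2 : ∀ g : ℝ → ℝ, iteratedDeriv 2 g = deriv (deriv g) := fun g => by
    rw [iteratedDeriv_succ, iteratedDeriv_one]
  filter_upwards [h1, h2, h3, self_mem_nhdsWithin] with t h1 h2 h3 ht
  simp only [iteratedDeriv_one] at h1
  simp only [e2] at h2 h3
  refine ⟨hf.contDiff t ht, hS t ht, fun x => (h1 x).trans (le_max_left _ _),
    fun x => (h2 x).trans ((le_max_left _ _).trans (le_max_right _ _)),
        fun x y => (h3 x y).trans ?_⟩
  gcongr
  exact (le_max_right _ _).trans (le_max_right _ _)

theorem RegularFlow.tendsto_slopeIntegrand {T t₀ x₀ k η : ℝ} {f : ℝ → ℝ → ℝ} (hf : RegularFlow T f)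
    (ht₀ : t₀ ∈ Icc 0 T) (hk : 0 < k) (hη : η ≠ 0) :
    Tendsto (fun p : ℝ × ℝ => slopeIntegrand k (f p.1) p.2 η) (𝓝[Icc 0 T] t₀ ×ˢ 𝓝 x₀)
      (𝓝 (slopeIntegrand k (f t₀) x₀ η)) := by
  have hshift : Tendsto (fun p : ℝ × ℝ => (p.1, p.2 - η)) (𝓝[Icc 0 T] t₀ ×ˢ 𝓝 x₀)
      (𝓝[Icc 0 T] t₀ ×ˢ 𝓝 (x₀ - η)) :=
    tendsto_fst.prodMk (tendsto_snd.sub_const η)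
  have e2 : ∀ g : ℝ → ℝ, iteratedDeriv 2 g = deriv (deriv g) := fun g => by
    rw [iteratedDeriv_succ, iteratedDeriv_one]
  have h0 : ∀ y, Tendsto (fun p : ℝ × ℝ => f p.1 p.2) (𝓝[Icc 0 T] t₀ ×ˢ 𝓝 y) (𝓝 (f t₀ y)) :=
    fun y => tendsto_prod_of_tendstoUniformly (hf.contDiff t₀ ht₀).continuous
      (by simpa using hf.uniform 0 (by simp) t₀ ht₀)
  have h1 : ∀ y, Tendsto (fun p : ℝ × ℝ => deriv (f p.1) p.2) (𝓝[Icc 0 T] t₀ ×ˢ 𝓝 y)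
      (𝓝 (deriv (f t₀) y)) :=
    fun y => tendsto_prod_of_tendstoUniformly (u := fun t => deriv (f t))
      ((hf.contDiff t₀ ht₀).continuous_deriv (by norm_num))
      (by simpa using hf.uniform 1 (by simp) t₀ ht₀)
  have h2 : ∀ y, Tendsto (fun p : ℝ × ℝ => deriv (deriv (f p.1)) p.2) (𝓝[Icc 0 T] t₀ ×ˢ 𝓝 y)
      (𝓝 (deriv (deriv (f t₀)) y)) :=
    fun y => tendsto_prod_of_tendstoUniformly (u := fun t => deriv (deriv (f t)))
      ((contDiff_deriv (n := 1) (hf.contDiff t₀ ht₀)).continuous_deriv le_rfl)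
      (by simpa [e2] using hf.uniform 2 le_rfl t₀ ht₀)
  have a0 := h0 x₀
  have a1 := h1 x₀
  have a2 := h2 x₀
  have b0 := (h0 (x₀ - η)).comp hshift
  have b1 := (h1 (x₀ - η)).comp hshift
  have b2 := (h2 (x₀ - η)).comp hshift
  have hδ := (a0.sub b0).const_mul k
  have hσ := (a0.add b0).const_mul k
  have hD := ((Real.continuous_cos.tendsto _).comp hδ).const_sub (Real.cosh (k * η))
  have hE := ((Real.continuous_cos.tendsto _).comp hσ).const_add (Real.cosh (k * η))
  have hs1 := ((Real.continuous_sin.tendsto _).comp hδ).const_mul (k * Real.sinh (k * η))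
  have hs2 := ((Real.continuous_sin.tendsto _).comp hσ).const_mul (k * Real.sinh (k * η))
  have d1 := (cosh_sub_cos_pos (a := k * (f t₀ x₀ - f t₀ (x₀ - η))) hk hη)
  have d2 := (cosh_add_cos_pos (a := k * (f t₀ x₀ + f t₀ (x₀ - η))) hk hη)
  have hs : Tendsto (fun _ : ℝ × ℝ => Real.sinh (k * η)) (𝓝[Icc 0 T] t₀ ×ˢ 𝓝 x₀)
    (𝓝 (Real.sinh (k * η))) := tendsto_const_nhds
  exact ((((a2.sub b2).mul (hs.div hD d1.ne')).sub
    (((a1.sub b1).pow 2).mul (hs1.div (hD.pow 2) (pow_pos d1 2).ne'))).add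
    ((a2.add b2).mul (hs.div hE d2.ne'))).add
    (((a1.add b1).pow 2).mul (hs2.div (hE.pow 2) (pow_pos d2 2).ne'))

/-- The integrand of the contour equation, symmetrized in `η`. -/
def muskatSum (l : ℝ) (g : ℝ → ℝ) (x η : ℝ) : ℝ :=
  muskatIntegrand l g x η + muskatIntegrand l g x (-η)

theorem exists_muskatSum_sub_eq {l x y η : ℝ} {g : ℝ → ℝ} (hl : 0 < l) (hg : ContDiff ℝ 2 g)
    (hη : η ≠ 0) (hxy : x < y) :
    ∃ z ∈ Ioo x y, slopeIntegrand (Real.pi / (2 * l)) g z η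
      + slopeIntegrand (Real.pi / (2 * l)) g z (-η)
      = (muskatSum l g y η - muskatSum l g x η) / (y - x) := by
  have hd : ∀ z, HasDerivAt (fun z => muskatSum l g z η)
      (slopeIntegrand (Real.pi / (2 * l)) g z η + slopeIntegrand (Real.pi / (2 * l)) g z (-η)) z :=
    fun z => (hasDerivAt_muskatIntegrand hl hg hη).fun_add
      (hasDerivAt_muskatIntegrand hl hg (neg_ne_zero.2 hη))
  exact exists_hasDerivAt_eq_slope (fun z => muskatSum l g z η) _ hxy
    (fun z _ => (hd z).continuousAt.continuousWithinAt) (fun z _ => hd z)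

theorem continuousOn_muskatIntegrand {l x : ℝ} {g : ℝ → ℝ} (hl : 0 < l) (hg : ContDiff ℝ 1 g) :
    ContinuousOn (muskatIntegrand l g x) {0}ᶜ := by
  have hk : 0 < Real.pi / (2 * l) := by have := Real.pi_pos; positivity
  have c0 := hg.continuous
  have c1 := hg.continuous_deriv le_rfl
  unfold muskatIntegrand kernelOne kernelTwo
  refine (ContinuousOn.mul ?_ (ContinuousOn.div ?_ ?_ ?_)).add
    (ContinuousOn.mul ?_ (ContinuousOn.div ?_ ?_ ?_))
  any_goals exact Continuous.continuousOn (by fun_prop)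
  · exact fun η hη => (cosh_sub_cos_pos hk hη).ne'
  · exact fun η hη => (cosh_add_cos_pos hk hη).ne'

theorem continuousOn_muskatSum {l x : ℝ} {g : ℝ → ℝ} (hl : 0 < l) (hg : ContDiff ℝ 1 g) :
    ContinuousOn (muskatSum l g x) (Ioi 0) :=
  ((continuousOn_muskatIntegrand hl hg).mono fun _ hη => ne_of_gt hη).add
    ((continuousOn_muskatIntegrand hl hg).comp continuousOn_neg
      fun _ hη => neg_ne_zero.2 (ne_of_gt hη))

theorem tendsto_integral_muskatSum {l x I : ℝ} {g : ℝ → ℝ} (hl : 0 < l) (hg : ContDiff ℝ 1 g)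
    (hI : HasPVIntegral (muskatIntegrand l g x) I) :
    Tendsto (fun p : ℝ × ℝ => ∫ η in p.1..p.2, muskatSum l g x η)
      ((𝓝[>] (0 : ℝ)) ×ˢ atTop) (𝓝 I) := by
  refine Tendsto.congr' ?_ hI
  have hpos : ∀ᶠ ε in 𝓝[>] (0 : ℝ), 0 < ε := self_mem_nhdsWithin
  filter_upwards [hpos.prod_mk (eventually_gt_atTop (0 : ℝ))] with p hp
  have hne : ∀ η ∈ uIcc p.1 p.2, η ≠ 0 := fun η hη =>
    ne_zero_of_mem_uIcc (mul_pos hp.1 hp.2) hη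
  have h1 : ContinuousOn (muskatIntegrand l g x) (uIcc p.1 p.2) :=
    (continuousOn_muskatIntegrand hl hg).mono fun η hη => hne η hη
  have h2 : ContinuousOn (fun η => muskatIntegrand l g x (-η)) (uIcc p.1 p.2) :=
    (continuousOn_muskatIntegrand hl hg).comp continuousOn_neg fun η hη => neg_ne_zero.2 (hne η hη)
  unfold muskatSum
  rw [intervalIntegral.integral_add h1.intervalIntegrable h2.intervalIntegrable,
    intervalIntegral.integral_comp_neg, add_comm]

theorem pvIntegral_sub_eq {l S K x y I J : ℝ} {g : ℝ → ℝ} (hl : 0 < l)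
    (hkS : Real.pi / (2 * l) * S ≤ Real.pi / 4) (hg : SlopeBounds S K g) (hxy : x < y)
    (hI : HasPVIntegral (muskatIntegrand l g x) I) (hJ : HasPVIntegral (muskatIntegrand l g y) J) :
    J - I = ∫ η in Ioi 0, (muskatSum l g y η - muskatSum l g x η) := by
  have hk : 0 < Real.pi / (2 * l) := by have := Real.pi_pos; positivity
  have hg1 : ContDiff ℝ 1 g := hg.contDiff.of_le (by norm_num)
  have hc := fun z => continuousOn_muskatSum (x := z) hl hg1
  obtain ⟨B, hB, hle⟩ := exists_integrable_bound hk hkS K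
  have hint : IntegrableOn (fun η => muskatSum l g y η - muskatSum l g x η) (Ioi 0) := by
    refine Integrable.mono' (hB.const_mul (y - x))
      (((hc y).sub (hc x)).aestronglyMeasurable measurableSet_Ioi) ?_
    filter_upwards [ae_restrict_mem measurableSet_Ioi] with η hη
    obtain ⟨z, -, hz⟩ := exists_muskatSum_sub_eq hl hg.contDiff (ne_of_gt hη) hxy
    have h1 := hle g hg z η hη
    rw [hz, abs_div, abs_of_pos (sub_pos.2 hxy), div_le_iff₀ (sub_pos.2 hxy)] at h1
    rw [Real.norm_eq_abs]
    linarith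
  have h1 := tendsto_intervalIntegral_Ioi hint
  have h2 := (tendsto_integral_muskatSum hl hg1 hJ).sub (tendsto_integral_muskatSum hl hg1 hI)
  refine tendsto_nhds_unique (h2.congr' ?_) h1
  have hpos : ∀ᶠ ε in 𝓝[>] (0 : ℝ), 0 < ε := self_mem_nhdsWithin
  filter_upwards [hpos.prod_mk (eventually_gt_atTop (0 : ℝ))] with p hp
  have hsub : uIcc p.1 p.2 ⊆ Ioi 0 := fun η hη => (lt_min hp.1 hp.2).trans_le hη.1
  exact (intervalIntegral.integral_sub ((hc y).mono hsub).intervalIntegrable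
    ((hc x).mono hsub).intervalIntegrable).symm

theorem RegularFlow.tendsto_slope_muskatSum {T S t₀ x₀ l : ℝ} {f : ℝ → ℝ → ℝ}
    (hf : RegularFlow T f) (hl : 0 < l) (hkS : Real.pi / (2 * l) * S ≤ Real.pi / 4)
    (ht₀ : t₀ ∈ Icc 0 T) (hS : ∀ t ∈ Icc 0 T, ∀ x, |f t x| ≤ S) :
    Tendsto (fun p : ℝ × (ℝ × ℝ) => ∫ η in Ioi 0,
        (muskatSum l (f p.1) (p.2.1 + p.2.2) η - muskatSum l (f p.1) p.2.1 η) / p.2.2)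
      (𝓝[Icc 0 T] t₀ ×ˢ (𝓝 x₀ ×ˢ 𝓝[>] 0))
      (𝓝 (∫ η in Ioi 0, (slopeIntegrand (Real.pi / (2 * l)) (f t₀) x₀ η
        + slopeIntegrand (Real.pi / (2 * l)) (f t₀) x₀ (-η)))) := by
  have hk : 0 < Real.pi / (2 * l) := by have := Real.pi_pos; positivity
  obtain ⟨K, hK⟩ := hf.eventually_slopeBounds ht₀ hS
  obtain ⟨B, hB, hle⟩ := exists_integrable_bound hk hkS K
  have hpos : ∀ᶠ h in 𝓝[>] (0 : ℝ), 0 < h := self_mem_nhdsWithin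
  have hev : ∀ᶠ p : ℝ × (ℝ × ℝ) in 𝓝[Icc 0 T] t₀ ×ˢ (𝓝 x₀ ×ˢ 𝓝[>] 0),
      SlopeBounds S K (f p.1) ∧ 0 < p.2.2 :=
    hK.prod_mk (hpos.prod_inr _)
  have hmv : ∀ {g : ℝ → ℝ} {x h η : ℝ}, ContDiff ℝ 2 g → 0 < h → 0 < η → ∃ z ∈ Ioo x (x + h),
      slopeIntegrand (Real.pi / (2 * l)) g z η + slopeIntegrand (Real.pi / (2 * l)) g z (-η)
        = (muskatSum l g (x + h) η - muskatSum l g x η) / h := by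
    intro g x h η hg hh hη
    obtain ⟨z, hz, hz'⟩ := exists_muskatSum_sub_eq hl hg hη.ne' (lt_add_of_pos_right x hh)
    exact ⟨z, hz, by rw [hz', add_sub_cancel_left]⟩
  refine tendsto_integral_filter_of_dominated_convergence B ?_ ?_ hB ?_
  · filter_upwards [hev] with p hp
    have hg1 : ContDiff ℝ 1 (f p.1) := hp.1.contDiff.of_le (by norm_num)
    exact (((continuousOn_muskatSum hl hg1).sub (continuousOn_muskatSum hl hg1)).div_const
      _).aestronglyMeasurable measurableSet_Ioi
  · filter_upwards [hev] with p hp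
    filter_upwards [ae_restrict_mem measurableSet_Ioi] with η hη
    obtain ⟨z, -, hz⟩ := hmv (x := p.2.1) hp.1.contDiff hp.2 hη
    rw [Real.norm_eq_abs, ← hz]
    exact hle _ hp.1 z η hη
  · filter_upwards [ae_restrict_mem measurableSet_Ioi] with η hη
    have hη : 0 < η := hη
    have hlim := (hf.tendsto_slopeIntegrand (x₀ := x₀) ht₀ hk hη.ne').add
      (hf.tendsto_slopeIntegrand (x₀ := x₀) ht₀ hk (neg_ne_zero.2 hη.ne'))
    rw [Metric.tendsto_nhds] at hlim ⊢
    intro ε hε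
    obtain ⟨pa, hpa, pb, hpb, hab⟩ := eventually_prod_iff.1 (hlim ε hε)
    obtain ⟨r, hr, hball⟩ := Metric.eventually_nhds_iff_ball.1 hpb
    have hx : ∀ᶠ x in 𝓝 x₀, x ∈ Metric.ball x₀ (r / 2) := Metric.ball_mem_nhds x₀ (half_pos hr)
    have hh : ∀ᶠ h in 𝓝[>] (0 : ℝ), h < r / 2 :=
      mem_nhdsWithin_of_mem_nhds (Iio_mem_nhds (half_pos hr))
    filter_upwards [hev, hpa.prod_mk (hx.prod_mk hh)] with p hp hp'
    obtain ⟨z, hz, hz'⟩ := hmv (x := p.2.1) hp.1.contDiff hp.2 hη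
    rw [← hz']
    refine hab hp'.1 (hball z ?_)
    have h1 := hp'.2.1
    rw [Metric.mem_ball, Real.dist_eq, abs_lt] at h1 ⊢
    constructor <;> linarith [hz.1, hz.2, hp'.2.2]

theorem IsClassicalSolution.abs_deriv_le {l ρ₁ ρ₂ T S M : ℝ} {f₀ : ℝ → ℝ} {f : ℝ → ℝ → ℝ}
    (hf : IsClassicalSolution l ρ₁ ρ₂ T f₀ f) (hl : 0 < l) (hρ : ρ₁ < ρ₂) (hM0 : 0 < M)
    (hM1 : M ≤ 1) (hkS : Real.pi / (2 * l) * S ≤ Real.arctan M)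
    (hS : ∀ t ∈ Icc 0 T, ∀ x, |f t x| ≤ S) (h0 : ∀ x, |deriv f₀ x| ≤ M) :
    ∀ t ∈ Icc 0 T, ∀ x, |deriv (f t) x| ≤ M := by
  have hk : 0 < Real.pi / (2 * l) := by have := Real.pi_pos; positivity
  have hkS' : Real.pi / (2 * l) * S ≤ Real.pi / 4 := by
    rw [← Real.arctan_one]
    exact hkS.trans (Real.arctan_strictMono.monotone hM1)
  have hup : ∀ {g₀ : ℝ → ℝ} {g : ℝ → ℝ → ℝ}, IsClassicalSolution l ρ₁ ρ₂ T g₀ g →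
      (∀ t ∈ Icc 0 T, ∀ x, |g t x| ≤ S) →
      ∀ t₀ ∈ Ico 0 T, (∀ x, |deriv (g t₀) x| ≤ M) → ∀ x₀, deriv (g t₀) x₀ = M →
      ∀ᶠ p in 𝓝[Icc t₀ T] t₀ ×ˢ 𝓝 x₀, deriv (g p.1) p.2 ≤ M := by
    intro g₀ g hg hS t₀ ht₀ hle x₀ hx₀
    obtain ⟨gt, -, hev⟩ := hg.evolution
    have ht₀' : t₀ ∈ Icc 0 T := ⟨ht₀.1, ht₀.2.le⟩
    have hR := hg.regularFlow
    obtain ⟨K, hK⟩ := hR.eventually_slopeBounds ht₀' hS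
    have hneg := integral_slopeSum_neg (x := x₀) hk hM0 hM1 hkS
      (hK.self_of_nhdsWithin ht₀') hle hx₀
    have hlim := (hR.tendsto_slope_muskatSum (x₀ := x₀) hl hkS' ht₀' hS).eventually
      (gt_mem_nhds hneg)
    have hmono : 𝓝[Icc t₀ T] t₀ ≤ 𝓝[Icc 0 T] t₀ :=
      nhdsWithin_mono _ (Icc_subset_Icc_left ht₀.1)
    have hpos : ∀ᶠ h in 𝓝[>] (0 : ℝ), 0 < h := self_mem_nhdsWithin
    have hmem : ∀ᶠ t in 𝓝[Icc 0 T] t₀, t ∈ Icc 0 T := self_mem_nhdsWithin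
    have hdec : ∀ᶠ p : ℝ × (ℝ × ℝ) in 𝓝[Icc t₀ T] t₀ ×ˢ (𝓝 x₀ ×ˢ 𝓝[>] 0),
        gt p.1 (p.2.1 + p.2.2) - gt p.1 p.2.1 ≤ 0 := by
      refine Eventually.filter_mono (prod_mono_left _ hmono) ?_
      filter_upwards [hlim, (hK.and hmem).prod_mk (hpos.prod_inr (𝓝 x₀))] with p hp hp'
      obtain ⟨⟨hb, ht⟩, hh⟩ := hp'
      obtain ⟨-, J, hJ, hgJ⟩ := hev p.1 ht (p.2.1 + p.2.2)
      obtain ⟨-, I, hI, hgI⟩ := hev p.1 ht p.2.1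
      have h1 := pvIntegral_sub_eq hl hkS' hb (lt_add_of_pos_right _ hh) hI hJ
      rw [integral_div, ← h1, div_lt_iff₀ hh, zero_mul] at hp
      rw [hgJ, hgI, ← mul_sub]
      exact mul_nonpos_of_nonneg_of_nonpos (div_nonneg (by linarith) (by linarith)) hp.le
    have hdiff := eventually_le_of_deriv_nonpos (A := 𝓝 x₀ ×ˢ 𝓝[>] (0 : ℝ)) ht₀
      (v := fun t a => g t (a.1 + a.2) - g t a.1) (vt := fun t a => gt t (a.1 + a.2) - gt t a.1)
      (fun t ht a => (hev t ht _).1.fun_sub (hev t ht _).1) hdec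
    obtain ⟨pa, hpa, pb, hpb, hab⟩ := eventually_prod_iff.1 hdiff
    have hmem' : ∀ᶠ t in 𝓝[Icc t₀ T] t₀, t ∈ Icc 0 T := hmono hmem
    filter_upwards [(hpa.and hmem').prod_mk hpb.curry] with p hp
    obtain ⟨⟨hp1, ht⟩, hp2⟩ := hp
    have hd := ((hR.contDiff p.1 ht).differentiable (by norm_num) p.2).hasDerivAt
    refine le_of_tendsto hd.tendsto_slope_zero_right ?_
    filter_upwards [hp2, hpos] with h hh hh0
    have h1 := hab hp1 hh
    have h2 := abs_sub_le_of_deriv_le ((hR.contDiff t₀ ht₀').of_le (by norm_num)) hle (p.2 + h) p.2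
    rw [add_sub_cancel_left, abs_of_pos hh0] at h2
    have h3 := (abs_le.1 h2).2
    rw [smul_eq_mul, inv_mul_le_iff₀ hh0]
    simp only at h1
    linarith
  have hR := hf.regularFlow
  refine abs_le_of_not_crossed (u := fun t => deriv (f t)) hM0
    (fun t ht => (hR.contDiff t ht).continuous_deriv (by norm_num))
    (fun t ht => by simpa using hR.decay t ht 1 (by simp))
    (fun t ht => by simpa using hR.uniform 1 (by simp) t ht) (by rwa [hf.initial])
    (fun t₀ ht₀ hle x₀ hx₀ => hup hf hS t₀ ht₀ hle x₀ hx₀) ?_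
  intro t₀ ht₀ hle x₀ hx₀
  have hneg : ∀ t x, deriv (-f t) x = -deriv (f t) x := fun t x => deriv.neg
  filter_upwards [hup hf.neg (by simpa using hS) t₀ ht₀ (by simpa [hneg] using hle) x₀
    (by simp [hneg, hx₀])] with p hp
  rw [hneg] at hp
  linarith

theorem eLpNorm_top_le {g : ℝ → ℝ} {M : ℝ} (h : ∀ x, |g x| ≤ M) :
    eLpNorm g ⊤ volume ≤ ENNReal.ofReal M := by
  rw [eLpNorm_exponent_top]
  exact eLpNormEssSup_le_of_ae_bound (Eventually.of_forall h)

theorem abs_le_linfNorm {g : ℝ → ℝ} (hg : Continuous g) (hfin : eLpNorm g ⊤ volume ≠ ⊤) (x : ℝ) :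
    |g x| ≤ linfNorm g := by
  have h1 : ∀ᵐ x, |g x| ≤ linfNorm g := by
    rw [linfNorm, eLpNorm_exponent_top] at *
    filter_upwards [ae_le_eLpNormEssSup (f := g) (μ := volume)] with x hx
    have := ENNReal.toReal_mono hfin hx
    simpa using this
  have h2 : IsOpen {x | linfNorm g < |g x|} := isOpen_lt continuous_const hg.abs
  have h3 : {x | linfNorm g < |g x|} = ∅ := by
    apply h2.eq_empty_of_measure_zero (μ := volume)
    simpa [ae_iff] using h1
  by_contra hx
  have : x ∈ {x | linfNorm g < |g x|} := not_le.1 hx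
  rw [h3] at this
  exact this

theorem tanh_pos {x : ℝ} (hx : 0 < x) : 0 < Real.tanh x := by
  rw [Real.tanh_eq_sinh_div_cosh]
  exact div_pos (Real.sinh_pos_iff.2 hx) (Real.cosh_pos x)

/-- The slope stays below `M ≤ 1` if it does so initially and `‖f₀‖ ≤ (2l/π) arctan M`. -/
theorem IsClassicalSolution.abs_deriv_le_of_initial {l ρ₁ ρ₂ T M : ℝ} {f₀ : ℝ → ℝ} {f : ℝ → ℝ → ℝ}
    (hf : IsClassicalSolution l ρ₁ ρ₂ T f₀ f) (hl : 0 < l) (hρ : ρ₁ < ρ₂) (hM0 : 0 < M)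
    (hM1 : M ≤ 1) (h0 : ∀ x, Real.pi / (2 * l) * |f₀ x| ≤ Real.arctan M)
    (h1 : ∀ x, |deriv f₀ x| ≤ M) :
    ∀ t ∈ Icc 0 T, ∀ x, |deriv (f t) x| ≤ M := by
  have hk : 0 < Real.pi / (2 * l) := by have := Real.pi_pos; positivity
  have hkS : Real.pi / (2 * l) * (Real.arctan M / (Real.pi / (2 * l))) = Real.arctan M :=
    mul_div_cancel₀ _ hk.ne'
  have hat : 0 < Real.arctan M := Real.arctan_pos.2 hM0
  refine hf.abs_deriv_le hl hρ hM0 hM1 hkS.le ?_ h1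
  refine hf.abs_apply_le hl hρ (div_pos hat hk) ?_ fun x => ?_
  · rw [hkS, ← Real.arctan_one]
    exact Real.arctan_strictMono.monotone hM1
  · rw [le_div_iff₀ hk, mul_comm]
    exact h0 x

theorem IsThresholdPair.lt_half {l x y : ℝ} (hl : 0 < l) (h : IsThresholdPair l x y) :
    x < l / 2 := by
  have hpi := Real.pi_pos
  have hx := h.x_pos
  have hy := h.y_pos
  have hτ : 0 < Real.tanh (Real.pi / (4 * l)) := tanh_pos (by positivity)
  have e1 : Real.pi * x / (2 * l) = Real.pi / (2 * l) * x := by ring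
  have htan : 0 < Real.tan (Real.pi / (2 * l) * x) := by
    have := h.eq_one
    rw [e1] at this
    have := mul_pos hy hτ
    linarith
  have htan2 : 0 ≤ Real.tan (Real.pi / (2 * l) * (y / 2)) := by
    apply Real.tan_nonneg_of_nonneg_of_le_pi_div_two (by positivity)
    rw [div_mul_eq_mul_div, div_le_div_iff₀ (by positivity) two_pos]
    nlinarith [h.y_lt]
  have h2 := h.eq_two
  unfold smallnessFun at h2
  have hfirst : 0 ≤ (y + |2 * (Real.cos (Real.pi / (2 * l)) - 2)
      * (1 / Real.cos (Real.pi / (4 * l))) ^ 4| * y ^ 3)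
      * ((1 + y * (y + Real.tan (Real.pi / (2 * l) * (y / 2)) / Real.tanh (Real.pi / (4 * l))))
          / (6 * Real.tanh (Real.pi / (4 * l)))) * (Real.pi / (2 * l)) ^ 5 := by positivity
  have hcos : 0 < y * Real.cos (Real.pi / l * x) := by nlinarith
  have hcos' := (mul_pos_iff_of_pos_left hy).1 hcos
  by_contra hge
  push Not at hge
  have h3 : Real.pi / 2 ≤ Real.pi / l * x := by
    rw [div_mul_eq_mul_div, div_le_div_iff₀ two_pos hl]
    nlinarith
  have h4 : Real.pi / l * x ≤ Real.pi := by
    rw [div_mul_eq_mul_div, div_le_iff₀ hl]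
    nlinarith [h.x_lt]
  linarith [Real.cos_nonpos_of_pi_div_two_le_of_le h3 (by linarith)]

end Muskat

end

theorem mainTheorem3 (l ρ₁ ρ₂ T : ℝ) (hl : 0 < l) (hρ : ρ₁ < ρ₂) (hT : 0 < T)
    (f₀ : ℝ → ℝ) (hf₀ : Muskat.MemHl 3 l f₀)
    (f : ℝ → ℝ → ℝ) (hf : Muskat.IsClassicalSolution l ρ₁ ρ₂ T f₀ f) :
    (Muskat.linfNorm (deriv f₀) ≤ 1 →
      Real.tan (Real.pi * Muskat.linfNorm f₀ / (2 * l))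
        < Muskat.linfNorm (deriv f₀) * Real.tanh (Real.pi / (4 * l)) →
      Muskat.smallnessFun l (Muskat.linfNorm f₀) (Muskat.linfNorm (deriv f₀)) ≤ 0 →
      ∀ t ∈ Set.Icc 0 T,
        MeasureTheory.eLpNorm (deriv (f t)) ⊤ MeasureTheory.volume
          ≤ MeasureTheory.eLpNorm (deriv f₀) ⊤ MeasureTheory.volume) ∧
    (∀ x y : ℝ, Muskat.IsThresholdPair l x y →
      Muskat.linfNorm f₀ < x →
      Muskat.linfNorm (deriv f₀) < y →
      Muskat.linfNorm (deriv f₀) ≤ 1 →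
      ∀ t ∈ Set.Icc 0 T,
        MeasureTheory.eLpNorm (deriv (f t)) ⊤ MeasureTheory.volume ≤ 1) := by
  have hpi := Real.pi_pos
  have hk : 0 < Real.pi / (2 * l) := by positivity
  have hR := hf.regularFlow
  have h0T : (0 : ℝ) ∈ Set.Icc 0 T := ⟨le_rfl, hT.le⟩
  have hC2 := hR.contDiff 0 h0T
  have hd1 := hR.decay 0 h0T 1 (by simp)
  rw [hf.initial] at hC2 hd1
  rw [iteratedDeriv_one] at hd1
  have hcd : Continuous (deriv f₀) := hC2.continuous_deriv (by norm_num)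
  obtain ⟨C, hC⟩ := Muskat.bounded_of_tendsto_cocompact hcd hd1
  have hfin : MeasureTheory.eLpNorm (deriv f₀) ⊤ MeasureTheory.volume ≠ ⊤ :=
    ((Muskat.eLpNorm_top_le hC).trans_lt ENNReal.ofReal_lt_top).ne
  have hb := Muskat.abs_le_linfNorm hcd hfin
  have ha := Muskat.abs_le_linfNorm hC2.continuous (hf₀.2.trans ENNReal.ofReal_lt_top).ne
  have hal : Muskat.linfNorm f₀ < l := by
    have := ENNReal.toReal_strict_mono ENNReal.ofReal_ne_top hf₀.2
    rwa [ENNReal.toReal_ofReal hl.le] at this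
  have ha0 : 0 ≤ Muskat.linfNorm f₀ := ENNReal.toReal_nonneg
  refine ⟨fun hM1 htan _ t ht => ?_, fun x y hxy hax _ hM1 t ht => ?_⟩
  · have e1 : Real.pi * Muskat.linfNorm f₀ / (2 * l) = Real.pi / (2 * l) * Muskat.linfNorm f₀ := by
      ring
    rw [e1] at htan
    have h1 : Real.pi / (2 * l) * Muskat.linfNorm f₀ < Real.pi / 2 := by
      rw [div_mul_eq_mul_div, div_lt_div_iff₀ (by positivity) two_pos]
      nlinarith
    have h2 : 0 ≤ Real.pi / (2 * l) * Muskat.linfNorm f₀ := by positivity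
    have h3 := Real.tan_nonneg_of_nonneg_of_le_pi_div_two h2 h1.le
    have hτ : 0 < Real.tanh (Real.pi / (4 * l)) := Muskat.tanh_pos (by positivity)
    have hM0 : 0 < Muskat.linfNorm (deriv f₀) :=
      pos_of_mul_pos_left (h3.trans_lt htan) hτ.le
    have h4 : Real.tan (Real.pi / (2 * l) * Muskat.linfNorm f₀) ≤ Muskat.linfNorm (deriv f₀) := by
      nlinarith [Real.tanh_lt_one (Real.pi / (4 * l))]
    have h5 : Real.pi / (2 * l) * Muskat.linfNorm f₀ ≤ Real.arctan (Muskat.linfNorm (deriv f₀)) := by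
      rw [← Real.arctan_tan (by linarith) h1]
      exact Real.arctan_strictMono.monotone h4
    have h6 := hf.abs_deriv_le_of_initial hl hρ hM0 hM1
      (fun x => (mul_le_mul_of_nonneg_left (ha x) hk.le).trans h5) hb t ht
    refine (Muskat.eLpNorm_top_le h6).trans ?_
    rw [Muskat.linfNorm, ENNReal.ofReal_toReal hfin]
  · have h1 : Real.pi / (2 * l) * (l / 2) = Real.arctan 1 := by
      rw [Real.arctan_one]; field_simp; norm_num
    have h2 := hf.abs_deriv_le_of_initial hl hρ one_pos le_rfl
      (fun z => (mul_le_mul_of_nonneg_left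
        ((ha z).trans (hax.le.trans (hxy.lt_half hl).le)) hk.le).trans h1.le)
      (fun z => (hb z).trans hM1) t ht
    simpa using Muskat.eLpNorm_top_le h2
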